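/- Let $w_1,\dots,w_n$ ($n\ge 1$) be positive real weights. A prefix-free code is a sequence of $n$ binary codewords none of which is a prefix of another one; it is optimal if, with $\ell_i$ the length of the $i$th codeword, the sum $\sum_{i=1}^n \ell_i w_i$ is minimal among all prefix-free codes of size $n$. The tree of a code is the rooted binary tree whose nodes are all prefixes of the codewords, so that the codewords are its leaves. A perfect tree is a binary tree in which every node has two children or none and all leaves have the same depth. The skeleton tree of a tree is obtained by shrinking each of its maximal perfect subtrees to its root, i.e. removing all other nodes of that subtree. An optimal skeleton tree for $w_1,\dots,w_n$ is a skeleton tree with the least number of nodes among the skeleton trees of the trees of all optimal prefix-free codes for $w_1,\dots,w_n$. Theorem. There is an algorithm that, given $n\ge 1$ and positive real weights $w_1,\dots,w_n$, constructs an optimal skeleton tree for $w_1,\dots,w_n$, together with an optimal prefix-free code from whose tree it arises, in $O(n^3)$ time. The algorithm is a fixed program for a random access machine with words of $O(\log n)$ bits and unit-cost integer arithmetic, which can moreover copy, add and compare weights at unit cost; it outputs the skeleton tree and the code tree as linked structures. -/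

import Mathlib

namespace SkeletonCode

/-! Binary words are lists of Booleans (`false` = left edge, `true` = right edge).  A rooted binary
tree is given by its set of nodes, a node being identified with the word read on the path from the
root to it.  The depth of a node is the length of its word, the descendants of `r` in the tree `N`
(including `r`) are the `p ∈ N` having `r` as a prefix, and `<+:` is the prefix order. -/

/-- No codeword is a prefix of another codeword. -/
def PrefixFree {n : ℕ} (c : Fin n → List Bool) : Prop :=
  ∀ i j, i ≠ j → ¬ c i <+: c j

/-- The total weighted length of a code. -/
def cost {n : ℕ} (w : Fin n → ℝ) (c : Fin n → List Bool) : ℝ :=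
  ∑ i, ((c i).length : ℝ) * w i

/-- A prefix-free code whose cost is minimal among all prefix-free codes. -/
def IsOptimalCode {n : ℕ} (w : Fin n → ℝ) (c : Fin n → List Bool) : Prop :=
  PrefixFree c ∧ ∀ c' : Fin n → List Bool, PrefixFree c' → cost w c ≤ cost w c'

/-- The tree formed by a code: its nodes are all the prefixes of the codewords (if the code is
prefix-free, the leaves are exactly the codewords). -/
def codeTree {n : ℕ} (c : Fin n → List Bool) : Set (List Bool) :=
  {p | ∃ i, p <+: c i}

/-- `p` is a node of the tree `N` without children. -/
def IsLeaf (N : Set (List Bool)) (p : List Bool) : Prop :=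
  p ∈ N ∧ ∀ b : Bool, p ++ [b] ∉ N

/-- The subtree of `N` rooted at its node `r` is perfect: it is full (every node has two children
or none) and all its leaves have the same depth. -/
def PerfectAt (N : Set (List Bool)) (r : List Bool) : Prop :=
  r ∈ N ∧
  (∀ p ∈ N, r <+: p → (p ++ [false] ∈ N ↔ p ++ [true] ∈ N)) ∧
  ∀ p q, IsLeaf N p → IsLeaf N q → r <+: p → r <+: q → p.length = q.length

/-- The subtree of `N` rooted at `r` is a maximal perfect subtree. -/
def MaximalPerfectAt (N : Set (List Bool)) (r : List Bool) : Prop :=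
  PerfectAt N r ∧ ∀ r', PerfectAt N r' → r' <+: r → r' = r

/-- The skeleton tree of `N`: every maximal perfect subtree is shrunk, that is, all its nodes
except its root are removed. -/
def skeleton (N : Set (List Bool)) : Set (List Bool) :=
  {p | p ∈ N ∧ ∀ r, MaximalPerfectAt N r → r <+: p → p = r}

/-- The skeleton tree of the code `c` is an optimal skeleton tree for the weights `w`: `c` is an
optimal prefix-free code, and no optimal prefix-free code has a skeleton tree with fewer nodes. -/
def HasOptimalSkeleton {n : ℕ} (w : Fin n → ℝ) (c : Fin n → List Bool) : Prop :=
  IsOptimalCode w c ∧ ∀ c' : Fin n → List Bool, IsOptimalCode w c' →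
    (skeleton (codeTree c)).encard ≤ (skeleton (codeTree c')).encard

/-! The machine: a word RAM (integer arithmetic modulo the word modulus `B`) whose memory also has
cells for weights (real numbers).  Weights can only be copied, added and compared.  Programs are
structured programs over finitely many scalar variables and arrays; each elementary operation,
memory access, test and assignment takes one unit of time. -/

/-- Integer expressions. `get a i` is the entry number `i` of the integer array `a`. -/
inductive Expr : Type
  | const (k : ℕ)
  | var (x : ℕ)
  | get (a : ℕ) (i : Expr)
  | add (e f : Expr)
  | sub (e f : Expr)
  | mul (e f : Expr)
  | div (e f : Expr)

/-- Weight expressions. `get a i` is the entry number `i` of the weight array `a`. -/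
inductive WExpr : Type
  | get (a : ℕ) (i : Expr)
  | add (u v : WExpr)

/-- Tests. `wlt` compares two weights. -/
inductive Test : Type
  | eq (e f : Expr)
  | lt (e f : Expr)
  | wlt (u v : WExpr)
  | neg (b : Test)
  | both (b d : Test)

/-- Programs. -/
inductive Prog : Type
  | nop
  | assign (x : ℕ) (e : Expr)
  | store (a : ℕ) (i e : Expr)
  | wstore (a : ℕ) (i : Expr) (u : WExpr)
  | seq (p q : Prog)
  | branch (b : Test) (p q : Prog)
  | loop (b : Test) (p : Prog)

/-- The contents of the memory: scalar variables, integer arrays, weight arrays. -/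
structure State : Type where
  var : ℕ → ℕ
  arr : ℕ → ℕ → ℕ
  wt : ℕ → ℕ → ℝ

/-- The value of an integer expression, with word modulus `B`. Subtraction is truncated at `0`, and
division by `0` gives `0`. -/
def Expr.eval (B : ℕ) (s : State) : Expr → ℕ
  | .const k => k % B
  | .var x => s.var x
  | .get a i => s.arr a (i.eval B s)
  | .add e f => (e.eval B s + f.eval B s) % B
  | .sub e f => e.eval B s - f.eval B s
  | .mul e f => (e.eval B s * f.eval B s) % B
  | .div e f => e.eval B s / f.eval B s

/-- The time for evaluating an integer expression. -/
def Expr.time : Expr → ℕ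
  | .const _ => 1
  | .var _ => 1
  | .get _ i => i.time + 1
  | .add e f => e.time + f.time + 1
  | .sub e f => e.time + f.time + 1
  | .mul e f => e.time + f.time + 1
  | .div e f => e.time + f.time + 1

/-- The value of a weight expression. -/
def WExpr.eval (B : ℕ) (s : State) : WExpr → ℝ
  | .get a i => s.wt a (i.eval B s)
  | .add u v => u.eval B s + v.eval B s

/-- The time for evaluating a weight expression. -/
def WExpr.time : WExpr → ℕ
  | .get _ i => i.time + 1
  | .add u v => u.time + v.time + 1

/-- The truth value of a test. -/
def Test.holds (B : ℕ) (s : State) : Test → Prop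
  | .eq e f => e.eval B s = f.eval B s
  | .lt e f => e.eval B s < f.eval B s
  | .wlt u v => u.eval B s < v.eval B s
  | .neg b => ¬ b.holds B s
  | .both b d => b.holds B s ∧ d.holds B s

/-- The time for evaluating a test. -/
def Test.time : Test → ℕ
  | .eq e f => e.time + f.time + 1
  | .lt e f => e.time + f.time + 1
  | .wlt u v => u.time + v.time + 1
  | .neg b => b.time + 1
  | .both b d => b.time + d.time + 1

/-- Assign `v` to the scalar variable `x`. -/
def State.setVar (s : State) (x v : ℕ) : State :=
  { s with var := Function.update s.var x v }

/-- Write `v` into the entry `i` of the integer array `a`. -/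
def State.setArr (s : State) (a i v : ℕ) : State :=
  { s with arr := Function.update s.arr a (Function.update (s.arr a) i v) }

/-- Write `v` into the entry `i` of the weight array `a`. -/
def State.setWt (s : State) (a i : ℕ) (v : ℝ) : State :=
  { s with wt := Function.update s.wt a (Function.update (s.wt a) i v) }

/-- `Exec B p s t s'`: with word modulus `B`, the program `p` started in the state `s` halts after
exactly `t` steps in the state `s'`. -/
inductive Exec (B : ℕ) : Prog → State → ℕ → State → Prop
  | nop (s : State) : Exec B .nop s 1 s
  | assign (s : State) (x : ℕ) (e : Expr) :
      Exec B (.assign x e) s (e.time + 1) (s.setVar x (e.eval B s))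
  | store (s : State) (a : ℕ) (i e : Expr) :
      Exec B (.store a i e) s (i.time + e.time + 1) (s.setArr a (i.eval B s) (e.eval B s))
  | wstore (s : State) (a : ℕ) (i : Expr) (u : WExpr) :
      Exec B (.wstore a i u) s (i.time + u.time + 1) (s.setWt a (i.eval B s) (u.eval B s))
  | seq {p q : Prog} {s s' s'' : State} {t t' : ℕ} :
      Exec B p s t s' → Exec B q s' t' s'' → Exec B (.seq p q) s (t + t') s''
  | branch_true {b : Test} {p q : Prog} {s s' : State} {t : ℕ} :
      b.holds B s → Exec B p s t s' → Exec B (.branch b p q) s (b.time + t) s'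
  | branch_false {b : Test} {p q : Prog} {s s' : State} {t : ℕ} :
      ¬ b.holds B s → Exec B q s t s' → Exec B (.branch b p q) s (b.time + t) s'
  | loop_done {b : Test} {p : Prog} {s : State} :
      ¬ b.holds B s → Exec B (.loop b p) s b.time s
  | loop_next {b : Test} {p : Prog} {s s' s'' : State} {t t' : ℕ} :
      b.holds B s → Exec B p s t s' → Exec B (.loop b p) s' t' s'' →
      Exec B (.loop b p) s (b.time + t + t') s''

/-- The initial state: `n` is in the variable `0`, the weights are in the entries `0, …, n - 1` of
the weight array `0`, and everything else is zero. -/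
def initState {n : ℕ} (w : Fin n → ℝ) : State where
  var := fun x => if x = 0 then n else 0
  arr := fun _ _ => 0
  wt := fun a i => if h : a = 0 ∧ i < n then w ⟨i, h.2⟩ else 0

/-- The memory node reached from the memory node `v` along the word, where `L` and `R` hold the
pointers to the left and right children, and the pointer `0` means that there is no child. -/
def follow (L R : ℕ → ℕ) (v : ℕ) : List Bool → Option ℕ
  | [] => some v
  | b :: p =>
      if (if b then R v else L v) = 0 then none
      else follow L R (if b then R v else L v) p

/-- The arrays `L`, `R` of child pointers and the root pointer `v` store the tree `N`, different
nodes of the tree being stored in different memory nodes. -/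
def StoresTree (L R : ℕ → ℕ) (v : ℕ) (N : Set (List Bool)) : Prop :=
  v ≠ 0 ∧ (∀ p, p ∈ N ↔ ∃ u, follow L R v p = some u) ∧
  ∀ p ∈ N, ∀ q ∈ N, follow L R v p = follow L R v q → p = q

/-- The output in the state `s` is the skeleton tree of the code `c` together with the code `c`
itself.  The skeleton tree has its root pointer in the variable `0` and its child pointers in the
integer arrays `0` and `1`.  The code is output as its tree, with root pointer in the variable `1`
and child pointers in the integer arrays `2` and `3`; the integer array `4` holds, for each leaf,
the number of the symbol whose codeword leads to this leaf. -/
def Outputs {n : ℕ} (s : State) (c : Fin n → List Bool) : Prop :=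
  StoresTree (s.arr 0) (s.arr 1) (s.var 0) (skeleton (codeTree c)) ∧
  StoresTree (s.arr 2) (s.arr 3) (s.var 1) (codeTree c) ∧
  ∀ i : Fin n, ∃ u, follow (s.arr 2) (s.arr 3) (s.var 1) (c i) = some u ∧ s.arr 4 u = i

end SkeletonCode

/-! Since the weights are positive, a node with a single child could be contracted, which would
shorten codewords; hence optimal codes are exactly codes of full binary trees
(`exists_tree_of_prefixFree`, `exists_tree_of_code`). In a full tree the leaves of the skeleton are
the roots of the maximal perfect subtrees. If there are `m` of them, the skeleton has `2 * m - 1`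
nodes (`LTree.size_skel`). So the pair (cost, `m`) has to be minimised lexicographically.

Both minima depend only on the level profile, the numbers `k_j` of leaves at depth `j`. For a given
profile the cheapest assignment gives the heaviest symbols the shallowest leaves, and its cost is
the sum over all levels of the total weight below that level (`lcost`). A perfect subtree
contributes a power of two to one single level, so level `j` meets at least `bitCount k_j` maximal
perfect subtrees (`LTree.sum_bitCount_cnt_le`). Both bounds are attained together: cut the leaves of
each level into blocks of `2 ^ b` leaves according to the binary digits of `k_j`, and arrange the
blocks by nondecreasing depth `j - b` of their roots. By the Kraft equality they fit into one tree,
built by merging equal depths on a stack; merging can join perfect subtrees but never creates more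
of them (`exists_tree_of_leafSeq`).

The best profile is found by dynamic programming down the levels. In the state `(s, r)` the current
level has `r` nodes and `s - r` leaves lie above it. If `q` of the `r` nodes are inner, the next
state is `(s + q, 2 * q)`, the cost grows by the weight `W (s - q)` of everything below, and the bit
count by `bitCount (r - q)`. There are quadratically many states with linearly many choices each.
`IsProfile.lexLE` and `Follows.spec` show that the tables are lower bounds and are attained, and
`hasOptimalSkeleton` combines this with the facts about trees.

The program is verified in a small Hoare logic (`Run`) that counts time. Besides functional
correctness, each step must show that no integer reaches the word modulus; all integers are bounded
by a quadratic polynomial in `n`. -/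

namespace SkeletonCode

/-! ### A program logic for the machine -/

/-- The program may change the variable `x`. -/
def Prog.setsVar : Prog → ℕ → Bool
  | .assign y _, x => y == x
  | .seq p q, x => p.setsVar x || q.setsVar x
  | .branch _ p q, x => p.setsVar x || q.setsVar x
  | .loop _ p, x => p.setsVar x
  | _, _ => false

/-- The program may change the integer array `a`. -/
def Prog.setsArr : Prog → ℕ → Bool
  | .store c _ _, a => c == a
  | .seq p q, a => p.setsArr a || q.setsArr a
  | .branch _ p q, a => p.setsArr a || q.setsArr a
  | .loop _ p, a => p.setsArr a
  | _, _ => false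

/-- The program may change the weight array `a`. -/
def Prog.setsWt : Prog → ℕ → Bool
  | .wstore c _ _, a => c == a
  | .seq p q, a => p.setsWt a || q.setsWt a
  | .branch _ p q, a => p.setsWt a || q.setsWt a
  | .loop _ p, a => p.setsWt a
  | _, _ => false

/-- The states `s` and `s'` agree on everything that the program `p` cannot change. -/
structure Frame (p : Prog) (s s' : State) : Prop where
  var : ∀ x, p.setsVar x = false → s'.var x = s.var x
  arr : ∀ a, p.setsArr a = false → s'.arr a = s.arr a
  wt : ∀ a, p.setsWt a = false → s'.wt a = s.wt a

theorem Frame.refl (p : Prog) (s : State) : Frame p s s :=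
  ⟨fun _ _ => rfl, fun _ _ => rfl, fun _ _ => rfl⟩

theorem Frame.trans {p : Prog} {s s' s'' : State} (h : Frame p s s') (h' : Frame p s' s'') :
    Frame p s s'' :=
  ⟨fun x hx => (h'.var x hx).trans (h.var x hx), fun x hx => (h'.arr x hx).trans (h.arr x hx),
    fun x hx => (h'.wt x hx).trans (h.wt x hx)⟩

theorem Frame.mono {p q : Prog} {s s' : State} (h : Frame p s s')
    (hv : ∀ x, q.setsVar x = false → p.setsVar x = false)
    (ha : ∀ x, q.setsArr x = false → p.setsArr x = false)
    (hw : ∀ x, q.setsWt x = false → p.setsWt x = false) : Frame q s s' :=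
  ⟨fun x hx => h.var x (hv x hx), fun x hx => h.arr x (ha x hx), fun x hx => h.wt x (hw x hx)⟩

theorem Frame.setVar (s : State) {p : Prog} {x : ℕ} (hx : p.setsVar x = true) (v : ℕ) :
    Frame p s (s.setVar x v) := by
  refine ⟨fun y hy => ?_, fun _ _ => rfl, fun _ _ => rfl⟩
  have : y ≠ x := by rintro rfl; simp [hx] at hy
  simp [State.setVar, this]

/-- Whether a program can touch a location is a Boolean computation, so later every claim that a
location has kept its value across a program is proved by `rfl`. -/
theorem Exec.frame {B : ℕ} {p : Prog} {s s' : State} {t : ℕ} (h : Exec B p s t s') :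
    Frame p s s' := by
  induction h with
  | nop s => exact Frame.refl _ _
  | assign s x e => exact Frame.setVar s (by simp [Prog.setsVar]) _
  | store s a i e =>
    refine ⟨fun _ _ => rfl, fun y hy => ?_, fun _ _ => rfl⟩
    have : y ≠ a := by rintro rfl; simp [Prog.setsArr] at hy
    simp [State.setArr, this]
  | wstore s a i e =>
    refine ⟨fun _ _ => rfl, fun _ _ => rfl, fun y hy => ?_⟩
    have : y ≠ a := by rintro rfl; simp [Prog.setsWt] at hy
    simp [State.setWt, this]
  | seq _ _ h1 h2 =>
    refine Frame.trans (h1.mono ?_ ?_ ?_) (h2.mono ?_ ?_ ?_) <;>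
      intro x hx <;> simp [Prog.setsVar, Prog.setsArr, Prog.setsWt] at hx <;> simp [hx]
  | branch_true _ _ h =>
    refine h.mono ?_ ?_ ?_ <;>
      intro x hx <;> simp [Prog.setsVar, Prog.setsArr, Prog.setsWt] at hx <;> simp [hx]
  | branch_false _ _ h =>
    refine h.mono ?_ ?_ ?_ <;>
      intro x hx <;> simp [Prog.setsVar, Prog.setsArr, Prog.setsWt] at hx <;> simp [hx]
  | loop_done _ => exact Frame.refl _ _
  | loop_next _ _ _ h1 h2 =>
    refine Frame.trans (h1.mono ?_ ?_ ?_) h2 <;> intro x hx <;>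
      simpa [Prog.setsVar, Prog.setsArr, Prog.setsWt] using hx

/-- The program `p` started in the state `s` halts within `T` steps in a state satisfying `Q`. -/
def Run (B : ℕ) (p : Prog) (s : State) (T : ℕ) (Q : State → Prop) : Prop :=
  ∃ t s', Exec B p s t s' ∧ t ≤ T ∧ Q s'

theorem Run.seq {B : ℕ} {p q : Prog} {s : State} {T₁ T₂ : ℕ} {T : ℕ} {P Q : State → Prop}
    (h₁ : Run B p s T₁ P) (h₂ : ∀ s', P s' → Frame p s s' → Run B q s' T₂ Q)
    (hT : T₁ + T₂ ≤ T) : Run B (.seq p q) s T Q := by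
  obtain ⟨t, s', he, ht, hp⟩ := h₁
  obtain ⟨t', s'', he', ht', hq⟩ := h₂ s' hp he.frame
  exact ⟨t + t', s'', .seq he he', by omega, hq⟩

/-- The effect of a program without loops. -/
noncomputable def Prog.run (B : ℕ) : Prog → State → State
  | .nop, s => s
  | .assign x e, s => s.setVar x (e.eval B s)
  | .store a i e, s => s.setArr a (i.eval B s) (e.eval B s)
  | .wstore a i u, s => s.setWt a (i.eval B s) (u.eval B s)
  | .seq p q, s => q.run B (p.run B s)
  | .branch b p q, s => by classical exact if b.holds B s then p.run B s else q.run B s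
  | .loop _ _, s => s

/-- The program has no loops. -/
def Prog.isFlat : Prog → Bool
  | .seq p q => p.isFlat && q.isFlat
  | .branch _ p q => p.isFlat && q.isFlat
  | .loop _ _ => false
  | _ => true

/-- A bound for the running time of a program without loops. -/
def Prog.flatTime : Prog → ℕ
  | .nop => 1
  | .assign _ e => e.time + 1
  | .store _ i e => i.time + e.time + 1
  | .wstore _ i u => i.time + u.time + 1
  | .seq p q => p.flatTime + q.flatTime
  | .branch b p q => b.time + max p.flatTime q.flatTime
  | .loop _ _ => 0

theorem Prog.exec_run (B : ℕ) (p : Prog) (hp : p.isFlat = true) (s : State) :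
    ∃ t, Exec B p s t (p.run B s) ∧ t ≤ p.flatTime := by
  induction p generalizing s with
  | nop => exact ⟨_, .nop s, le_rfl⟩
  | assign x e => exact ⟨_, .assign s x e, le_rfl⟩
  | store a i e => exact ⟨_, .store s a i e, le_rfl⟩
  | wstore a i u => exact ⟨_, .wstore s a i u, le_rfl⟩
  | seq p q ihp ihq =>
    simp only [Prog.isFlat, Bool.and_eq_true] at hp
    obtain ⟨t, h, ht⟩ := ihp hp.1 s
    obtain ⟨t', h', ht'⟩ := ihq hp.2 (p.run B s)
    exact ⟨_, .seq h h', by simp only [Prog.flatTime]; omega⟩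
  | branch b p q ihp ihq =>
    simp only [Prog.isFlat, Bool.and_eq_true] at hp
    obtain ⟨t, h, ht⟩ := ihp hp.1 s
    obtain ⟨t', h', ht'⟩ := ihq hp.2 s
    by_cases hb : b.holds B s
    · refine ⟨b.time + t, ?_, by simp only [Prog.flatTime]; omega⟩
      simp only [Prog.run, if_pos hb]
      exact .branch_true hb h
    · refine ⟨b.time + t', ?_, by simp only [Prog.flatTime]; omega⟩
      simp only [Prog.run, if_neg hb]
      exact .branch_false hb h'
  | loop b p => simp [Prog.isFlat] at hp

/-- Reduces a loop-free program to simplifying `Prog.run` symbolically; the time bound is then a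
closed numeral inequality. -/
theorem Run.flat {B : ℕ} {p : Prog} {s : State} {T : ℕ} {Q : State → Prop}
    (hp : p.isFlat = true) (hT : p.flatTime ≤ T) (hQ : Q (p.run B s)) : Run B p s T Q := by
  obtain ⟨t, h, ht⟩ := p.exec_run B hp s
  exact ⟨t, _, h, ht.trans hT, hQ⟩

theorem Run.mono {B : ℕ} {p : Prog} {s : State} {T T' : ℕ} {Q Q' : State → Prop}
    (h : Run B p s T Q) (hT : T ≤ T') (hQ : ∀ s', Q s' → Frame p s s' → Q' s') :
    Run B p s T' Q' := by
  obtain ⟨t, s', he, ht, hq⟩ := h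
  exact ⟨t, s', he, ht.trans hT, hQ s' hq he.frame⟩

theorem Run.loop_done {B : ℕ} {b : Test} {p : Prog} {s : State} {T : ℕ} {Q : State → Prop}
    (hb : ¬ b.holds B s) (hT : b.time ≤ T) (hQ : Q s) : Run B (.loop b p) s T Q :=
  ⟨_, _, .loop_done hb, hT, hQ⟩

theorem Run.loop_next {B : ℕ} {b : Test} {p : Prog} {s : State} {T₁ T₂ T : ℕ}
    {P Q : State → Prop} (hb : b.holds B s) (h₁ : Run B p s T₁ P)
    (h₂ : ∀ s', P s' → Frame p s s' → Run B (.loop b p) s' T₂ Q)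
    (hT : b.time + T₁ + T₂ ≤ T) : Run B (.loop b p) s T Q := by
  obtain ⟨t, s', he, ht, hp⟩ := h₁
  obtain ⟨t', s'', he', ht', hq⟩ := h₂ s' hp he.frame
  exact ⟨_, s'', .loop_next hb he he', by omega, hq⟩

/-- Run `p` with `x` ranging from its current value up to (excluding) the value of `h`. -/
def Prog.forTo (x h : ℕ) (p : Prog) : Prog :=
  .loop (.lt (.var x) (.var h)) (.seq p (.assign x (.add (.var x) (.const 1))))

/-- Loop rule with invariant `I`, by induction on the number of remaining rounds. The body has to
establish the invariant in the state where the counter is already incremented; `N < B` keeps this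
increment from wrapping around. A round costs 3 for the test and 4 for the increment besides the
body, and the last failing test costs 3. -/
theorem Run.forTo {B x h : ℕ} {p : Prog} {s : State} {a N Tp T : ℕ} {Q : State → Prop}
    (I : ℕ → State → Prop)
    (hx : p.setsVar x = false) (hh : (p.setsVar h || x == h) = false)
    (ha : s.var x = a) (hN : s.var h = N) (haN : a ≤ N) (hB : N < B) (h0 : I a s)
    (hstep : ∀ i s', a ≤ i → i < N → s'.var x = i → Frame (p.forTo x h) s s' → I i s' →
      Run B p s' Tp (fun s'' => I (i + 1) (s''.setVar x (i + 1))))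
    (hQ : ∀ s', s'.var x = N → Frame (p.forTo x h) s s' → I N s' → Q s')
    (hT : (N - a) * (Tp + 7) + 3 ≤ T) : Run B (p.forTo x h) s T Q := by
  have hxh : h ≠ x := by rintro rfl; simp at hh
  have hh' : p.setsVar h = false := by simp at hh; exact hh.1
  have key : ∀ m i s', i + m = N → a ≤ i → s'.var x = i → Frame (p.forTo x h) s s' → I i s' →
      Run B (p.forTo x h) s' (m * (Tp + 7) + 3) Q := by
    intro m
    induction m with
    | zero =>
      intro i s' him hai hi hf hI
      have hh2 : s'.var h = N :=
        (hf.var h (by simp [Prog.forTo, Prog.setsVar, hh', Ne.symm hxh])).trans hN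
      have hiN : i = N := by omega
      subst hiN
      refine Run.loop_done ?_ (by simp [Test.time, Expr.time]) (hQ s' hi hf hI)
      simp [Test.holds, Expr.eval, hi, hh2]
    | succ m ih =>
      intro i s' him hai hi hf hI
      have hh2 : s'.var h = N :=
        (hf.var h (by simp [Prog.forTo, Prog.setsVar, hh', Ne.symm hxh])).trans hN
      refine Run.loop_next (T₁ := Tp + 4) (T₂ := m * (Tp + 7) + 3)
        (P := fun s'' => I (i + 1) s'' ∧ s''.var x = i + 1) ?_ ?_ ?_ ?_
      · simp [Test.holds, Expr.eval, hi, hh2]; omega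
      · refine Run.seq (T₂ := 4) (hstep i s' hai (by omega) hi hf hI) ?_ le_rfl
        intro s'' hs'' hf''
        refine Run.flat rfl (by simp [Prog.flatTime, Expr.time]) ?_
        have h1 : s''.var x = i := (hf''.var x hx).trans hi
        have h2 : (Expr.add (.var x) (.const 1)).eval B s'' = i + 1 := by
          rcases B with _ | _ | B
          · omega
          · omega
          · simp only [Expr.eval, h1]
            rw [Nat.mod_eq_of_lt (a := 1) (by omega), Nat.mod_eq_of_lt (by omega)]
        simp only [Prog.run, h2]
        exact ⟨hs'', by simp [State.setVar]⟩
      · rintro s'' ⟨h1, h2⟩ hf''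
        refine ih (i + 1) s'' (by omega) (by omega) h2 (hf.trans (hf''.mono ?_ ?_ ?_)) h1 <;>
          intro y hy <;> simpa [Prog.forTo, Prog.setsVar, Prog.setsArr, Prog.setsWt] using hy
      · simp only [Test.time, Expr.time]; ring_nf; omega
  obtain ⟨m, hm⟩ := Nat.exists_eq_add_of_le haN
  refine (key m a s hm.symm le_rfl ha (Frame.refl _ _) h0).mono ?_ (fun _ h _ => h)
  have : N - a = m := by omega
  rwa [this] at hT

end SkeletonCode

namespace SkeletonCode

/-! ### Binary trees with labelled leaves, every node carrying its memory address -/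

/-- Full binary trees: `leaf v i` has the address `v` and the label `i`. -/
inductive LTree : Type
  | leaf (v i : ℕ)
  | node (v : ℕ) (l r : LTree)

namespace LTree

/-- The address of the root. -/
def root : LTree → ℕ
  | leaf v _ => v
  | node v _ _ => v

/-- The subtree at the end of the path `p`. -/
def sub : LTree → List Bool → Option LTree
  | t, [] => some t
  | leaf _ _, _ :: _ => none
  | node _ l r, b :: p => if b then r.sub p else l.sub p

/-- The nodes as words. -/
def nodes (t : LTree) : Set (List Bool) := {p | (t.sub p).isSome}

/-- The number of nodes. -/
def size : LTree → ℕ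
  | leaf _ _ => 1
  | node _ l r => l.size + r.size + 1

/-- The addresses of all nodes. -/
def ids : LTree → List ℕ
  | leaf v _ => [v]
  | node v l r => v :: (l.ids ++ r.ids)

/-- The labels of the leaves. -/
def labels : LTree → List ℕ
  | leaf _ i => [i]
  | node _ l r => l.labels ++ r.labels

/-- One more than the height for a perfect tree, and `0` otherwise. -/
def ph : LTree → ℕ
  | leaf _ _ => 1
  | node _ l r => if l.ph = r.ph ∧ l.ph ≠ 0 then l.ph + 1 else 0

/-- The skeleton tree. -/
def skel : LTree → LTree
  | leaf v i => leaf v i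
  | node v l r => if (node v l r).ph = 0 then node v l.skel r.skel else leaf v 0

/-- The number of maximal perfect subtrees. -/
def sk : LTree → ℕ
  | leaf _ _ => 1
  | node v l r => if (node v l r).ph = 0 then l.sk + r.sk else 1

/-- The word of the leaf with the label `i`. -/
def path : LTree → ℕ → List Bool
  | leaf _ _, _ => []
  | node _ l r, i => if i ∈ l.labels then false :: l.path i else true :: r.path i

/-- The arrays `L` and `R` hold the child pointers of the tree. -/
def Linked (L R : ℕ → ℕ) : LTree → Prop
  | leaf v _ => v ≠ 0 ∧ L v = 0 ∧ R v = 0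
  | node v l r => v ≠ 0 ∧ L v = l.root ∧ R v = r.root ∧ l.Linked L R ∧ r.Linked L R

/-- The array `A` holds the labels of the leaves. -/
def Labelled (A : ℕ → ℕ) : LTree → Prop
  | leaf v i => A v = i
  | node _ l r => l.Labelled A ∧ r.Labelled A

@[simp] theorem root_leaf (v i : ℕ) : (leaf v i).root = v := rfl

@[simp] theorem root_node (v : ℕ) (l r : LTree) : (node v l r).root = v := rfl

@[simp] theorem sub_nil (t : LTree) : t.sub [] = some t := by cases t <;> rfl

@[simp] theorem sub_leaf_cons (v i : ℕ) (b : Bool) (p : List Bool) :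
    (leaf v i).sub (b :: p) = none := rfl

@[simp] theorem sub_node_cons (v : ℕ) (l r : LTree) (b : Bool) (p : List Bool) :
    (node v l r).sub (b :: p) = if b then r.sub p else l.sub p := rfl

theorem sub_append (t : LTree) (p q : List Bool) :
    t.sub (p ++ q) = (t.sub p).bind (fun u => u.sub q) := by
  induction p generalizing t with
  | nil => simp
  | cons b p ih => cases t <;> cases b <;> simp [ih]

theorem Linked.root_ne_zero {L R : ℕ → ℕ} {t : LTree} (h : t.Linked L R) : t.root ≠ 0 := by
  cases t <;> exact h.1

/-- Addresses of stored nodes are nonzero, so the pointer `0` is met exactly where the tree has no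
child. -/
theorem Linked.follow_eq {L R : ℕ → ℕ} {t : LTree} (h : t.Linked L R) (p : List Bool) :
    follow L R t.root p = (t.sub p).map root := by
  induction t generalizing p with
  | leaf v i => cases p with
    | nil => simp [follow]
    | cons b p => cases b <;> simp [follow, h.2.1, h.2.2]
  | node v l r ihl ihr =>
    obtain ⟨_, hL, hR, hl, hr⟩ := h
    cases p with
    | nil => simp [follow]
    | cons b p =>
      cases b
      · simp [follow, hL, hl.root_ne_zero, ihl hl]
      · simp [follow, hR, hr.root_ne_zero, ihr hr]

theorem root_mem_ids (t : LTree) : t.root ∈ t.ids := by cases t <;> simp [root, ids]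

theorem sub_root_mem {t u : LTree} {p : List Bool} (h : t.sub p = some u) : u.root ∈ t.ids := by
  induction t generalizing p with
  | leaf v i => cases p with
    | nil => simp at h; subst h; simp [root, ids]
    | cons b p => simp at h
  | node v l r ihl ihr => cases p with
    | nil => simp at h; subst h; simp [root, ids]
    | cons b p =>
      cases b
      · simp only [sub_node_cons] at h
        simp [ids, ihl h]
      · simp only [sub_node_cons] at h
        simp [ids, ihr h]

/-- Supplies the injectivity demanded by `StoresTree`: with distinct addresses, the two subtrees and
the root occupy disjoint parts of memory. -/
theorem path_unique {t u u' : LTree} (hn : t.ids.Nodup) {p q : List Bool} (h : t.sub p = some u)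
    (h' : t.sub q = some u') (hu : u.root = u'.root) : p = q := by
  induction t generalizing p q with
  | leaf v i => cases p <;> cases q <;> simp at h h' ⊢
  | node v l r ihl ihr =>
    simp only [ids, List.nodup_cons, List.mem_append, not_or, List.nodup_append] at hn
    obtain ⟨⟨hvl, hvr⟩, hl, hr, hd⟩ := hn
    rcases p with _ | ⟨_ | _, p⟩ <;> rcases q with _ | ⟨_ | _, q⟩ <;> simp at h h'
    · rfl
    · subst h; exact absurd (sub_root_mem h') (by rwa [← hu])
    · subst h; exact absurd (sub_root_mem h') (by rwa [← hu])
    · subst h'; exact absurd (sub_root_mem h) (by rwa [hu])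
    · rw [ihl hl h h']
    · exact absurd hu (hd _ (sub_root_mem h) _ (sub_root_mem h'))
    · subst h'; exact absurd (sub_root_mem h) (by rwa [hu])
    · exact absurd hu.symm (hd _ (sub_root_mem h') _ (sub_root_mem h))
    · rw [ihr hr h h']

theorem Linked.storesTree {L R : ℕ → ℕ} {t : LTree} (h : t.Linked L R) (hn : t.ids.Nodup) :
    StoresTree L R t.root t.nodes := by
  refine ⟨h.root_ne_zero, fun p => ?_, fun p hp q hq hpq => ?_⟩
  · rw [h.follow_eq]
    simp only [nodes, Set.mem_ofPred_eq, Option.isSome_iff_exists, Option.map_eq_some_iff]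
    exact ⟨fun ⟨u, hu⟩ => ⟨_, u, hu, rfl⟩, fun ⟨_, u, hu, _⟩ => ⟨u, hu⟩⟩
  · obtain ⟨u, hu⟩ := Option.isSome_iff_exists.1 hp
    obtain ⟨u', hu'⟩ := Option.isSome_iff_exists.1 hq
    rw [h.follow_eq, h.follow_eq, hu, hu'] at hpq
    exact path_unique hn hu hu' (by simpa using hpq)

theorem skel_root (t : LTree) : t.skel.root = t.root := by
  cases t with
  | leaf v i => rfl
  | node v l r => simp only [skel]; split_ifs <;> rfl

theorem skel_ids_sublist (t : LTree) : t.skel.ids.Sublist t.ids := by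
  induction t with
  | leaf v i => exact List.Sublist.refl _
  | node v l r ihl ihr =>
    simp only [skel]
    split_ifs
    · exact (ihl.append ihr).cons_cons v
    · simp [ids]

theorem encard_nodes (t : LTree) : t.nodes.encard = t.size := by
  induction t with
  | leaf v i =>
    have : (leaf v i).nodes = {[]} := by
      ext p; cases p <;> simp [nodes]
    simp [this, size]
  | node v l r ihl ihr =>
    have : (node v l r).nodes =
        insert [] (List.cons false '' l.nodes ∪ List.cons true '' r.nodes) := by
      ext p; rcases p with _ | ⟨_ | _, p⟩ <;> simp [nodes]
    rw [this, Set.encard_insert_of_notMem (by simp), Set.encard_union_eq,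
      (List.cons_injective).encard_image, (List.cons_injective).encard_image, ihl, ihr]
    · simp [size]
    · rw [Set.disjoint_left]
      rintro _ ⟨p, _, rfl⟩ ⟨q, _, h⟩
      simp at h

/-- A full binary tree with `m` leaves has `2 * m - 1` nodes, and the leaves of the skeleton
correspond to the maximal perfect subtrees. Minimising the skeleton therefore means minimising `sk`.
-/
theorem size_skel (t : LTree) : t.skel.size + 1 = 2 * t.sk := by
  induction t with
  | leaf v i => rfl
  | node v l r ihl ihr =>
    simp only [skel, sk]
    split_ifs
    · simp only [size]; omega
    · rfl

theorem sk_pos (t : LTree) : 0 < t.sk := by have := t.size_skel; omega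

theorem sk_node_le (v : ℕ) (l r : LTree) : (node v l r).sk ≤ l.sk + r.sk := by
  have := l.sk_pos
  simp only [sk]; split_ifs <;> omega

theorem sk_eq_one {t : LTree} (h : t.ph ≠ 0) : t.sk = 1 := by
  cases t with
  | leaf v i => rfl
  | node v l r => simp [sk, h]

/-! #### Perfect subtrees -/

theorem isLeaf_nodes_iff (t : LTree) (p : List Bool) :
    IsLeaf t.nodes p ↔ ∃ v i, t.sub p = some (leaf v i) := by
  simp only [IsLeaf, nodes, Set.mem_ofPred_eq, sub_append]
  cases h : t.sub p with
  | none => simp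
  | some u => cases u <;> simp

theorem full_nodes (t : LTree) (p : List Bool) :
    p ++ [false] ∈ t.nodes ↔ p ++ [true] ∈ t.nodes := by
  simp only [nodes, Set.mem_ofPred_eq, sub_append]
  cases h : t.sub p with
  | none => simp
  | some u => cases u <;> simp

theorem exists_leaf (t : LTree) : ∃ p v i, t.sub p = some (leaf v i) := by
  induction t with
  | leaf v i => exact ⟨[], v, i, rfl⟩
  | node v l r ihl _ =>
    obtain ⟨p, v', i, h⟩ := ihl
    exact ⟨false :: p, v', i, h⟩

theorem leaf_length {t : LTree} (h : t.ph ≠ 0) {p : List Bool} {v i : ℕ}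
    (hp : t.sub p = some (leaf v i)) : p.length + 1 = t.ph := by
  induction t generalizing p with
  | leaf v' i' => cases p <;> simp_all [ph]
  | node v' l r ihl ihr =>
    simp only [ph, ne_eq, ite_eq_right_iff, Classical.not_imp] at h
    obtain ⟨⟨h1, h2⟩, _⟩ := h
    simp only [ph, ne_eq, h1, true_and] at h2 ⊢
    rw [if_pos h2]
    rcases p with _ | ⟨_ | _, p⟩ <;> simp at hp
    · simp [← h1, ihl (by rwa [h1]) hp]
    · simp [ihr h2 hp]

/-- Links the bottom-up test, which the machine can evaluate, with the definition by leaf depths.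
Comparing one leaf from each side shows that two perfect subtrees of a perfect tree have equal
height. -/
theorem ph_ne_zero_iff (t : LTree) : t.ph ≠ 0 ↔ ∀ p q v i v' i', t.sub p = some (leaf v i) →
    t.sub q = some (leaf v' i') → p.length = q.length := by
  constructor
  · intro h p q v i v' i' hp hq
    have := leaf_length h hp
    have := leaf_length h hq
    omega
  · intro h
    induction t with
    | leaf v i => simp [ph]
    | node v l r ihl ihr =>
      have h1 := ihl fun p q v i v' i' hp hq => by
        simpa using h (false :: p) (false :: q) v i v' i' hp hq
      have h2 := ihr fun p q v i v' i' hp hq => by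
        simpa using h (true :: p) (true :: q) v i v' i' hp hq
      obtain ⟨p, v1, i1, hp⟩ := l.exists_leaf
      obtain ⟨q, v2, i2, hq⟩ := r.exists_leaf
      have h3 := h (false :: p) (true :: q) _ _ _ _ hp hq
      have h4 := leaf_length h1 hp
      have h5 := leaf_length h2 hq
      simp only [List.length_cons] at h3
      have h6 : l.ph = r.ph := by omega
      simp [ph, h6, h2]

/-- Fullness holds automatically for these trees, so only the equality of the leaf depths is at
stake. -/
theorem perfectAt_nodes_iff (t : LTree) (p : List Bool) :
    PerfectAt t.nodes p ↔ ∃ u, t.sub p = some u ∧ u.ph ≠ 0 := by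
  simp only [PerfectAt, isLeaf_nodes_iff]
  constructor
  · rintro ⟨hp, _, h⟩
    obtain ⟨u, hu⟩ := Option.isSome_iff_exists.1 hp
    refine ⟨u, hu, u.ph_ne_zero_iff.2 fun q q' v i v' i' hq hq' => ?_⟩
    simpa using h (p ++ q) (p ++ q') ⟨v, i, by simp [sub_append, hu, hq]⟩
      ⟨v', i', by simp [sub_append, hu, hq']⟩ (List.prefix_append _ _) (List.prefix_append _ _)
  · rintro ⟨u, hu, hph⟩
    refine ⟨by simp [nodes, hu], fun q _ _ => t.full_nodes q, ?_⟩
    rintro _ _ ⟨v, i, hq⟩ ⟨v', i', hq'⟩ ⟨q, rfl⟩ ⟨q', rfl⟩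
    simp only [sub_append, hu, Option.bind_some] at hq hq'
    have := u.ph_ne_zero_iff.1 hph q q' v i v' i' hq hq'
    simp [this]

/-- The recursion stops at the first perfect subtree on the way down, so a node survives exactly if
it has no perfect proper ancestor. -/
theorem mem_nodes_skel_iff (t : LTree) (p : List Bool) : p ∈ t.skel.nodes ↔
    p ∈ t.nodes ∧ ∀ q u, q <+: p → q ≠ p → t.sub q = some u → u.ph = 0 := by
  induction t generalizing p with
  | leaf v i =>
    cases p with
    | nil => simp +contextual [skel, nodes]
    | cons b p => simp [skel, nodes]
  | node v l r ihl ihr =>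
    by_cases h : (node v l r).ph = 0
    · simp only [skel, if_pos h]
      rcases p with _ | ⟨b, p⟩
      · simp +contextual [nodes]
      · have key : ∀ (t' : LTree), (node v l r).sub [b] = some t' → (p ∈ t'.skel.nodes ↔
            p ∈ t'.nodes ∧ ∀ q u, q <+: p → q ≠ p → t'.sub q = some u → u.ph = 0) →
            (p ∈ t'.skel.nodes ↔ b :: p ∈ (node v l r).nodes ∧ ∀ q u, q <+: b :: p → q ≠ b :: p →
              (node v l r).sub q = some u → u.ph = 0) := by
          intro t' ht' ih
          have hs : ∀ q, (node v l r).sub (b :: q) = t'.sub q := by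
            intro q
            have := (node v l r).sub_append [b] q
            simpa [ht'] using this
          rw [ih]
          refine and_congr (by simp only [nodes, Set.mem_ofPred_eq, hs]) ⟨fun H q u hq hne hu => ?_,
            fun H q u hq hne hu => ?_⟩
          · rcases q with _ | ⟨b', q⟩
            · simp at hu; rwa [← hu]
            · obtain ⟨rfl, hq'⟩ := List.cons_prefix_cons.1 hq
              exact H q u hq' (by simpa using hne) (by rwa [hs] at hu)
          · exact H (b :: q) u (List.cons_prefix_cons.2 ⟨rfl, hq⟩) (by simpa using hne)
              (by rwa [hs])
        cases b
        · rw [← key l (by simp) (ihl p)]; simp [nodes]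
        · rw [← key r (by simp) (ihr p)]; simp [nodes]
    · simp only [skel, if_neg h]
      rcases p with _ | ⟨b, p⟩
      · simp +contextual [nodes]
      · simp only [nodes, Set.mem_ofPred_eq, sub_leaf_cons, Option.isSome_none, Bool.false_eq_true,
          false_iff, not_and, not_forall]
        exact fun _ => ⟨[], _, List.nil_prefix, by simp, sub_nil _, h⟩

theorem skeleton_nodes (t : LTree) : skeleton t.nodes = t.skel.nodes := by
  ext p
  rw [mem_nodes_skel_iff]
  refine and_congr_right fun hp => ⟨fun H q u hq hne hu => ?_, fun H r hr hrp => ?_⟩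
  · by_contra hph
    -- The shortest perfect ancestor is the root of a maximal perfect subtree; this passes from
    -- arbitrary perfect ancestors to the maximal ones in the definition of `skeleton`.
    have hex : ∃ m, ∃ q', q' <+: q ∧ PerfectAt t.nodes q' ∧ q'.length = m :=
      ⟨_, q, List.prefix_rfl, (t.perfectAt_nodes_iff q).2 ⟨u, hu, hph⟩, rfl⟩
    classical
    obtain ⟨q', hq', hper, hlen⟩ := Nat.find_spec hex
    have hmax : MaximalPerfectAt t.nodes q' := by
      refine ⟨hper, fun r' hr' hpre => ?_⟩
      have := Nat.find_min' hex ⟨r', hpre.trans hq', hr', rfl⟩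
      exact hpre.eq_of_length_le (by omega)
    have h1 := H q' hmax (hq'.trans hq)
    subst h1
    exact hne (hq.eq_of_length_le hq'.length_le)
  · by_contra hne
    obtain ⟨u, hu, hph⟩ := (t.perfectAt_nodes_iff r).1 hr.1
    exact hph (H r u hrp (Ne.symm hne) hu)

/-! #### The code of a tree -/

theorem sub_path {t : LTree} {i : ℕ} (h : i ∈ t.labels) :
    ∃ v, t.sub (t.path i) = some (leaf v i) := by
  induction t with
  | leaf v j => simp [labels] at h; subst h; exact ⟨v, rfl⟩
  | node v l r ihl ihr =>
    simp only [path]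
    split_ifs with hi
    · simpa using ihl hi
    · simp only [labels, List.mem_append, hi, false_or] at h
      simpa using ihr h

theorem path_prefix {t : LTree} {i j : ℕ} (hi : i ∈ t.labels) (hj : j ∈ t.labels)
    (h : t.path i <+: t.path j) : i = j := by
  obtain ⟨v, hv⟩ := sub_path hi
  obtain ⟨v', hv'⟩ := sub_path hj
  obtain ⟨q, hq⟩ := h
  rw [← hq, sub_append, hv] at hv'
  cases q with
  | nil => simp at hv'; exact hv'.2
  | cons b q => simp at hv'

/-- Below every node there is a leaf. Distinct labels are needed because `path` searches the left
subtree first and would miss a second leaf with the same label. -/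
theorem mem_nodes_iff {t : LTree} (hn : t.labels.Nodup) (p : List Bool) :
    p ∈ t.nodes ↔ ∃ i ∈ t.labels, p <+: t.path i := by
  constructor
  · intro hp
    induction t generalizing p with
    | leaf v i => cases p <;> simp_all [nodes, labels]
    | node v l r ihl ihr =>
      simp only [labels, List.nodup_append] at hn
      obtain ⟨hl, hr, hd⟩ := hn
      have hR : ∀ i ∈ r.labels, i ∉ l.labels := fun i hi hi' => hd i hi' i hi rfl
      rcases p with _ | ⟨_ | _, p⟩
      · obtain ⟨i, hi, _⟩ := ihl hl [] (by simp [nodes])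
        exact ⟨i, by simp [labels, hi], List.nil_prefix⟩
      · obtain ⟨i, hi, h⟩ := ihl hl p (by simpa [nodes] using hp)
        exact ⟨i, by simp [labels, hi], by simp [path, hi, h]⟩
      · obtain ⟨i, hi, h⟩ := ihr hr p (by simpa [nodes] using hp)
        exact ⟨i, by simp [labels, hi], by simp [path, hR i hi, h]⟩
  · rintro ⟨i, hi, q, hq⟩
    obtain ⟨v, hv⟩ := sub_path hi
    rw [← hq, sub_append] at hv
    simp only [nodes, Set.mem_ofPred_eq]
    cases h : t.sub p <;> simp_all

theorem Labelled.path {A L R : ℕ → ℕ} {t : LTree} (h : t.Labelled A) (hl : t.Linked L R) {i : ℕ}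
    (hi : i ∈ t.labels) : ∃ u, follow L R t.root (t.path i) = some u ∧ A u = i := by
  obtain ⟨v, hv⟩ := sub_path hi
  refine ⟨v, by rw [hl.follow_eq, hv]; rfl, ?_⟩
  generalize t.path i = p at hv
  clear hi hl
  induction t generalizing p with
  | leaf v' j => cases p with
    | nil => simp at hv; obtain ⟨rfl, rfl⟩ := hv; exact h
    | cons b p => simp at hv
  | node v' l r ihl ihr =>
    rcases p with _ | ⟨_ | _, p⟩ <;> simp at hv
    · exact ihl h.1 p hv
    · exact ihr h.2 p hv

/-- The total weight of the leaves. -/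
def wsum (u : ℕ → ℝ) (t : LTree) : ℝ := (t.labels.map u).sum

/-- The weighted path length. -/
def wpl (u : ℕ → ℝ) : LTree → ℝ
  | leaf _ _ => 0
  | node _ l r => l.wpl u + l.wsum u + (r.wpl u + r.wsum u)

theorem wsum_node (u : ℕ → ℝ) (v : ℕ) (l r : LTree) :
    (node v l r).wsum u = l.wsum u + r.wsum u := by simp [wsum, labels]

theorem wpl_eq (u : ℕ → ℝ) {t : LTree} (hn : t.labels.Nodup) :
    t.wpl u = (t.labels.map fun i => ((t.path i).length : ℝ) * u i).sum := by
  induction t with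
  | leaf v i => simp [wpl, labels, path]
  | node v l r ihl ihr =>
    simp only [labels, List.nodup_append] at hn
    obtain ⟨hl, hr, hd⟩ := hn
    have hR : ∀ i ∈ r.labels, i ∉ l.labels := fun i hi hi' => hd i hi' i hi rfl
    rw [wpl, ihl hl, ihr hr, wsum, wsum, ← List.sum_map_add, ← List.sum_map_add, labels,
      List.map_append, List.sum_append]
    congr 2
    · refine List.map_congr_left fun i hi => ?_
      simp [path, hi]; ring
    · refine List.map_congr_left fun i hi => ?_
      simp [path, hR i hi]; ring

end LTree

/-- Every prefix-free code is at least as long as the code of some full binary tree, with equality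
only if it is the code of this tree. -/
theorem exists_tree_of_prefixFree (S : Finset ℕ) (hS : S.Nonempty) (c : ℕ → List Bool)
    (hc : ∀ i ∈ S, ∀ j ∈ S, i ≠ j → ¬ c i <+: c j) :
    ∃ t : LTree, t.labels.Nodup ∧ t.labels.toFinset = S ∧
      (∀ i ∈ S, (t.path i).length ≤ (c i).length) ∧
      ((∀ i ∈ S, (t.path i).length = (c i).length) → ∀ i ∈ S, t.path i = c i) := by
  induction hN : ∑ i ∈ S, (c i).length using Nat.strong_induction_on generalizing S c with
  | _ N ih =>
  subst hN
  by_cases hone : ∃ i, S = {i}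
  · obtain ⟨i, rfl⟩ := hone
    refine ⟨.leaf 0 i, by simp [LTree.labels], by simp [LTree.labels], by simp [LTree.path], ?_⟩
    intro h j hj
    have := h j hj
    simp only [LTree.path, List.length_nil] at this
    simpa [LTree.path] using (List.eq_nil_of_length_eq_zero this.symm).symm
  · have hne : ∀ i ∈ S, c i ≠ [] := by
      intro i hi h
      refine hone ⟨i, Finset.eq_singleton_iff_unique_mem.2 ⟨hi, fun j hj => ?_⟩⟩
      by_contra hij
      exact hc i hi j hj (Ne.symm hij) (h ▸ List.nil_prefix)
    set c' : ℕ → List Bool := fun i => (c i).tail with hc'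
    have hlen : ∀ i ∈ S, (c' i).length + 1 = (c i).length := by
      intro i hi
      have := List.length_pos_iff.2 (hne i hi)
      simp only [hc', List.length_tail]; omega
    have hpf : ∀ (b : Bool) (S' : Finset ℕ), (∀ i ∈ S', i ∈ S ∧ c i = b :: c' i) →
        ∀ i ∈ S', ∀ j ∈ S', i ≠ j → ¬ c' i <+: c' j := by
      intro b S' hS' i hi j hj hij h
      refine hc i (hS' i hi).1 j (hS' j hj).1 hij ?_
      rw [(hS' i hi).2, (hS' j hj).2]
      exact List.cons_prefix_cons.2 ⟨rfl, h⟩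
    have hlt : ∀ S' ⊆ S, S'.Nonempty → ∑ i ∈ S', (c' i).length < ∑ i ∈ S, (c i).length := by
      intro S' hS' hS'n
      calc ∑ i ∈ S', (c' i).length < ∑ i ∈ S', (c i).length :=
            Finset.sum_lt_sum_of_nonempty hS'n fun i hi => by have := hlen i (hS' hi); omega
        _ ≤ _ := Finset.sum_le_sum_of_subset hS'
    have hcons : ∀ i ∈ S, c i = false :: c' i ∨ c i = true :: c' i := by
      intro i hi
      rcases h : c i with _ | ⟨_ | _, p⟩
      · exact absurd h (hne i hi)
      · left; simp [hc', h]
      · right; simp [hc', h]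
    -- If all words start with the same bit, the root has one child and is contracted. Every word
    -- gets strictly shorter, so the clause about equal lengths holds vacuously.
    have hskip : ∀ b : Bool, (∀ i ∈ S, c i = b :: c' i) → ∃ t : LTree, t.labels.Nodup ∧
        t.labels.toFinset = S ∧ (∀ i ∈ S, (t.path i).length ≤ (c i).length) ∧
        ((∀ i ∈ S, (t.path i).length = (c i).length) → ∀ i ∈ S, t.path i = c i) := by
      intro b hb
      obtain ⟨t, h1, h2, h3, h4⟩ := ih _ (hlt S subset_rfl hS) S hS c'
        (hpf b S fun i hi => ⟨hi, hb i hi⟩) rfl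
      refine ⟨t, h1, h2, fun i hi => ?_, fun h => ?_⟩
      · have := h3 i hi; have := hlen i hi; omega
      · obtain ⟨i, hi⟩ := hS
        have := h3 i hi; have := hlen i hi; have := h i hi
        omega
    set S0 := S.filter fun i => c i = false :: c' i with hS0
    set S1 := S.filter fun i => c i = true :: c' i with hS1
    rcases S0.eq_empty_or_nonempty with h0 | h0
    · refine hskip true fun i hi => (hcons i hi).resolve_left fun h => ?_
      exact Finset.eq_empty_iff_forall_notMem.1 h0 i (Finset.mem_filter.2 ⟨hi, h⟩)
    rcases S1.eq_empty_or_nonempty with h1 | h1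
    · refine hskip false fun i hi => (hcons i hi).resolve_right fun h => ?_
      exact Finset.eq_empty_iff_forall_notMem.1 h1 i (Finset.mem_filter.2 ⟨hi, h⟩)
    have hm0 : ∀ i ∈ S0, i ∈ S ∧ c i = false :: c' i := fun i hi => Finset.mem_filter.1 hi
    have hm1 : ∀ i ∈ S1, i ∈ S ∧ c i = true :: c' i := fun i hi => Finset.mem_filter.1 hi
    obtain ⟨t0, a1, a2, a3, a4⟩ := ih _ (hlt S0 (Finset.filter_subset _ _) h0) S0 h0 c'
      (hpf false S0 hm0) rfl
    obtain ⟨t1, b1, b2, b3, b4⟩ := ih _ (hlt S1 (Finset.filter_subset _ _) h1) S1 h1 c'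
      (hpf true S1 hm1) rfl
    have hl0 : ∀ i, i ∈ t0.labels ↔ i ∈ S0 := fun i => by rw [← a2, List.mem_toFinset]
    have hl1 : ∀ i, i ∈ t1.labels ↔ i ∈ S1 := fun i => by rw [← b2, List.mem_toFinset]
    have hdis : ∀ i, i ∈ S1 → i ∉ S0 := by
      intro i hi hi'
      have := (hm1 i hi).2.symm.trans (hm0 i hi').2
      simp at this
    have hp0 : ∀ i ∈ S0, (LTree.node 0 t0 t1).path i = false :: t0.path i := by
      intro i hi
      simp [LTree.path, hl0, hi]
    have hp1 : ∀ i ∈ S1, (LTree.node 0 t0 t1).path i = true :: t1.path i := by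
      intro i hi
      simp [LTree.path, hl0, hdis i hi]
    have hcase : ∀ i ∈ S, i ∈ S0 ∨ i ∈ S1 := fun i hi => (hcons i hi).imp
      (fun h => Finset.mem_filter.2 ⟨hi, h⟩) (fun h => Finset.mem_filter.2 ⟨hi, h⟩)
    refine ⟨.node 0 t0 t1, ?_, ?_, ?_, ?_⟩
    · simp only [LTree.labels, List.nodup_append]
      refine ⟨a1, b1, fun i hi j hj hij => ?_⟩
      subst hij
      exact hdis i ((hl1 i).1 hj) ((hl0 i).1 hi)
    · simp only [LTree.labels, List.toFinset_append, a2, b2]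
      ext i
      simp only [Finset.mem_union]
      exact ⟨fun h => h.elim (fun h => (hm0 i h).1) (fun h => (hm1 i h).1), hcase i⟩
    · intro i hi
      have := hlen i hi
      rcases hcase i hi with h | h
      · rw [hp0 i h]; have := a3 i h; simp; omega
      · rw [hp1 i h]; have := b3 i h; simp; omega
    · intro h i hi
      rcases hcase i hi with hi' | hi'
      · rw [hp0 i hi', (hm0 i hi').2, a4 (fun j hj => ?_) i hi']
        have h1 := h j (hm0 j hj).1
        have h2 := hlen j (hm0 j hj).1
        rw [hp0 j hj] at h1
        simp at h1; omega
      · rw [hp1 i hi', (hm1 i hi').2, b4 (fun j hj => ?_) i hi']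
        have h1 := h j (hm1 j hj).1
        have h2 := hlen j (hm1 j hj).1
        rw [hp1 j hj] at h1
        simp at h1; omega

end SkeletonCode

namespace SkeletonCode

/-! ### Binary digits -/

/-- The number of ones in the binary expansion. -/
def bitCount : ℕ → ℕ
  | 0 => 0
  | n + 1 => bitCount ((n + 1) / 2) + (n + 1) % 2
decreasing_by omega

theorem bitCount_eq (n : ℕ) : bitCount n = bitCount (n / 2) + n % 2 := by
  cases n with
  | zero => simp [bitCount]
  | succ n => rw [bitCount]

theorem bitCount_succ_le (n : ℕ) : bitCount (n + 1) ≤ bitCount n + 1 := by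
  induction n using Nat.strong_induction_on with
  | _ n ih =>
    rw [bitCount_eq (n + 1), bitCount_eq n]
    rcases Nat.even_or_odd' n with ⟨m, rfl | rfl⟩
    · have : (2 * m + 1) / 2 = 2 * m / 2 := by omega
      rw [this]; omega
    · have h1 : (2 * m + 1 + 1) / 2 = m + 1 := by omega
      have h2 : (2 * m + 1) / 2 = m := by omega
      have := ih m (by omega)
      rw [h1, h2]; omega

/-- In binary addition a carry replaces two ones by a single one. -/
theorem bitCount_add_le (a b : ℕ) : bitCount (a + b) ≤ bitCount a + bitCount b := by
  induction a using Nat.strong_induction_on generalizing b with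
  | _ a ih =>
    rcases Nat.eq_zero_or_pos a with rfl | ha
    · simp [bitCount]
    rw [bitCount_eq (a + b), bitCount_eq a, bitCount_eq b]
    have h := ih (a / 2) (by omega) (b / 2)
    by_cases hc : a % 2 = 1 ∧ b % 2 = 1
    · have h1 : (a + b) / 2 = a / 2 + b / 2 + 1 := by omega
      have := bitCount_succ_le (a / 2 + b / 2)
      rw [h1]; omega
    · have h1 : (a + b) / 2 = a / 2 + b / 2 := by omega
      rw [h1]; omega

theorem bitCount_two_pow (h : ℕ) : bitCount (2 ^ h) = 1 := by
  induction h with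
  | zero => simp [bitCount_eq 1, bitCount]
  | succ h ih =>
    have h1 : 2 ^ (h + 1) / 2 = 2 ^ h := by rw [pow_succ]; omega
    rw [bitCount_eq, h1, ih, pow_succ]; omega

theorem bitCount_eq_sum {k N : ℕ} (h : k < 2 ^ N) :
    bitCount k = ∑ b ∈ Finset.range N, k / 2 ^ b % 2 := by
  induction N generalizing k with
  | zero => have : k = 0 := by simpa using h
            simp [this, bitCount]
  | succ N ih =>
    rw [bitCount_eq, ih (by rw [pow_succ] at h; omega), Finset.sum_range_succ']
    simp [Nat.div_div_eq_div_mul, pow_succ']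

/-! ### Level profiles of trees -/

namespace LTree

/-- The number of leaves at the given depth. -/
def cnt : LTree → ℕ → ℕ
  | leaf _ _, j => if j = 0 then 1 else 0
  | node _ _ _, 0 => 0
  | node _ l r, j + 1 => l.cnt j + r.cnt j

@[simp] theorem cnt_node_zero (v : ℕ) (l r : LTree) : (node v l r).cnt 0 = 0 := rfl

@[simp] theorem cnt_node_succ (v : ℕ) (l r : LTree) (j : ℕ) :
    (node v l r).cnt (j + 1) = l.cnt j + r.cnt j := rfl

theorem cnt_of_perfect {t : LTree} (h : t.ph ≠ 0) (j : ℕ) :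
    t.cnt j = if j + 1 = t.ph then 2 ^ j else 0 := by
  induction t generalizing j with
  | leaf v i => cases j <;> simp [cnt, ph]
  | node v l r ihl ihr =>
    simp only [ph, ne_eq, ite_eq_right_iff, Classical.not_imp] at h
    obtain ⟨⟨h1, h2⟩, _⟩ := h
    have h3 : r.ph ≠ 0 := by rwa [← h1]
    simp only [ph, ne_eq, h1, h3, not_false_eq_true, and_self, if_true]
    cases j with
    | zero => simp; omega
    | succ j =>
      rw [cnt_node_succ, ihl h2, ihr h3, h1]
      by_cases hj : j + 1 = r.ph
      · simp [← hj]; ring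
      · simp [hj]

/-- The lower bound for the skeleton. A perfect tree has its leaves on one level, and their number
is a power of two, with a single binary one. At an imperfect root the profiles of the two subtrees
are added level by level, where `bitCount` is subadditive, while `sk` is additive. -/
theorem sum_bitCount_cnt_le (t : LTree) (N : ℕ) :
    ∑ j ∈ Finset.range N, bitCount (t.cnt j) ≤ t.sk := by
  have hperf : ∀ (t : LTree) (N : ℕ), t.ph ≠ 0 →
      ∑ j ∈ Finset.range N, bitCount (t.cnt j) ≤ t.sk := by
    intro t N h
    rw [sk_eq_one h]
    calc ∑ j ∈ Finset.range N, bitCount (t.cnt j)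
        ≤ ∑ j ∈ Finset.range N, if j = t.ph - 1 then 1 else 0 := by
          refine Finset.sum_le_sum fun j _ => ?_
          rw [cnt_of_perfect h]
          by_cases hj : j + 1 = t.ph
          · rw [if_pos hj, bitCount_two_pow, if_pos (by omega)]
          · rw [if_neg hj]; simp [bitCount]
      _ ≤ 1 := by rw [Finset.sum_ite_eq']; split_ifs <;> omega
  induction t generalizing N with
  | leaf v i => exact hperf _ N (by simp [ph])
  | node v l r ihl ihr =>
    by_cases h : (node v l r).ph = 0
    · simp only [sk, if_pos h]
      cases N with
      | zero => simp
      | succ N =>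
        rw [Finset.sum_range_succ']
        simp only [cnt_node_succ, cnt_node_zero, bitCount, add_zero]
        refine (Finset.sum_le_sum fun j _ => bitCount_add_le _ _).trans ?_
        rw [Finset.sum_add_distrib]
        exact Nat.add_le_add (ihl N) (ihr N)
    · exact hperf _ N h

/-- The number of inner nodes. -/
def inner : LTree → ℕ
  | leaf _ _ => 0
  | node _ l r => l.inner + r.inner + 1

/-- `1` for an inner node and `0` for a leaf. -/
def isNode : LTree → ℕ
  | leaf _ _ => 0
  | node _ _ _ => 1

/-- The subtrees of the children of the root. -/
def kids : LTree → List LTree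
  | leaf _ _ => []
  | node _ l r => [l, r]

theorem length_labels (t : LTree) : t.labels.length = t.inner + 1 := by
  induction t with
  | leaf v i => rfl
  | node v l r ihl ihr => simp only [labels, List.length_append, inner]; omega

theorem length_flatMap_kids (F : List LTree) :
    (F.flatMap kids).length = 2 * (F.map isNode).sum := by
  induction F with
  | nil => rfl
  | cons t F ih => cases t <;> simp [kids, isNode, ih]; omega

theorem sum_cnt_zero (F : List LTree) :
    (F.map fun t => t.cnt 0).sum + (F.map isNode).sum = F.length := by
  induction F with
  | nil => rfl
  | cons t F ih => cases t <;> simp [cnt, isNode] <;> omega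

theorem sum_cnt_succ (F : List LTree) (j : ℕ) :
    (F.map fun t => t.cnt (j + 1)).sum = ((F.flatMap kids).map fun t => t.cnt j).sum := by
  induction F with
  | nil => rfl
  | cons t F ih => cases t <;> simp [cnt, kids, ih]; omega

theorem sum_inner (F : List LTree) : (F.map inner).sum =
    ((F.flatMap kids).map inner).sum + (F.map isNode).sum := by
  induction F with
  | nil => rfl
  | cons t F ih => cases t <;> simp [inner, kids, isNode, ih]; omega

theorem sum_isNode_pos {F : List LTree} (h : 0 < (F.map inner).sum) : 0 < (F.map isNode).sum := by
  induction F with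
  | nil => exact h
  | cons t F ih =>
    cases t
    · simp only [inner, isNode, List.map_cons, List.sum_cons, zero_add] at h ⊢; exact ih h
    · simp [isNode]

theorem length_labels_forest (F : List LTree) :
    (F.flatMap labels).length = (F.map inner).sum + F.length := by
  induction F with
  | nil => rfl
  | cons t F ih => simp [ih, length_labels]; omega

theorem labels_kids_sublist (F : List LTree) :
    ((F.flatMap kids).flatMap labels).Sublist (F.flatMap labels) := by
  induction F with
  | nil => exact List.Sublist.refl _
  | cons t F ih =>
    cases t
    · simpa [kids, labels] using ih.cons _
    · simp [kids, labels, ih]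

theorem sum_wpl (u : ℕ → ℝ) (F : List LTree) : (F.map (wpl u)).sum =
    (((F.flatMap kids).flatMap labels).map u).sum + ((F.flatMap kids).map (wpl u)).sum := by
  induction F with
  | nil => simp
  | cons t F ih =>
    cases t
    · simpa [kids, wpl] using ih
    · simp only [kids, wpl, List.map_cons, List.sum_cons, ih, List.flatMap_cons, List.map_append,
        List.sum_append, wsum, List.cons_append, List.nil_append]
      ring

end LTree

/-- `ks` is the list of the numbers of leaves on the levels of a forest with `r` roots, where `s` is
the total number of leaves minus the number of inner nodes of the forest, and `n` is the total
number of leaves. -/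
inductive IsProfile (n : ℕ) : ℕ → ℕ → List ℕ → Prop
  | last (r : ℕ) : IsProfile n n r [r]
  | step {s r q : ℕ} {ks : List ℕ} : 1 ≤ q → q ≤ r → s + q ≤ n → IsProfile n (s + q) (2 * q) ks →
      IsProfile n s r ((r - q) :: ks)

/-- The cost of a profile, if `W m` is the total weight of all but the `m` heaviest symbols. -/
def lcost (W : ℕ → ℝ) : ℕ → List ℕ → ℝ
  | _, [] => 0
  | m, k :: ks => W (m + k) + lcost W (m + k) ks

/-- `F` is the forest hanging below one level of a tree, so the induction descends level by level
from `F` to the subtrees of its children. Each level charges the total weight of the leaves strictly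
below it, and by `hW` this is at least the weight of equally many lightest symbols. -/
theorem exists_profile {n : ℕ} {u W : ℕ → ℝ} (hW0 : W n = 0)
    (hW : ∀ l : List ℕ, l.Nodup → (∀ i ∈ l, i < n) → W (n - l.length) ≤ (l.map u).sum)
    (F : List LTree) (hn : (F.flatMap LTree.labels).Nodup)
    (hlt : ∀ i ∈ F.flatMap LTree.labels, i < n) (s : ℕ) (hs : s + (F.map LTree.inner).sum = n)
    (hF : F.length ≤ s) :
    ∃ ks, IsProfile n s F.length ks ∧ lcost W (s - F.length) ks ≤ (F.map (LTree.wpl u)).sum ∧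
      ∀ j, ks.getD j 0 = (F.map fun t => t.cnt j).sum := by
  induction hI : (F.map LTree.inner).sum using Nat.strong_induction_on generalizing F s with
  | _ I ih =>
  subst hI
  have h0 := LTree.sum_cnt_zero F
  have h1 := LTree.sum_inner F
  have h2 := LTree.length_flatMap_kids F
  have h3 := LTree.sum_wpl u F
  rcases Nat.eq_zero_or_pos (F.map LTree.inner).sum with hz | hpos
  · have hq : (F.map LTree.isNode).sum = 0 := by omega
    have hk : F.flatMap LTree.kids = [] := List.eq_nil_of_length_eq_zero (by omega)
    obtain rfl : s = n := by omega
    refine ⟨[F.length], .last _, ?_, fun j => ?_⟩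
    · rw [h3, hk]
      simp [lcost, Nat.sub_add_cancel hF, hW0]
    · cases j with
      | zero => simp; omega
      | succ j => rw [LTree.sum_cnt_succ, hk]; simp
  · have hq := LTree.sum_isNode_pos hpos
    have hsub := LTree.labels_kids_sublist F
    have hlen := LTree.length_labels_forest (F.flatMap LTree.kids)
    have hlt' : ∀ i ∈ (F.flatMap LTree.kids).flatMap LTree.labels, i < n :=
      fun i hi => hlt i (hsub.subset hi)
    obtain ⟨ks, hp, hc, hj⟩ := ih _ (by omega) (F.flatMap LTree.kids) (hn.sublist hsub) hlt'
      (s + (F.map LTree.isNode).sum) (by omega) (by omega) rfl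
    have hWle := hW _ (hn.sublist hsub) hlt'
    refine ⟨(F.length - (F.map LTree.isNode).sum) :: ks, .step hq (by omega) (by omega) ?_, ?_, ?_⟩
    · rwa [h2] at hp
    · have e1 : s - F.length + (F.length - (F.map LTree.isNode).sum) =
          s - (F.map LTree.isNode).sum := by omega
      have e2 : s + (F.map LTree.isNode).sum - (F.flatMap LTree.kids).length =
          s - (F.map LTree.isNode).sum := by omega
      have e3 : n - ((F.flatMap LTree.kids).flatMap LTree.labels).length =
          s - (F.map LTree.isNode).sum := by omega
      rw [e2] at hc
      rw [e3] at hWle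
      simp only [lcost, e1]
      rw [h3]
      linarith
    · rintro (_ | j)
      · simp only [List.getD_cons_zero]; omega
      · simpa [LTree.sum_cnt_succ] using hj j

theorem exists_profile_of_tree {n : ℕ} {u W : ℕ → ℝ} (hW0 : W n = 0)
    (hW : ∀ l : List ℕ, l.Nodup → (∀ i ∈ l, i < n) → W (n - l.length) ≤ (l.map u).sum)
    {t : LTree} (hn : t.labels.Nodup) (hlt : t.labels.toFinset = Finset.range n) :
    ∃ ks, IsProfile n 1 1 ks ∧ lcost W 0 ks ≤ t.wpl u ∧ (ks.map bitCount).sum ≤ t.sk := by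
  have hmem : ∀ i, i ∈ t.labels ↔ i < n := fun i => by
    rw [← List.mem_toFinset, hlt, Finset.mem_range]
  have hcard : t.inner + 1 = n := by
    rw [← LTree.length_labels, ← List.toFinset_card_of_nodup hn, hlt, Finset.card_range]
  obtain ⟨ks, h1, h2, h3⟩ := exists_profile (u := u) hW0 hW [t] (by simpa using hn)
    (by simpa using fun i hi => (hmem i).1 hi) 1 (by simp; omega) (by simp)
  refine ⟨ks, by simpa using h1, by simpa using h2, ?_⟩
  refine le_trans (le_of_eq ?_) (t.sum_bitCount_cnt_le ks.length)
  rw [Finset.sum_range, ← List.sum_ofFn]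
  congr 1
  refine List.ext_getElem (by simp) fun j hj hj' => ?_
  have := h3 j
  have hj'' : j < ks.length := by simpa using hj
  simp only [List.map_cons, List.map_nil, List.sum_cons, List.sum_nil, add_zero] at this
  rw [List.getElem_map, List.getElem_ofFn, ← this, List.getD_eq_getElem _ _ hj'']

/-! ### Dynamic programming -/

/-- Lexicographic comparison of a cost and a number. -/
def LexLE (a : ℝ) (p : ℕ) (b : ℝ) (q : ℕ) : Prop := a < b ∨ a = b ∧ p ≤ q

theorem LexLE.trans {a b c : ℝ} {p q r : ℕ} (h : LexLE a p b q) (h' : LexLE b q c r) :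
    LexLE a p c r := by
  rcases h with h | ⟨rfl, h⟩ <;> rcases h' with h' | ⟨rfl, h'⟩
  · exact .inl (h.trans h')
  · exact .inl h
  · exact .inl h'
  · exact .inr ⟨rfl, h.trans h'⟩

theorem LexLE.add {a b : ℝ} {p q : ℕ} (h : LexLE a p b q) (c : ℝ) (r : ℕ) :
    LexLE (c + a) (r + p) (c + b) (r + q) := by
  rcases h with h | ⟨rfl, h⟩
  · exact .inl (by linarith)
  · exact .inr ⟨rfl, by omega⟩

theorem LexLE.refl (a : ℝ) (p : ℕ) : LexLE a p a p := .inr ⟨rfl, le_rfl⟩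

/-- The tables `F`, `P` of the optimal costs and bit counts and the table `Q` of the optimal numbers
of inner nodes satisfy the optimality equation for `s` and `r`. -/
def Bellman (n : ℕ) (W : ℕ → ℝ) (F : ℕ → ℕ → ℝ) (P Q : ℕ → ℕ → ℕ) (s r : ℕ) : Prop :=
  (s = n → F s r = 0 ∧ P s r = bitCount r) ∧
  (s < n → 1 ≤ Q s r ∧ Q s r ≤ r ∧ s + Q s r ≤ n ∧
    F s r = W (s - Q s r) + F (s + Q s r) (2 * Q s r) ∧
    P s r = bitCount (r - Q s r) + P (s + Q s r) (2 * Q s r) ∧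
    ∀ q, 1 ≤ q → q ≤ r → s + q ≤ n → LexLE (F s r) (P s r)
      (W (s - q) + F (s + q) (2 * q)) (bitCount (r - q) + P (s + q) (2 * q)))

/-- The profile `ks` is read off the table `Q`. -/
inductive Follows (n : ℕ) (Q : ℕ → ℕ → ℕ) : ℕ → ℕ → List ℕ → Prop
  | last (r : ℕ) : Follows n Q n r [r]
  | step {s r : ℕ} {ks : List ℕ} : s < n → Follows n Q (s + Q s r) (2 * Q s r) ks →
      Follows n Q s r ((r - Q s r) :: ks)

section Bellman

variable {n : ℕ} {W : ℕ → ℝ} {F : ℕ → ℕ → ℝ} {P Q : ℕ → ℕ → ℕ}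

/-- The tables are attained. The conditions `1 ≤ r ≤ s ≤ n` survive a step, since `q ≤ r ≤ s` gives
`2 * q ≤ s + q`, and the number of leaves already placed changes from `s - r` to `s - q`. -/
theorem Follows.spec (hW0 : W n = 0)
    (hB : ∀ s r, 1 ≤ r → r ≤ s → s ≤ n → Bellman n W F P Q s r) {s r : ℕ} {ks : List ℕ}
    (h : Follows n Q s r ks) (hr : 1 ≤ r) (hrs : r ≤ s) (hs : s ≤ n) :
    IsProfile n s r ks ∧ lcost W (s - r) ks = F s r ∧ (ks.map bitCount).sum = P s r := by
  induction h with
  | last r =>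
    obtain ⟨h1, h2⟩ := (hB n r hr hrs le_rfl).1 rfl
    refine ⟨.last r, ?_, ?_⟩
    · simp [lcost, Nat.sub_add_cancel hrs, hW0, h1]
    · simp [h2]
  | @step s r ks hsn _ ih =>
    obtain ⟨h1, h2, h3, h4, h5, _⟩ := (hB s r hr hrs hs).2 hsn
    obtain ⟨i1, i2, i3⟩ := ih (by omega) (by omega) h3
    refine ⟨.step h1 h2 h3 i1, ?_, ?_⟩
    · have e1 : s - r + (r - Q s r) = s - Q s r := by omega
      have e2 : s + Q s r - 2 * Q s r = s - Q s r := by omega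
      rw [e2] at i2
      rw [lcost, e1, i2, h4]
    · rw [List.map_cons, List.sum_cons, i3, h5]

/-- The principle of optimality, valid for the lexicographic order because that order is preserved
when both components are translated. -/
theorem IsProfile.lexLE (hW0 : W n = 0)
    (hB : ∀ s r, 1 ≤ r → r ≤ s → s ≤ n → Bellman n W F P Q s r) {s r : ℕ} {ks : List ℕ}
    (h : IsProfile n s r ks) (hr : 1 ≤ r) (hrs : r ≤ s) (hs : s ≤ n) :
    LexLE (F s r) (P s r) (lcost W (s - r) ks) (ks.map bitCount).sum := by
  induction h with
  | last r =>
    obtain ⟨h1, h2⟩ := (hB n r hr hrs le_rfl).1 rfl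
    refine .inr ⟨?_, ?_⟩
    · simp [lcost, Nat.sub_add_cancel hrs, hW0, h1]
    · simp [h2]
  | @step s r q ks hq hqr hsq _ ih =>
    obtain ⟨_, _, _, _, _, h6⟩ := (hB s r hr hrs hs).2 (by omega)
    have e1 : s - r + (r - q) = s - q := by omega
    have e2 : s + q - 2 * q = s - q := by omega
    have i := ih (by omega) (by omega) hsq
    rw [e2] at i
    rw [lcost, e1, List.map_cons, List.sum_cons]
    exact (h6 q hq hqr hsq).trans (i.add _ _)

end Bellman

/-! ### Sorted weights -/

/-- In a nonincreasing sequence the last terms are the lightest. In the induction the top index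
either belongs to `S` and cancels, or the window is shifted down by one, which only increases its
terms. -/
theorem sum_Ico_le_sum {v : ℕ → ℝ} {n : ℕ} (hv : ∀ x y, x ≤ y → y < n → v y ≤ v x)
    (S : Finset ℕ) (hS : S ⊆ Finset.range n) :
    ∑ x ∈ Finset.Ico (n - S.card) n, v x ≤ ∑ x ∈ S, v x := by
  induction n generalizing S with
  | zero => have : S = ∅ := by simpa using hS
            simp [this]
  | succ n ih =>
    have hv' : ∀ x y, x ≤ y → y < n → v y ≤ v x := fun x y h h' => hv x y h (by omega)
    have hcard := Finset.card_le_card hS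
    rw [Finset.card_range] at hcard
    by_cases hn : n ∈ S
    · have hc := Finset.card_erase_of_mem hn
      have hpos : 0 < S.card := Finset.card_pos.2 ⟨n, hn⟩
      have h1 := ih hv' (S.erase n) fun x hx => by
        have h2 := Finset.mem_range.1 (hS (Finset.mem_of_mem_erase hx))
        have h3 := Finset.ne_of_mem_erase hx
        exact Finset.mem_range.2 (by omega)
      rw [hc] at h1
      have e : n + 1 - S.card = n - (S.card - 1) := by omega
      rw [e, Finset.sum_Ico_succ_top (by omega), ← Finset.add_sum_erase S v hn]
      linarith
    · have hS' : S ⊆ Finset.range n := fun x hx => by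
        have h2 := Finset.mem_range.1 (hS hx)
        have h3 : x ≠ n := fun h => hn (h ▸ hx)
        exact Finset.mem_range.2 (by omega)
      have hcard' := Finset.card_le_card hS'
      rw [Finset.card_range] at hcard'
      refine le_trans ?_ (ih hv' S hS')
      have e : n + 1 - S.card = n - S.card + 1 := by omega
      rw [e, ← Finset.sum_Ico_add' v (n - S.card) n 1]
      refine Finset.sum_le_sum fun x hx => hv x (x + 1) (by omega) ?_
      have := (Finset.mem_Ico.1 hx).2
      omega

section Rank

variable (u : ℕ → ℝ) (n : ℕ)

/-- In the sorted order, `j` comes before `i`. -/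
def Before (j i : ℕ) : Prop := u i < u j ∨ ¬ u j < u i ∧ j < i

open Classical in
/-- The number of symbols `j < m` that come before `i`. -/
noncomputable def rankUpTo (m i : ℕ) : ℕ := ((Finset.range m).filter fun j => Before u j i).card

variable {u n}

theorem Before.trans {i j k : ℕ} (h : Before u i j) (h' : Before u j k) : Before u i k := by
  rcases h with h | ⟨h, h1⟩ <;> rcases h' with h' | ⟨h', h2⟩
  · exact .inl (h'.trans h)
  · exact .inl (lt_of_le_of_lt (not_lt.1 h') h)
  · exact .inl (lt_of_lt_of_le h' (not_lt.1 h))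
  · exact .inr ⟨not_lt.2 ((not_lt.1 h').trans (not_lt.1 h)), h1.trans h2⟩

theorem not_before_self (i : ℕ) : ¬ Before u i i := by
  rintro (h | ⟨_, h⟩)
  · exact lt_irrefl _ h
  · exact lt_irrefl _ h

theorem before_total {i j : ℕ} (h : i ≠ j) : Before u i j ∨ Before u j i := by
  by_cases h1 : u i < u j
  · exact .inr (.inl h1)
  by_cases h2 : u j < u i
  · exact .inl (.inl h2)
  rcases Nat.lt_or_gt_of_ne h with h3 | h3
  · exact .inl (.inr ⟨h1, h3⟩)
  · exact .inr (.inr ⟨h2, h3⟩)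

theorem rankUpTo_succ (m i : ℕ) [Decidable (Before u m i)] :
    rankUpTo u (m + 1) i = rankUpTo u m i + if Before u m i then 1 else 0 := by
  classical
  rw [rankUpTo, Finset.range_add_one, Finset.filter_insert]
  split_ifs with h
  · rw [Finset.card_insert_of_notMem (by simp), rankUpTo]
  · rfl

theorem rankUpTo_le (m i : ℕ) : rankUpTo u m i ≤ m := by
  classical
  simpa [rankUpTo] using Finset.card_filter_le (Finset.range m) fun j => Before u j i

theorem rank_lt {i : ℕ} (hi : i < n) : rankUpTo u n i < n := by
  classical
  have h : (Finset.range n).filter (fun j => Before u j i) ⊂ Finset.range n :=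
    (Finset.filter_ssubset).2 ⟨i, Finset.mem_range.2 hi, not_before_self i⟩
  simpa [rankUpTo] using Finset.card_lt_card h

theorem rank_lt_rank {i j : ℕ} (hi : i < n) (h : Before u i j) :
    rankUpTo u n i < rankUpTo u n j := by
  classical
  refine Finset.card_lt_card (Finset.ssubset_iff_of_subset ?_ |>.2 ⟨i, ?_, ?_⟩)
  · intro k hk
    rw [Finset.mem_filter] at hk ⊢
    exact ⟨hk.1, hk.2.trans h⟩
  · simp [hi, h]
  · simp [not_before_self]

theorem rank_injOn : Set.InjOn (rankUpTo u n) (Finset.range n) := by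
  intro i hi j hj hij
  by_contra hne
  simp only [Finset.coe_range, Set.mem_Iio] at hi hj
  rcases before_total (u := u) hne with h | h
  · exact absurd hij (rank_lt_rank hi h).ne
  · exact absurd hij (rank_lt_rank hj h).ne'

/-- Ties are broken by the index, so ranks are distinct; an injective self-map of a finite set is
onto. -/
theorem exists_rank {x : ℕ} (hx : x < n) : ∃ i < n, rankUpTo u n i = x := by
  have := Finset.surj_on_of_inj_on_of_card_le (s := Finset.range n) (t := Finset.range n)
    (fun i _ => rankUpTo u n i) (fun i hi => by simpa using rank_lt (by simpa using hi))
    (fun i j hi hj h => rank_injOn (by simpa using hi) (by simpa using hj) h) le_rfl x (by simpa)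
  obtain ⟨i, hi, h⟩ := this
  exact ⟨i, by simpa using hi, h.symm⟩

variable {σ : ℕ → ℕ} {v : ℕ → ℝ}

theorem sorted_antitone (hv : ∀ i < n, v (rankUpTo u n i) = u i) (x y : ℕ) (hxy : x ≤ y)
    (hy : y < n) : v y ≤ v x := by
  obtain ⟨i, hi, rfl⟩ := exists_rank (u := u) (hxy.trans_lt hy)
  obtain ⟨j, hj, rfl⟩ := exists_rank (u := u) hy
  rw [hv i hi, hv j hj]
  by_contra h
  have := rank_lt_rank (n := n) hj (.inl (not_le.1 h) : Before u j i)
  omega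

theorem sorted_sum_le (hv : ∀ i < n, v (rankUpTo u n i) = u i) (l : List ℕ) (hl : l.Nodup)
    (hlt : ∀ i ∈ l, i < n) :
    ∑ x ∈ Finset.Ico (n - l.length) n, v x ≤ (l.map u).sum := by
  have hinj : Set.InjOn (rankUpTo u n) l.toFinset := rank_injOn.mono fun i hi => by
    simpa using hlt i (by simpa using hi)
  have h := sum_Ico_le_sum (sorted_antitone hv) (l.toFinset.image (rankUpTo u n)) fun x hx => by
    obtain ⟨i, hi, rfl⟩ := Finset.mem_image.1 hx
    simpa using rank_lt (hlt i (by simpa using hi))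
  rw [Finset.card_image_of_injOn hinj, List.toFinset_card_of_nodup hl,
    Finset.sum_image hinj] at h
  refine h.trans (le_of_eq ?_)
  rw [← List.sum_toFinset _ hl]
  exact Finset.sum_congr rfl fun i hi => hv i (hlt i (by simpa using hi))

theorem sorted_weight (hσ : ∀ i < n, σ (rankUpTo u n i) = i)
    (hv : ∀ i < n, v (rankUpTo u n i) = u i) {x : ℕ} (hx : x < n) : σ x < n ∧ v x = u (σ x) := by
  obtain ⟨i, hi, rfl⟩ := exists_rank (u := u) hx
  rw [hσ i hi, hv i hi]
  exact ⟨hi, rfl⟩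

/-- The multiset form matches the way in which leaf labels are tracked through the merging. -/
theorem sorted_image (hσ : ∀ i < n, σ (rankUpTo u n i) = i) :
    (Multiset.range n).map σ = Multiset.range n := by
  have h1 : ((Multiset.range n).map σ).Nodup := by
    refine (Multiset.nodup_map_iff_of_inj_on ?_ |>.2 (Multiset.nodup_range n))
    intro x hx y hy hxy
    obtain ⟨i, hi, rfl⟩ := exists_rank (u := u) (Multiset.mem_range.1 hx)
    obtain ⟨j, hj, rfl⟩ := exists_rank (u := u) (Multiset.mem_range.1 hy)
    rw [hσ i hi, hσ j hj] at hxy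
    rw [hxy]
  refine (Multiset.Nodup.ext h1 (Multiset.nodup_range n)).2 fun i => ?_
  rw [Multiset.mem_map, Multiset.mem_range]
  constructor
  · rintro ⟨x, hx, rfl⟩
    obtain ⟨i, hi, rfl⟩ := exists_rank (u := u) (Multiset.mem_range.1 hx)
    rwa [hσ i hi]
  · intro hi
    exact ⟨_, Multiset.mem_range.2 (rank_lt hi), hσ i hi⟩

end Rank

end SkeletonCode

namespace SkeletonCode

/-! ### Ordering the leaves so that perfect subtrees arise -/

section Profile

variable {n s r : ℕ} {ks : List ℕ}

theorem IsProfile.sum_eq (h : IsProfile n s r ks) (hrs : r ≤ s) : s - r + ks.sum = n := by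
  induction h with
  | last r => simp; omega
  | step h1 h2 h3 _ ih => have := ih (by omega); rw [List.sum_cons]; omega

theorem IsProfile.length_add_le (h : IsProfile n s r ks) : s + ks.length ≤ n + 1 := by
  induction h with
  | last r => simp
  | step h1 h2 h3 _ ih => rw [List.length_cons]; omega

/-- Kraft's equality for `r` full trees, cleared of denominators: turning `q` roots into `2 * q`
nodes one level deeper does not change the sum. -/
theorem IsProfile.kraft (h : IsProfile n s r ks) :
    ∑ j ∈ Finset.range ks.length, ks.getD j 0 * 2 ^ (ks.length - j) = r * 2 ^ ks.length := by
  induction h with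
  | last r => simp
  | @step s r q ks h1 h2 h3 _ ih =>
    rw [List.length_cons, Finset.sum_range_succ']
    simp only [List.getD_cons_succ, Nat.add_sub_add_right, ih, List.getD_cons_zero, Nat.sub_zero]
    obtain ⟨k, rfl⟩ := Nat.exists_eq_add_of_le h2
    rw [Nat.add_sub_cancel_left]
    ring

/-- A digit `b` of the number of leaves on level `j` thus has `b ≤ j`, so the root depth `j - b` of
its block makes sense. -/
theorem IsProfile.getD_lt (h : IsProfile n s 1 ks) (j : ℕ) : ks.getD j 0 < 2 ^ (j + 1) := by
  by_cases hj : j < ks.length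
  · have h1 := h.kraft
    have h2 := Finset.single_le_sum (f := fun j => ks.getD j 0 * 2 ^ (ks.length - j))
      (fun _ _ => Nat.zero_le _) (Finset.mem_range.2 hj)
    rw [h1, one_mul] at h2
    have h3 : 2 ^ ks.length = 2 ^ j * 2 ^ (ks.length - j) := by
      rw [← pow_add]; congr 1; omega
    rw [h3] at h2
    have h4 := Nat.le_of_mul_le_mul_right h2 (by positivity)
    rw [pow_succ]
    have : 0 < 2 ^ j := by positivity
    omega
  · rw [List.getD_eq_default _ _ (by omega)]; positivity

/-- The number of leaves above level `j`. -/
def offset (ks : List ℕ) (j : ℕ) : ℕ := (ks.take j).sum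

/-- Summation by parts: a leaf on level `j` occurs in exactly `j` of the tail sums that form
`lcost`. The initial depth `d` absorbs the shift of levels in the induction. -/
theorem lcost_eq {W v : ℕ → ℝ} (hW : ∀ m ≤ n, W m = ∑ x ∈ Finset.Ico m n, v x) (m d : ℕ)
    (h : m + ks.sum = n) : ∑ j ∈ Finset.range ks.length, ∑ x ∈ Finset.Ico (m + offset ks j)
      (m + offset ks j + ks.getD j 0), ((d + j : ℕ) : ℝ) * v x = d * W m + lcost W m ks := by
  induction ks generalizing m d with
  | nil =>
    have hm : m = n := by simpa using h
    subst hm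
    have h0 : W m = 0 := by simpa using hW m le_rfl
    simp [lcost, h0]
  | cons k ks ih =>
    rw [List.sum_cons] at h
    have h1 := ih (m + k) (d + 1) (by omega)
    rw [List.length_cons, Finset.sum_range_succ']
    simp only [offset, List.take_succ_cons, List.sum_cons, List.getD_cons_succ, List.take_zero,
      List.sum_nil, add_zero, List.getD_cons_zero] at h1 ⊢
    simp only [← add_assoc, add_right_comm d _ 1] at h1 ⊢
    rw [h1, ← Finset.mul_sum, lcost, hW m (by omega), hW (m + k) (by omega),
      ← Finset.sum_Ico_consecutive v (show m ≤ m + k by omega) (show m + k ≤ n by omega)]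
    push_cast
    ring

end Profile

/-- The leaves on level `j` that belong to a perfect subtree with `2 ^ b` leaves; there are `2 ^ b`
of them if the number `k` of leaves on this level has the binary digit `b`, and otherwise none. The
first leaf on this level in the sorted order has the number `o`. -/
def piece (σ : ℕ → ℕ) (o k j b : ℕ) : List (ℕ × ℕ) :=
  (List.range' (o + k / 2 ^ (b + 1) * 2 ^ (b + 1))
    (k / 2 ^ b * 2 ^ b - k / 2 ^ (b + 1) * 2 ^ (b + 1))).map fun x => (j, σ x)

/-- All leaves, as pairs of a depth and a symbol, ordered by the depths of the roots of the perfect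
subtrees. -/
def leafSeq (σ : ℕ → ℕ) (ks : List ℕ) : List (ℕ × ℕ) :=
  (List.range ks.length).flatMap fun d => (List.range (ks.length - d)).flatMap fun b =>
    piece σ (offset ks (d + b)) (ks.getD (d + b) 0) (d + b) b

/-- Clearing the digits below `b` and clearing those below `b + 1` differ by the digit `b`; the two
cleared numbers delimit a block. -/
theorem div_two_pow_eq (k b : ℕ) :
    k / 2 ^ b * 2 ^ b = k / 2 ^ (b + 1) * 2 ^ (b + 1) + k / 2 ^ b % 2 * 2 ^ b := by
  have h1 : k / 2 ^ (b + 1) = k / 2 ^ b / 2 := by rw [pow_succ, Nat.div_div_eq_div_mul]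
  rw [h1, pow_succ]
  calc k / 2 ^ b * 2 ^ b = (2 * (k / 2 ^ b / 2) + k / 2 ^ b % 2) * 2 ^ b := by
        rw [Nat.div_add_mod]
    _ = _ := by ring

theorem length_piece (σ : ℕ → ℕ) (o k j b : ℕ) :
    (piece σ o k j b).length = k / 2 ^ b % 2 * 2 ^ b := by
  have := div_two_pow_eq k b
  simp only [piece, List.length_map, List.length_range']
  omega

theorem sum_piece {M : Type*} [AddCommMonoid M] (σ : ℕ → ℕ) (g : ℕ × ℕ → M) (o k j b : ℕ) :
    ((piece σ o k j b).map g).sum = ∑ x ∈ Finset.Ico (o + k / 2 ^ (b + 1) * 2 ^ (b + 1))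
      (o + k / 2 ^ b * 2 ^ b), g (j, σ x) := by
  have h : (o + k / 2 ^ b * 2 ^ b) - (o + k / 2 ^ (b + 1) * 2 ^ (b + 1)) =
      k / 2 ^ b * 2 ^ b - k / 2 ^ (b + 1) * 2 ^ (b + 1) := by omega
  rw [piece, List.map_map, ← h]
  rfl

theorem sum_pieces {M : Type*} [AddCommMonoid M] (σ : ℕ → ℕ) (g : ℕ × ℕ → M) (o k j J : ℕ) :
    ∑ b ∈ Finset.range J, ((piece σ o k j b).map g).sum =
      ∑ x ∈ Finset.Ico (o + k / 2 ^ J * 2 ^ J) (o + k), g (j, σ x) := by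
  induction J with
  | zero => simp
  | succ J ih =>
    have h := div_two_pow_eq k J
    have h2 := Nat.div_mul_le_self k (2 ^ J)
    rw [Finset.sum_range_succ, ih, sum_piece, add_comm, Finset.sum_Ico_consecutive] <;> omega

theorem sum_flatMap {α M : Type*} [AddCommMonoid M] (l : List ℕ) (f : ℕ → List α) (g : α → M) :
    ((l.flatMap f).map g).sum = (l.map fun d => ((f d).map g).sum).sum := by
  induction l with
  | nil => simp
  | cons a l ih => simp [ih]

theorem sum_map_range {M : Type*} [AddCommMonoid M] (N : ℕ) (f : ℕ → M) :
    ((List.range N).map f).sum = ∑ d ∈ Finset.range N, f d := rfl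

theorem sum_triangle {M : Type*} [AddCommMonoid M] (N : ℕ) (f : ℕ → ℕ → M) :
    ∑ d ∈ Finset.range N, ∑ b ∈ Finset.range (N - d), f (d + b) b =
      ∑ j ∈ Finset.range N, ∑ b ∈ Finset.range (j + 1), f j b := by
  rw [← Finset.sum_range_diag_flip N fun d b => f (d + b) b]
  refine Finset.sum_congr rfl fun j _ => ?_
  rw [← Finset.sum_range_reflect]
  refine Finset.sum_congr rfl fun b hb => ?_
  have := Finset.mem_range.1 hb
  congr 1 <;> omega

/-- The blocks of a level tile it, so ordering by root depth only permutes the leaves. A general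
monoid lets this serve the Kraft sum, the cost, the multiset of labels and the length. -/
theorem sum_leafSeq {M : Type*} [AddCommMonoid M] (σ : ℕ → ℕ) (g : ℕ × ℕ → M) {ks : List ℕ}
    (hks : ∀ j, ks.getD j 0 < 2 ^ (j + 1)) :
    ((leafSeq σ ks).map g).sum = ∑ j ∈ Finset.range ks.length,
      ∑ x ∈ Finset.Ico (offset ks j) (offset ks j + ks.getD j 0), g (j, σ x) := by
  simp only [leafSeq, sum_flatMap, sum_map_range]
  rw [sum_triangle ks.length fun j b =>
    ((piece σ (offset ks j) (ks.getD j 0) j b).map g).sum]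
  refine Finset.sum_congr rfl fun j _ => ?_
  rw [sum_pieces, Nat.div_eq_of_lt (hks j)]
  simp

/-! ### Building a tree by merging on a stack -/

/-- Put the tree `t` of depth `d` on the stack, merging trees of the same depth. -/
def merge : List (ℕ × LTree) → ℕ → ℕ → LTree → ℕ × List (ℕ × LTree)
  | [], nx, d, t => (nx, [(d, t)])
  | (e, u) :: st, nx, d, t =>
    if e = d then merge st (nx + 1) (d - 1) (.node nx u t) else (nx, (d, t) :: (e, u) :: st)

/-- Put a leaf on the stack. -/
def push (z : ℕ × List (ℕ × LTree)) (y : ℕ × ℕ) : ℕ × List (ℕ × LTree) :=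
  merge z.2 (z.1 + 1) y.1 (.leaf z.1 y.2)

theorem merge_of_lt {st : List (ℕ × LTree)} {d : ℕ} (h : ∀ x ∈ st, x.1 < d) (nx : ℕ) (t : LTree) :
    merge st nx d t = (nx, (d, t) :: st) := by
  cases st with
  | nil => rfl
  | cons x st => rw [merge, if_neg (h x (by simp)).ne]

/-- A block acts like one perfect tree with root depth `d`. Its first half becomes a tree of depth
`d + 1`, which stays on top because everything below has depth at most `d`; the second half then
merges with it. -/
theorem foldl_push_block (b d nx : ℕ) (st : List (ℕ × LTree)) (l : List (ℕ × ℕ))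
    (hl : l.length = 2 ^ b) (hd : ∀ y ∈ l, y.1 = d + b) (hst : ∀ x ∈ st, x.1 ≤ d) :
    ∃ nx' t, l.foldl push (nx, st) = merge st nx' d t ∧ t.ph = b + 1 := by
  induction b generalizing d nx st l with
  | zero =>
    obtain ⟨y, rfl⟩ := List.length_eq_one_iff.1 (by simpa using hl)
    have := hd y (by simp)
    exact ⟨nx + 1, .leaf nx y.2, by simp [push, this], rfl⟩
  | succ b ih =>
    have hl2 : 2 ^ (b + 1) = 2 ^ b + 2 ^ b := by rw [pow_succ]; ring
    rw [hl2] at hl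
    obtain ⟨nx1, t1, h1, hp1⟩ := ih (d + 1) nx st (l.take (2 ^ b)) (by simp; omega)
      (fun y hy => by rw [hd y (List.mem_of_mem_take hy)]; ring)
      (fun x hx => (hst x hx).trans (by omega))
    rw [merge_of_lt fun x hx => Nat.lt_succ_of_le (hst x hx)] at h1
    obtain ⟨nx2, t2, h2, hp2⟩ := ih (d + 1) nx1 ((d + 1, t1) :: st) (l.drop (2 ^ b))
      (by simp; omega)
      (fun y hy => by rw [hd y (List.mem_of_mem_drop hy)]; ring)
      (fun x hx => by
        rcases List.mem_cons.1 hx with rfl | hx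
        · exact le_rfl
        · exact (hst x hx).trans (by omega))
    refine ⟨nx2 + 1, .node nx2 t1 t2, ?_, by simp [LTree.ph, hp1, hp2]⟩
    conv_lhs => rw [← List.take_append_drop (2 ^ b) l]
    rw [List.foldl_append, h1, h2, merge, if_pos rfl, Nat.add_sub_cancel]

/-- The depths on the stack increase towards its top and are at most `d`. -/
def StackSorted (d : ℕ) (st : List (ℕ × LTree)) : Prop :=
  st.Pairwise (fun x y => y.1 < x.1) ∧ ∀ x ∈ st, x.1 ≤ d

theorem StackSorted.mono {d d' : ℕ} {st : List (ℕ × LTree)} (h : StackSorted d st) (hd : d ≤ d') :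
    StackSorted d' st := ⟨h.1, fun x hx => (h.2 x hx).trans hd⟩

/-- Merging works like a carry, so depths stay distinct; joining two trees never increases the
number of maximal perfect subtrees. -/
theorem StackSorted.merge {d : ℕ} {st : List (ℕ × LTree)} (h : StackSorted d st) (nx : ℕ)
    (t : LTree) : StackSorted d (merge st nx d t).2 ∧
      ((SkeletonCode.merge st nx d t).2.map fun x => x.2.sk).sum ≤
        (st.map fun x => x.2.sk).sum + t.sk := by
  induction st generalizing nx d t with
  | nil => simp [SkeletonCode.merge, StackSorted]
  | cons x st ih =>
    obtain ⟨e, u⟩ := x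
    have hp := List.pairwise_cons.1 h.1
    rw [SkeletonCode.merge]
    split_ifs with hed
    · subst hed
      have h' : StackSorted (e - 1) st := ⟨hp.2, fun x hx => by
        have : x.1 < e := hp.1 x hx
        omega⟩
      obtain ⟨h1, h2⟩ := ih h' (nx + 1) (.node nx u t)
      refine ⟨h1.mono (by omega), ?_⟩
      have := LTree.sk_node_le nx u t
      simp only [List.map_cons, List.sum_cons]
      omega
    · have he := h.2 (e, u) (by simp)
      have hlt : e < d := lt_of_le_of_ne he hed
      refine ⟨⟨List.pairwise_cons.2 ⟨fun x hx => ?_, h.1⟩, fun x hx => ?_⟩, ?_⟩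
      · rcases List.mem_cons.1 hx with rfl | hx
        · exact hlt
        · exact (hp.1 x hx).trans hlt
      · rcases List.mem_cons.1 hx with rfl | hx
        · exact le_rfl
        · exact h.2 x hx
      · simp only [List.map_cons, List.sum_cons]; omega

theorem StackSorted.piece {d b nx : ℕ} {st : List (ℕ × LTree)} (h : StackSorted d st) (σ : ℕ → ℕ)
    (o k : ℕ) : StackSorted d ((piece σ o k (d + b) b).foldl push (nx, st)).2 ∧
      (((SkeletonCode.piece σ o k (d + b) b).foldl push (nx, st)).2.map fun x => x.2.sk).sum ≤
        (st.map fun x => x.2.sk).sum + k / 2 ^ b % 2 := by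
  have hlen := length_piece σ o k (d + b) b
  rcases Nat.mod_two_eq_zero_or_one (k / 2 ^ b) with hk | hk
  · rw [hk, zero_mul] at hlen
    rw [List.eq_nil_of_length_eq_zero hlen]
    exact ⟨h, by simp⟩
  · rw [hk, one_mul] at hlen
    obtain ⟨nx', t, h1, h2⟩ := foldl_push_block b d nx st _ hlen
      (fun y hy => by
        simp only [SkeletonCode.piece, List.mem_map] at hy
        obtain ⟨x, _, rfl⟩ := hy
        rfl) h.2
    rw [h1, hk, ← LTree.sk_eq_one (t := t) (by omega)]
    exact h.merge nx' t

theorem StackSorted.pieces {d nx : ℕ} {st : List (ℕ × LTree)} (h : StackSorted d st) (σ : ℕ → ℕ)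
    (o k : ℕ → ℕ) (l : List ℕ) :
    StackSorted d ((l.flatMap fun b => SkeletonCode.piece σ (o b) (k b) (d + b) b).foldl push
      (nx, st)).2 ∧
    (((l.flatMap fun b => SkeletonCode.piece σ (o b) (k b) (d + b) b).foldl push
      (nx, st)).2.map fun x => x.2.sk).sum ≤
        (st.map fun x => x.2.sk).sum + (l.map fun b => k b / 2 ^ b % 2).sum := by
  induction l generalizing nx st with
  | nil => exact ⟨h, by simp⟩
  | cons b l ih =>
    rw [List.flatMap_cons, List.foldl_append]
    obtain ⟨h1, h2⟩ := h.piece (b := b) (nx := nx) σ (o b) (k b)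
    obtain ⟨h3, h4⟩ := ih h1 (nx := _)
    refine ⟨h3, h4.trans ?_⟩
    simp only [List.map_cons, List.sum_cons]
    omega

/-- Root depths never decrease along the list, which is what each new block requires of the stack.
Every block adds at most one perfect subtree, and there is one block per binary one. -/
theorem stackSorted_leafSeq (σ : ℕ → ℕ) {ks : List ℕ} (hks : ∀ j, ks.getD j 0 < 2 ^ (j + 1)) :
    StackSorted ks.length ((leafSeq σ ks).foldl push (1, [])).2 ∧
      (((leafSeq σ ks).foldl push (1, [])).2.map fun x => x.2.sk).sum ≤
        (ks.map bitCount).sum := by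
  have key : ∀ D, StackSorted D (((List.range D).flatMap fun d =>
      (List.range (ks.length - d)).flatMap fun b =>
        piece σ (offset ks (d + b)) (ks.getD (d + b) 0) (d + b) b).foldl push (1, [])).2 ∧
      ((((List.range D).flatMap fun d => (List.range (ks.length - d)).flatMap fun b =>
        piece σ (offset ks (d + b)) (ks.getD (d + b) 0) (d + b) b).foldl push
          (1, [])).2.map fun x => x.2.sk).sum ≤
      ∑ d ∈ Finset.range D, ∑ b ∈ Finset.range (ks.length - d),
        ks.getD (d + b) 0 / 2 ^ b % 2 := by
    intro D
    induction D with
    | zero => exact ⟨⟨List.Pairwise.nil, by simp⟩, by simp⟩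
    | succ D ih =>
      rw [List.range_succ, List.flatMap_append, List.foldl_append, Finset.sum_range_succ]
      have h1 := ih.1.pieces (nx := (((List.range D).flatMap fun d =>
        (List.range (ks.length - d)).flatMap fun b =>
        piece σ (offset ks (d + b)) (ks.getD (d + b) 0) (d + b) b).foldl push (1, [])).1) σ
        (fun b => offset ks (D + b)) (fun b => ks.getD (D + b) 0) (List.range (ks.length - D))
      simp only [List.flatMap_cons, List.flatMap_nil, List.append_nil]
      refine ⟨h1.1.mono (by omega), h1.2.trans ?_⟩
      rw [sum_map_range]
      have := ih.2
      omega
  refine ⟨(key ks.length).1, (key ks.length).2.trans (le_of_eq ?_)⟩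
  rw [sum_triangle ks.length fun j b => ks.getD j 0 / 2 ^ b % 2]
  rw [Finset.sum_congr rfl fun j _ => (bitCount_eq_sum (hks j)).symm, Finset.sum_range,
    ← List.sum_ofFn]
  congr 1
  refine List.ext_getElem (by simp) fun j hj hj' => ?_
  have hj'' : j < ks.length := by simpa using hj'
  rw [List.getElem_map, List.getElem_ofFn, List.getD_eq_getElem _ _ hj'']

/-! ### Invariants of the stack: Kraft sum, cost, labels and addresses -/

section Invariants

variable {N : ℕ}

/-- The Kraft sum of a stack, times `2 ^ N`. -/
def kraftSum (N : ℕ) (st : List (ℕ × LTree)) : ℕ := (st.map fun x => 2 ^ (N - x.1)).sum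

/-- The contribution of a stack to the cost of the code. -/
def stackCost (u : ℕ → ℝ) (st : List (ℕ × LTree)) : ℝ :=
  (st.map fun x => x.2.wpl u + (x.1 : ℝ) * x.2.wsum u).sum

/-- Two trees of depth `e` and their join of depth `e - 1` have the same Kraft sum, and the edge
gained inside the tree is lost above it, so the cost is the same as well. -/
theorem merge_kraft (u : ℕ → ℝ) {st : List (ℕ × LTree)} {d : ℕ} (hd : d ≤ N)
    (hk : kraftSum N st + 2 ^ (N - d) ≤ 2 ^ N) (nx : ℕ) (t : LTree) :
    kraftSum N (merge st nx d t).2 = kraftSum N st + 2 ^ (N - d) ∧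
      stackCost u (merge st nx d t).2 = stackCost u st + (t.wpl u + d * t.wsum u) := by
  induction st generalizing nx d t with
  | nil => simp [merge, kraftSum, stackCost]
  | cons x st ih =>
    obtain ⟨e, w⟩ := x
    rw [merge]
    split_ifs with hed
    · subst hed
      have hpos : 0 < 2 ^ N := by positivity
      have hk' : kraftSum N ((e, w) :: st) = kraftSum N st + 2 ^ (N - e) := by
        simp [kraftSum, add_comm]
      rw [hk'] at hk ⊢
      -- Two trees of depth `0` would have Kraft sum at least two, so the truncated `d - 1` is never
      -- used at `0`.
      rcases e with _ | e
      · simp only [Nat.sub_zero] at hk; omega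
      · have h2 : 2 ^ (N - (e + 1 - 1)) = 2 ^ (N - (e + 1)) + 2 ^ (N - (e + 1)) := by
          have : N - (e + 1 - 1) = N - (e + 1) + 1 := by omega
          rw [this, pow_succ]; ring
        obtain ⟨h3, h4⟩ := ih (d := e + 1 - 1) (by omega) (by omega) (nx + 1) (.node nx w t)
        refine ⟨by omega, ?_⟩
        rw [h4, LTree.wsum_node, LTree.wpl]
        simp only [stackCost, List.map_cons, List.sum_cons, Nat.add_sub_cancel]
        push_cast
        ring
    · simp only [kraftSum, stackCost, List.map_cons, List.sum_cons]
      exact ⟨by ring, by ring⟩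

theorem merge_labels (st : List (ℕ × LTree)) (nx d : ℕ) (t : LTree) :
    ((merge st nx d t).2.map fun x => (x.2.labels : Multiset ℕ)).sum =
      (st.map fun x => (x.2.labels : Multiset ℕ)).sum + t.labels := by
  induction st generalizing nx d t with
  | nil => simp [merge]
  | cons x st ih =>
    obtain ⟨e, w⟩ := x
    rw [merge]
    split_ifs with hed
    · rw [ih]
      simp only [LTree.labels, List.map_cons, List.sum_cons, ← Multiset.coe_add]
      abel
    · simp only [List.map_cons, List.sum_cons]
      abel

/-- The addresses of the nodes on the stack are different, positive and below `nx`. -/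
def FreshIds (nx : ℕ) (ids : List ℕ) : Prop := ids.Nodup ∧ ∀ v ∈ ids, v ≠ 0 ∧ v < nx

theorem FreshIds.merge {st : List (ℕ × LTree)} {nx : ℕ} {t : LTree} (d : ℕ)
    (h : FreshIds nx (t.ids ++ st.flatMap fun x => x.2.ids)) (hnx : nx ≠ 0) :
    FreshIds (merge st nx d t).1 ((SkeletonCode.merge st nx d t).2.flatMap fun x => x.2.ids) ∧
      (SkeletonCode.merge st nx d t).1 ≠ 0 := by
  induction st generalizing nx d t with
  | nil => exact ⟨by simpa [SkeletonCode.merge] using h, hnx⟩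
  | cons x st ih =>
    obtain ⟨e, w⟩ := x
    rw [SkeletonCode.merge]
    split_ifs with hed
    · refine ih (nx := nx + 1) (d := d - 1) (t := .node nx w t) ?_ (by omega)
      have hperm : (LTree.ids (.node nx w t) ++ st.flatMap fun x => x.2.ids).Perm
          (nx :: (t.ids ++ ((e, w) :: st).flatMap fun x => x.2.ids)) := by
        simp only [LTree.ids, List.flatMap_cons, List.cons_append, ← List.append_assoc]
        exact (List.perm_append_comm.append_right _).cons _
      refine ⟨hperm.nodup_iff.2 (List.nodup_cons.2 ⟨fun hm => ?_, h.1⟩), fun v hv => ?_⟩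
      · exact lt_irrefl _ (h.2 nx hm).2
      · rcases List.mem_cons.1 (hperm.mem_iff.1 hv) with rfl | hv
        · exact ⟨hnx, by omega⟩
        · have := h.2 v hv
          exact ⟨this.1, by omega⟩
    · exact ⟨by simpa using h, hnx⟩

theorem foldl_push_kraft (u : ℕ → ℝ) (l : List (ℕ × ℕ)) (z : ℕ × List (ℕ × LTree))
    (hl : ∀ y ∈ l, y.1 ≤ N) (hk : kraftSum N z.2 + (l.map fun y => 2 ^ (N - y.1)).sum ≤ 2 ^ N) :
    kraftSum N (l.foldl push z).2 = kraftSum N z.2 + (l.map fun y => 2 ^ (N - y.1)).sum ∧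
      stackCost u (l.foldl push z).2 =
        stackCost u z.2 + (l.map fun y => (y.1 : ℝ) * u y.2).sum := by
  induction l generalizing z with
  | nil => simp
  | cons y l ih =>
    simp only [List.map_cons, List.sum_cons] at hk
    obtain ⟨h1, h2⟩ := merge_kraft (N := N) u (st := z.2) (d := y.1) (hl y (by simp)) (by omega)
      (z.1 + 1) (.leaf z.1 y.2)
    obtain ⟨h3, h4⟩ := ih (push z y) (fun y hy => hl y (by simp [hy])) (by rw [push, h1]; omega)
    refine ⟨?_, ?_⟩
    · rw [List.foldl_cons, h3, push, h1, List.map_cons, List.sum_cons]; omega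
    · rw [List.foldl_cons, h4, push, h2, List.map_cons, List.sum_cons]
      simp [LTree.wpl, LTree.wsum, LTree.labels]
      ring

theorem foldl_push_labels (l : List (ℕ × ℕ)) (z : ℕ × List (ℕ × LTree)) :
    ((l.foldl push z).2.map fun x => (x.2.labels : Multiset ℕ)).sum =
      (z.2.map fun x => (x.2.labels : Multiset ℕ)).sum +
        (l.map fun y => ({y.2} : Multiset ℕ)).sum := by
  induction l generalizing z with
  | nil => simp
  | cons y l ih =>
    rw [List.foldl_cons, ih, push, merge_labels, List.map_cons, List.sum_cons]
    simp [LTree.labels, add_assoc]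

theorem FreshIds.push {z : ℕ × List (ℕ × LTree)} (y : ℕ × ℕ)
    (h : FreshIds z.1 (z.2.flatMap fun x => x.2.ids)) (h0 : z.1 ≠ 0) :
    FreshIds (push z y).1 ((SkeletonCode.push z y).2.flatMap fun x => x.2.ids) ∧
      (SkeletonCode.push z y).1 ≠ 0 := by
  refine FreshIds.merge y.1 ⟨?_, ?_⟩ (by omega)
  · refine List.nodup_cons.2 ⟨fun hm => lt_irrefl _ (h.2 _ hm).2, h.1⟩
  · intro v hv
    rcases List.mem_cons.1 hv with rfl | hv
    · exact ⟨h0, by omega⟩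
    · have := h.2 v hv
      exact ⟨this.1, by omega⟩

theorem FreshIds.foldl_push (l : List (ℕ × ℕ)) {z : ℕ × List (ℕ × LTree)}
    (h : FreshIds z.1 (z.2.flatMap fun x => x.2.ids)) (h0 : z.1 ≠ 0) :
    FreshIds (l.foldl SkeletonCode.push z).1
      ((l.foldl SkeletonCode.push z).2.flatMap fun x => x.2.ids) := by
  induction l generalizing z with
  | nil => exact h
  | cons y l ih => exact ih (h.push y h0).1 (h.push y h0).2

/-- A sorted stack with Kraft sum one consists of a single tree of depth zero. -/
theorem StackSorted.eq_singleton {d : ℕ} {st : List (ℕ × LTree)} (h : StackSorted d st)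
    (hN : ∀ x ∈ st, x.1 ≤ N) (hk : kraftSum N st = 2 ^ N) : ∃ t, st = [(0, t)] := by
  rcases st with _ | ⟨⟨e, t⟩, st⟩
  · simp only [kraftSum, List.map_nil, List.sum_nil] at hk
    have : 0 < 2 ^ N := by positivity
    omega
  · have hp := (List.pairwise_cons.1 h.1).1
    have he : e ≤ N := hN (e, t) (by simp)
    -- All entries below the top are shallower, so they contribute even multiples of `2 ^ (N - e)`.
    -- The total is then an odd multiple, equal to `2 ^ e * 2 ^ (N - e)`, which forces `e = 0`.
    have heven : ∀ st : List (ℕ × LTree), (∀ x ∈ st, x.1 < e) →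
        ∃ m, (st.map fun x => 2 ^ (N - x.1)).sum = 2 * m * 2 ^ (N - e) := by
      intro st hst
      induction st with
      | nil => exact ⟨0, by simp⟩
      | cons x st ih =>
        obtain ⟨m, hm⟩ := ih fun y hy => hst y (by simp [hy])
        have := hst x (by simp)
        refine ⟨m + 2 ^ (e - x.1 - 1), ?_⟩
        have h1 : N - x.1 = 1 + (e - x.1 - 1) + (N - e) := by omega
        rw [List.map_cons, List.sum_cons, hm, h1, pow_add, pow_add]
        ring
    obtain ⟨m, hm⟩ := heven st hp
    have h1 : 2 ^ N = 2 ^ e * 2 ^ (N - e) := by rw [← pow_add]; congr 1; omega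
    simp only [kraftSum, List.map_cons, List.sum_cons] at hk
    rw [hm, h1] at hk
    have h2 : (1 + 2 * m) * 2 ^ (N - e) = 2 ^ e * 2 ^ (N - e) := by rw [← hk]; ring
    have h3 := Nat.eq_of_mul_eq_mul_right (by positivity) h2
    rcases e with _ | e
    · refine ⟨t, ?_⟩
      congr 1
      exact List.eq_nil_iff_forall_not_mem.2 fun x hx => by simpa using hp x hx
    · rw [pow_succ] at h3; omega

end Invariants

/-- A profile is realised with its cost and within its bit count at once, because sorting fixes only
which symbols lie on a level, while the order of the leaves stays free for forming perfect subtrees.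
-/
theorem exists_tree_of_leafSeq {n : ℕ} {u v W : ℕ → ℝ} {σ : ℕ → ℕ} {ks : List ℕ}
    (hks : IsProfile n 1 1 ks) (hσ : (Multiset.range n).map σ = Multiset.range n)
    (hv : ∀ x < n, v x = u (σ x)) (hW : ∀ m ≤ n, W m = ∑ x ∈ Finset.Ico m n, v x) :
    ∃ nx t, (leafSeq σ ks).foldl push (1, []) = (nx, [(0, t)]) ∧
      t.labels.Nodup ∧ t.labels.toFinset = Finset.range n ∧ t.ids.Nodup ∧
      t.wpl u = lcost W 0 ks ∧ t.sk ≤ (ks.map bitCount).sum := by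
  have hlt := hks.getD_lt
  have hsum : ks.sum = n := by simpa using hks.sum_eq le_rfl
  have hmem : ∀ y ∈ leafSeq σ ks, y.1 ≤ ks.length := by
    intro y hy
    simp only [leafSeq, piece, List.mem_flatMap, List.mem_map, List.mem_range] at hy
    obtain ⟨d, hd, b, hb, x, _, rfl⟩ := hy
    simp only; omega
  have hkr : ((leafSeq σ ks).map fun y => 2 ^ (ks.length - y.1)).sum = 2 ^ ks.length := by
    rw [sum_leafSeq σ _ hlt]
    simpa using hks.kraft
  obtain ⟨h1, h2⟩ := foldl_push_kraft u (leafSeq σ ks) (1, []) hmem (by simp [kraftSum, hkr])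
  have h3 := foldl_push_labels (leafSeq σ ks) (1, [])
  have h4 := FreshIds.foldl_push (leafSeq σ ks) (z := (1, [])) ⟨by simp, by simp⟩ (by simp)
  obtain ⟨h5, h6⟩ := stackSorted_leafSeq σ hlt
  have hsucc : ∀ j < ks.length, offset ks (j + 1) = offset ks j + ks.getD j 0 := by
    intro j hj
    rw [offset, offset, List.sum_take_succ _ _ hj, List.getD_eq_getElem _ _ hj]
  have hoff : ∀ j, offset ks j ≤ n := fun j => by
    have := List.sum_take_add_sum_drop ks j
    rw [offset]; omega
  have hico : ∀ J ≤ ks.length, ∑ j ∈ Finset.range J,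
      ∑ x ∈ Finset.Ico (offset ks j) (offset ks j + ks.getD j 0), ({σ x} : Multiset ℕ) =
        ∑ x ∈ Finset.range (offset ks J), {σ x} := by
    intro J
    induction J with
    | zero => simp [offset]
    | succ J ih =>
      intro hJ
      have hs := hsucc J (by omega)
      rw [Finset.sum_range_succ, ih (by omega), hs, Finset.sum_range_add_sum_Ico _ (by omega)]
  obtain ⟨t, ht⟩ := h5.eq_singleton h5.2 (by rw [h1, hkr]; simp [kraftSum])
  rw [ht] at h2 h3 h4 h6
  have hlab : (t.labels : Multiset ℕ) = Multiset.range n := by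
    rw [sum_leafSeq σ _ hlt, hico _ le_rfl, offset, List.take_length, hsum] at h3
    rw [← hσ]
    rw [← Multiset.sum_map_singleton ((Multiset.range n).map σ), Multiset.map_map]
    simp only [List.map_cons, List.map_nil, List.sum_cons, List.sum_nil, add_zero, zero_add] at h3
    exact h3
  refine ⟨_, t, Prod.ext rfl ht, ?_, ?_, ?_, ?_, by simpa using h6⟩
  · rw [← Multiset.coe_nodup, hlab]; exact Multiset.nodup_range n
  · ext i
    rw [List.mem_toFinset, Finset.mem_range, ← Multiset.mem_coe, hlab, Multiset.mem_range]
  · simpa using h4.1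
  · have h7 := lcost_eq hW 0 0 (by simpa using hsum)
    rw [sum_leafSeq σ _ hlt] at h2
    simp only [stackCost, List.map_cons, List.map_nil, List.sum_cons, List.sum_nil, add_zero,
      Nat.cast_zero, zero_mul, zero_add] at h2 h7
    rw [h2, ← h7]
    refine Finset.sum_congr rfl fun j hj => Finset.sum_congr rfl fun x hx => ?_
    have h8 := hsucc j (Finset.mem_range.1 hj)
    have h9 := hoff (j + 1)
    have := (Finset.mem_Ico.1 hx).2
    rw [hv x (by omega)]

end SkeletonCode

namespace SkeletonCode

/-! ### Optimal codes and optimal trees -/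

section Optimal

variable {n : ℕ} {w : Fin n → ℝ} {u : ℕ → ℝ} {t : LTree}

theorem mem_labels_iff (ht : t.labels.toFinset = Finset.range n) {i : ℕ} :
    i ∈ t.labels ↔ i < n := by
  rw [← List.mem_toFinset, ht, Finset.mem_range]

theorem prefixFree_path (ht : t.labels.toFinset = Finset.range n) :
    PrefixFree fun i : Fin n => t.path i := fun i j hij h =>
  hij (Fin.ext (LTree.path_prefix ((mem_labels_iff ht).2 i.2) ((mem_labels_iff ht).2 j.2) h))

theorem codeTree_path (hn : t.labels.Nodup) (ht : t.labels.toFinset = Finset.range n) :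
    codeTree (fun i : Fin n => t.path i) = t.nodes := by
  ext p
  rw [LTree.mem_nodes_iff hn]
  exact ⟨fun ⟨i, hi⟩ => ⟨i, (mem_labels_iff ht).2 i.2, hi⟩,
    fun ⟨i, hi, h⟩ => ⟨⟨i, (mem_labels_iff ht).1 hi⟩, h⟩⟩

theorem wpl_eq_sum (hn : t.labels.Nodup) (ht : t.labels.toFinset = Finset.range n) :
    t.wpl u = ∑ i : Fin n, ((t.path i).length : ℝ) * u i := by
  rw [LTree.wpl_eq u hn, ← List.sum_toFinset _ hn, ht, Finset.sum_range]

/-- With positive weights, equal costs force equal lengths symbol by symbol, and then the code is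
the code of the tree. -/
theorem exists_tree_of_code (hn : 0 < n) (hw : ∀ i, 0 < w i) (hu : ∀ i : Fin n, u i = w i)
    {c : Fin n → List Bool} (hc : PrefixFree c) : ∃ t : LTree, t.labels.Nodup ∧
      t.labels.toFinset = Finset.range n ∧ t.wpl u ≤ cost w c ∧
      (cost w c ≤ t.wpl u → codeTree c = t.nodes) := by
  obtain ⟨t, h1, h2, h3, h4⟩ := exists_tree_of_prefixFree (Finset.range n)
    (Finset.nonempty_range_iff.2 hn.ne') (fun i => if h : i < n then c ⟨i, h⟩ else [])
    (fun i hi j hj hij => by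
      rw [Finset.mem_range] at hi hj
      simp only [hi, hj, dif_pos]
      exact hc _ _ (by simpa using hij))
  have h3' : ∀ i : Fin n, (t.path i).length ≤ (c i).length := fun i => by
    simpa using h3 i (by simp)
  have hle : ∀ i ∈ Finset.univ, ((t.path (i : Fin n)).length : ℝ) * u i ≤ (c i).length * w i := by
    intro i _
    rw [hu]
    exact mul_le_mul_of_nonneg_right (by exact_mod_cast h3' i) (hw i).le
  refine ⟨t, h1, h2, ?_, fun h => ?_⟩
  · rw [wpl_eq_sum h1 h2]
    exact Finset.sum_le_sum hle
  · rw [wpl_eq_sum h1 h2] at h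
    have h5 := (Finset.sum_eq_sum_iff_of_le hle).1 (le_antisymm (Finset.sum_le_sum hle) h)
    have h6 : c = fun i : Fin n => t.path i := by
      funext i
      have := h4 (fun j hj => ?_) i (by simp)
      · simpa using this.symm
      · rw [Finset.mem_range] at hj
        have h7 := h5 ⟨j, hj⟩ (Finset.mem_univ _)
        rw [hu] at h7
        have h8 := mul_right_cancel₀ (hw ⟨j, hj⟩).ne' h7
        simpa [hj] using h8
    rw [h6, codeTree_path h1 h2]

/-- The table entry at `(1, 1)` is a lexicographic lower bound for cost and `sk` of every full tree
with these labels; `t` has that cost and does not exceed that bit count. The root alone gives `r =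
1`, and the `n - 1` inner nodes give `s = 1`. -/
theorem hasOptimalSkeleton {W v : ℕ → ℝ} {F : ℕ → ℕ → ℝ} {P Q : ℕ → ℕ → ℕ} {ks : List ℕ}
    (hn : 0 < n) (hw : ∀ i, 0 < w i) (hu : ∀ i : Fin n, u i = w i)
    (hv : ∀ i < n, v (rankUpTo u n i) = u i)
    (hW : ∀ m ≤ n, W m = ∑ x ∈ Finset.Ico m n, v x)
    (hB : ∀ s r, 1 ≤ r → r ≤ s → s ≤ n → Bellman n W F P Q s r) (hks : Follows n Q 1 1 ks)
    (h1 : t.labels.Nodup) (h2 : t.labels.toFinset = Finset.range n)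
    (hcost : t.wpl u = lcost W 0 ks) (hsk : t.sk ≤ (ks.map bitCount).sum) :
    HasOptimalSkeleton w fun i => t.path i := by
  have hW0 : W n = 0 := by simpa using hW n le_rfl
  obtain ⟨_, hF, hP⟩ := hks.spec hW0 hB le_rfl le_rfl hn
  have hcost' : cost w (fun i => t.path i) = F 1 1 := by
    rw [← hF, Nat.sub_self, ← hcost, wpl_eq_sum h1 h2]
    simp [cost, hu]
  have hlow : ∀ t' : LTree, t'.labels.Nodup → t'.labels.toFinset = Finset.range n →
      LexLE (F 1 1) (P 1 1) (t'.wpl u) t'.sk := by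
    intro t' h1' h2'
    obtain ⟨ks', a1, a2, a3⟩ := exists_profile_of_tree (u := u) hW0 (fun l hl hlt => by
      rw [hW _ (Nat.sub_le _ _)]
      exact sorted_sum_le hv l hl hlt) h1' h2'
    have h := a1.lexLE hW0 hB le_rfl le_rfl hn
    refine h.trans ?_
    rcases a2.lt_or_eq with a2 | a2
    · exact .inl a2
    · exact .inr ⟨a2, a3⟩
  have hmin : ∀ c' : Fin n → List Bool, PrefixFree c' →
      cost w (fun i => t.path i) ≤ cost w c' := by
    intro c' hc'
    obtain ⟨t', a1, a2, a3, _⟩ := exists_tree_of_code hn hw hu hc'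
    rw [hcost']
    rcases hlow t' a1 a2 with h | ⟨h, _⟩ <;> linarith
  refine ⟨⟨prefixFree_path h2, hmin⟩, fun c' hc' => ?_⟩
  obtain ⟨t', a1, a2, a3, a4⟩ := exists_tree_of_code hn hw hu hc'.1
  have hle := hc'.2 _ (prefixFree_path h2)
  have hsk' : t.sk ≤ t'.sk := by
    rcases hlow t' a1 a2 with h | ⟨_, h⟩
    · linarith
    · omega
  have heq : codeTree c' = t'.nodes := a4 (by
    rcases hlow t' a1 a2 with h | ⟨h, _⟩ <;> linarith)
  rw [heq, codeTree_path h1 h2, LTree.skeleton_nodes, LTree.skeleton_nodes, LTree.encard_nodes,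
    LTree.encard_nodes]
  have e1 := t.size_skel
  have e2 := t'.size_skel
  exact_mod_cast (by omega : t.skel.size ≤ t'.skel.size)

theorem outputs_path {s : State} (h1 : t.labels.Nodup) (h2 : t.labels.toFinset = Finset.range n)
    (h3 : t.ids.Nodup) (hroot0 : s.var 0 = t.root) (hroot1 : s.var 1 = t.root)
    (hskel : t.skel.Linked (s.arr 0) (s.arr 1)) (hlink : t.Linked (s.arr 2) (s.arr 3))
    (hlab : t.Labelled (s.arr 4)) : Outputs s fun i : Fin n => t.path i := by
  refine ⟨?_, ?_, fun i => ?_⟩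
  · rw [codeTree_path h1 h2, LTree.skeleton_nodes, hroot0, ← t.skel_root]
    exact hskel.storesTree (h3.sublist t.skel_ids_sublist)
  · rw [codeTree_path h1 h2, hroot1]
    exact hlink.storesTree h3
  · rw [hroot1]
    exact hlab.path hlink ((mem_labels_iff h2).2 i.2)

end Optimal

end SkeletonCode

namespace SkeletonCode

/-! ### Sorting, suffix sums and bit counts -/

@[simp] theorem setVar_var (s : State) (x v y : ℕ) :
    (s.setVar x v).var y = if y = x then v else s.var y := by
  simp [State.setVar, Function.update_apply]

@[simp] theorem setVar_arr (s : State) (x v : ℕ) : (s.setVar x v).arr = s.arr := rfl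

@[simp] theorem setVar_wt (s : State) (x v : ℕ) : (s.setVar x v).wt = s.wt := rfl

@[simp] theorem setArr_var (s : State) (a i v : ℕ) : (s.setArr a i v).var = s.var := rfl

@[simp] theorem setArr_arr (s : State) (a i v b : ℕ) : (s.setArr a i v).arr b =
    if b = a then Function.update (s.arr a) i v else s.arr b := by
  simp [State.setArr, Function.update_apply]

@[simp] theorem setArr_wt (s : State) (a i v : ℕ) : (s.setArr a i v).wt = s.wt := rfl

@[simp] theorem setWt_var (s : State) (a i : ℕ) (v : ℝ) : (s.setWt a i v).var = s.var := rfl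

@[simp] theorem setWt_arr (s : State) (a i : ℕ) (v : ℝ) : (s.setWt a i v).arr = s.arr := rfl

@[simp] theorem setWt_wt (s : State) (a i : ℕ) (v : ℝ) (b : ℕ) : (s.setWt a i v).wt b =
    if b = a then Function.update (s.wt a) i v else s.wt b := by
  simp [State.setWt, Function.update_apply]

/-- Disjunction of tests. -/
def Test.or (b d : Test) : Test := .neg (.both (.neg b) (.neg d))

@[simp] theorem Test.holds_or (B : ℕ) (s : State) (b d : Test) :
    (b.or d).holds B s ↔ b.holds B s ∨ d.holds B s := by
  simp only [Test.or, Test.holds]; tauto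

/-- The rank of the symbol in the variable `2` among the first symbols, up to the one in the
variable `3`, is computed in the variable `4`. -/
def rankStep : Prog :=
  .branch (.or (.wlt (.get 0 (.var 2)) (.get 0 (.var 3)))
      (.both (.neg (.wlt (.get 0 (.var 3)) (.get 0 (.var 2)))) (.lt (.var 3) (.var 2))))
    (.assign 4 (.add (.var 4) (.const 1))) .nop

/-- Sort the weights: array `5` is the sorting permutation, weight array `1` is sorted. -/
def sortProg : Prog :=
  .seq (.assign 2 (.const 0)) (.forTo 2 0
    (.seq (.seq (.assign 4 (.const 0)) (.assign 3 (.const 0)))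
      (.seq (.forTo 3 0 rankStep)
        (.seq (.store 5 (.var 4) (.var 2)) (.wstore 1 (.var 4) (.get 0 (.var 2)))))))

/-- Each symbol is written at its rank, obtained by counting. Ranks are distinct, so earlier entries
are not overwritten. -/
theorem sortProg_run {B n : ℕ} {s : State} (hn : s.var 0 = n) (hB : n + 1 < B) :
    Run B sortProg s (100 * (n + 1) ^ 2) fun s' => ∀ i < n,
      s'.arr 5 (rankUpTo (s.wt 0) n i) = i ∧ s'.wt 1 (rankUpTo (s.wt 0) n i) = s.wt 0 i := by
  set u := s.wt 0 with hu
  refine Run.seq (T₁ := 2) (T₂ := n * ((n * 33 + 24) + 7) + 3) (P := fun s' => s'.var 2 = 0)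
    (Run.flat rfl (by decide) ?_) (fun s1 h1 f1 => ?_) (by nlinarith)
  · simp [Prog.run, Expr.eval]
  refine Run.forTo (fun i s' => ∀ i' < i, s'.arr 5 (rankUpTo u n i') = i' ∧
    s'.wt 1 (rankUpTo u n i') = u i') rfl rfl h1 ((f1.var 0 rfl).trans hn) (Nat.zero_le _)
    (by omega) (by simp) ?_ (fun s' _ _ h => h) le_rfl
  intro i s2 _ hin hi2 f2 hI
  have hu2 : s2.wt 0 = u := (f2.wt 0 rfl).trans (f1.wt 0 rfl)
  have hn2 : s2.var 0 = n := ((f2.var 0 rfl).trans (f1.var 0 rfl)).trans hn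
  refine Run.seq (T₁ := 4) (T₂ := n * 33 + 20) (P := fun s' => s'.var 3 = 0 ∧ s'.var 4 = 0)
    (Run.flat rfl (by decide) ?_) (fun s3 h3 f3 => ?_) (by omega)
  · simp [Prog.run, Expr.eval]
  have hu3 : s3.wt 0 = u := (f3.wt 0 rfl).trans hu2
  have hi3 : s3.var 2 = i := (f3.var 2 rfl).trans hi2
  refine Run.seq (T₁ := n * (26 + 7) + 3) (T₂ := 10) (P := fun s' => s'.var 4 = rankUpTo u n i)
    (Run.forTo (fun m s' => s'.var 4 = rankUpTo u m i) rfl rfl h3.1 ((f3.var 0 rfl).trans hn2)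
      (Nat.zero_le _) (by omega) (by simp [h3.2, rankUpTo]) ?_ (fun s' _ _ h => h) le_rfl)
    (fun s4 h4 f4 => ?_) (by omega)
  · intro m s4 _ hm hm4 f4 h4
    refine Run.flat rfl (by decide) ?_
    have hu4 : s4.wt 0 = u := (f4.wt 0 rfl).trans hu3
    have hi4 : s4.var 2 = i := (f4.var 2 rfl).trans hi3
    have hle := rankUpTo_le (u := u) m i
    have hcond : Before u m i ↔ (Test.or (.wlt (.get 0 (.var 2)) (.get 0 (.var 3)))
      (.both (.neg (.wlt (.get 0 (.var 3)) (.get 0 (.var 2)))) (.lt (.var 3) (.var 2)))).holds B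
        s4 := by
      simp [Before, Test.holds, WExpr.eval, Expr.eval, hu4, hi4, hm4]
    classical
    rw [rankUpTo_succ, hcond]
    simp only [rankStep, Prog.run]
    split_ifs with hc
    · simp [Expr.eval, h4, Nat.mod_eq_of_lt (show 1 < B by omega),
        Nat.mod_eq_of_lt (show rankUpTo u m i + 1 < B by omega)]
    · simpa using h4
  · have hu4 : s4.wt 0 = u := (f4.wt 0 rfl).trans hu3
    have hi4 : s4.var 2 = i := (f4.var 2 rfl).trans hi3
    have ha4 : s4.arr 5 = s2.arr 5 := (f4.arr 5 rfl).trans (f3.arr 5 rfl)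
    have hw4 : s4.wt 1 = s2.wt 1 := (f4.wt 1 rfl).trans (f3.wt 1 rfl)
    refine Run.flat rfl (by decide) ?_
    intro i' hi'
    simp only [Prog.run, Expr.eval, WExpr.eval, h4, hi4, hu4, setVar_arr, setVar_wt, setWt_arr,
      setArr_arr, setWt_wt, setArr_wt, setArr_var, if_true, ha4, hw4, Function.update_apply]
    rcases Nat.lt_succ_iff_lt_or_eq.1 hi' with hlt | rfl
    · have hne : rankUpTo u n i' ≠ rankUpTo u n i := fun h =>
        hlt.ne (rank_injOn (by simp; omega) (by simpa using hin) h)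
      simpa [hne] using hI i' hlt
    · simp

/-- The weight array `2` receives the suffix sums of the weight array `1`. -/
def suffixProg : Prog :=
  .seq (.assign 2 (.const 0)) (.forTo 2 0
    (.seq (.assign 3 (.sub (.var 0) (.var 2)))
      (.wstore 2 (.sub (.var 3) (.const 1))
        (.add (.get 2 (.var 3)) (.get 1 (.sub (.var 3) (.const 1)))))))

/-- Weight expressions have no constants, so the empty sum must come from a cell that is still zero
(`h0`). -/
theorem suffixProg_run {B n : ℕ} {s : State} (hn : s.var 0 = n) (hB : n + 1 < B)
    (h0 : s.wt 2 n = 0) : Run B suffixProg s (100 * (n + 1) ^ 2) fun s' => ∀ m ≤ n,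
      s'.wt 2 m = ∑ x ∈ Finset.Ico m n, s.wt 1 x := by
  refine Run.seq (T₁ := 2) (T₂ := n * (20 + 7) + 3) (P := fun s' => s'.var 2 = 0)
    (Run.flat rfl (by decide) ?_) (fun s1 h1 f1 => ?_) (by nlinarith)
  · simp [Prog.run, Expr.eval]
  refine Run.forTo (fun i s' => ∀ m ≤ n, n ≤ m + i →
    s'.wt 2 m = ∑ x ∈ Finset.Ico m n, s.wt 1 x) rfl rfl h1 ((f1.var 0 rfl).trans hn) (Nat.zero_le _)
    (by omega) ?_ ?_ (fun s' _ _ h m hm => h m hm (by omega)) le_rfl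
  · intro m h1 h2
    obtain rfl : m = n := by omega
    rw [f1.wt 2 rfl, h0]; simp
  intro i s2 _ hin hi2 f2 hI
  have hu2 : s2.wt 1 = s.wt 1 := (f2.wt 1 rfl).trans (f1.wt 1 rfl)
  have hn2 : s2.var 0 = n := ((f2.var 0 rfl).trans (f1.var 0 rfl)).trans hn
  refine Run.flat rfl (by decide) ?_
  intro m hm hmi
  simp only [Prog.run, Expr.eval, WExpr.eval, hi2, hu2, hn2, setVar_var, setVar_wt,
    setWt_wt, if_true,
    Function.update_apply, Nat.mod_eq_of_lt (show 1 < B by omega)]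
  split_ifs with h
  · rw [hI (n - i) (by omega) (by omega), h]
    have e : n - i = n - i - 1 + 1 := by omega
    rw [Finset.sum_eq_sum_Ico_succ_bot (show n - i - 1 < n by omega), ← e, add_comm]
  · exact hI m hm (by omega)

/-- The array `6` receives the bit counts of the numbers up to `n`. -/
def bitCountProg : Prog :=
  .seq (.assign 2 (.const 1)) (.seq (.assign 3 (.add (.var 0) (.const 1))) (.forTo 2 3
    (.store 6 (.var 2) (.add (.get 6 (.div (.var 2) (.const 2)))
      (.sub (.var 2) (.mul (.div (.var 2) (.const 2)) (.const 2)))))))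

theorem bitCount_le (m : ℕ) : bitCount m ≤ m := by
  induction m using Nat.strong_induction_on with
  | _ m ih =>
    rcases Nat.eq_zero_or_pos m with rfl | h
    · simp [bitCount]
    · have := ih (m / 2) (by omega)
      rw [bitCount_eq]; omega

theorem bitCountProg_run {B n : ℕ} {s : State} (hn : s.var 0 = n) (hB : n + 2 < B)
    (h0 : s.arr 6 0 = 0) : Run B bitCountProg s (100 * (n + 1) ^ 2) fun s' => ∀ m ≤ n,
      s'.arr 6 m = bitCount m := by
  refine Run.seq (T₁ := 2) (T₂ := 4 + (n * (20 + 7) + 3)) (P := fun s' => s'.var 2 = 1)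
    (Run.flat rfl (by decide) ?_) (fun s1 h1 f1 => ?_) (by nlinarith)
  · simp [Prog.run, Expr.eval, Nat.mod_eq_of_lt (show 1 < B by omega)]
  have hn1 : s1.var 0 = n := (f1.var 0 rfl).trans hn
  refine Run.seq (T₁ := 4) (T₂ := (n * (20 + 7) + 3)) (P := fun s' => s'.var 3 = n + 1)
    (Run.flat rfl (by decide) ?_) (fun s2 h2 f2 => ?_) le_rfl
  · simp [Prog.run, Expr.eval, hn1, Nat.mod_eq_of_lt (show 1 < B by omega),
      Nat.mod_eq_of_lt (show n + 1 < B by omega)]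
  refine Run.forTo (Tp := 20) (fun i s' => ∀ m < i, s'.arr 6 m = bitCount m) rfl rfl
    ((f2.var 2 rfl).trans h1) h2 (by omega) (by omega) ?_ ?_
    (fun s' _ _ h m hm => h m (by omega)) (by simp)
  · intro m hm
    obtain rfl : m = 0 := by omega
    rw [f2.arr 6 rfl, f1.arr 6 rfl, h0, bitCount]
  intro i s3 h1i hin hi3 f3 hI
  refine Run.flat rfl (by decide) ?_
  intro m hm
  have hle := bitCount_le (i / 2)
  have h5 : i / 2 * 2 ≤ i := Nat.div_mul_le_self i 2
  have h6 : i - i / 2 * 2 = i % 2 := by omega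
  simp only [Prog.run, Expr.eval, hi3, setVar_arr, setArr_arr, if_true,
    Function.update_apply, Nat.mod_eq_of_lt (show 2 < B by omega),
    Nat.mod_eq_of_lt (show i / 2 * 2 < B by omega), hI (i / 2) (by omega), h6,
    Nat.mod_eq_of_lt (show bitCount (i / 2) + i % 2 < B by omega)]
  split_ifs with h
  · rw [h, ← bitCount_eq]
  · exact hI m (by omega)

end SkeletonCode

namespace SkeletonCode

/-! ### The dynamic programming tables -/

/-- Try the number of inner nodes in the variable `5`. -/
def dpStep : Prog :=
  .seq (.assign 9 (.add (.mul (.add (.var 3) (.var 5)) (.add (.var 0) (.const 1)))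
    (.mul (.const 2) (.var 5))))
  (.seq (.assign 10 (.add (.get 6 (.sub (.var 4) (.var 5))) (.get 7 (.var 9))))
  (.branch (.or (.eq (.var 5) (.const 1))
      (.or (.wlt (.add (.get 2 (.sub (.var 3) (.var 5))) (.get 3 (.var 9))) (.get 3 (.var 8)))
        (.both (.neg (.wlt (.get 3 (.var 8))
            (.add (.get 2 (.sub (.var 3) (.var 5))) (.get 3 (.var 9)))))
          (.lt (.var 10) (.get 7 (.var 8))))))
    (.seq (.wstore 3 (.var 8) (.add (.get 2 (.sub (.var 3) (.var 5))) (.get 3 (.var 9))))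
      (.seq (.store 7 (.var 8) (.var 10)) (.store 8 (.var 8) (.var 5))))
    .nop))

/-- Prepare the computation of the entry for the variables `3` and `4`. -/
def dpCellInit : Prog :=
  .seq (.assign 8 (.add (.mul (.var 3) (.add (.var 0) (.const 1))) (.var 4)))
  (.seq (.wstore 3 (.var 8) (.get 2 (.var 0)))
  (.seq (.store 7 (.var 8) (.get 6 (.var 4)))
  (.seq (.assign 5 (.const 1))
  (.branch (.lt (.var 4) (.sub (.var 0) (.var 3)))
    (.assign 7 (.add (.var 4) (.const 1)))
    (.assign 7 (.add (.sub (.var 0) (.var 3)) (.const 1)))))))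

/-- Compute the entry of the tables for the variables `3` and `4`. -/
def dpCell : Prog := .seq dpCellInit (.forTo 5 7 dpStep)

/-- Compute the tables of the optimal costs (weight array `3`), bit counts (array `7`) and numbers
of inner nodes (array `8`). -/
def dpProg : Prog :=
  .seq (.assign 2 (.const 0)) (.forTo 2 0
    (.seq (.seq (.assign 3 (.sub (.var 0) (.var 2)))
        (.seq (.assign 6 (.add (.var 3) (.const 1))) (.assign 4 (.const 1))))
      (.forTo 4 6 dpCell)))

/-- Two-dimensional indexing with row length `n + 1`. -/
def idx (n a b : ℕ) : ℕ := a * (n + 1) + b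

theorem idx_inj {n a b a' b' : ℕ} (hb : b ≤ n) (hb' : b' ≤ n) (h : idx n a b = idx n a' b') :
    a = a' ∧ b = b' := by
  simp only [idx] at h
  have h1 : (a * (n + 1) + b) / (n + 1) = a := by
    rw [mul_comm, Nat.mul_add_div (by omega), Nat.div_eq_of_lt (by omega), add_zero]
  have h2 : (a' * (n + 1) + b') / (n + 1) = a' := by
    rw [mul_comm, Nat.mul_add_div (by omega), Nat.div_eq_of_lt (by omega), add_zero]
  rw [h, h2] at h1
  subst h1
  exact ⟨rfl, by omega⟩

theorem idx_le {n a : ℕ} (b : ℕ) (ha : a ≤ n) : idx n a b ≤ n * (n + 1) + b :=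
  Nat.add_le_add_right (Nat.mul_le_mul_right _ ha) b

/-- The entry of the tables for `a` and `b` is correct. -/
def GoodCell (n : ℕ) (W : ℕ → ℝ) (s : State) (a b : ℕ) : Prop :=
  Bellman n W (fun a b => s.wt 3 (idx n a b)) (fun a b => s.arr 7 (idx n a b))
    (fun a b => s.arr 8 (idx n a b)) a b ∧ s.arr 7 (idx n a b) + a ≤ n + b

/-- Correctness of a cell involves only that cell and rows with larger index, so writing elsewhere
does no harm. -/
theorem GoodCell.congr {n : ℕ} {W : ℕ → ℝ} {s s' : State} {a b : ℕ} (h : GoodCell n W s a b)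
    (hba : b ≤ a) (ha : a ≤ n)
    (hs : ∀ a' b', b' ≤ n → a < a' ∨ a' = a ∧ b' = b →
      s'.wt 3 (idx n a' b') = s.wt 3 (idx n a' b') ∧
      s'.arr 7 (idx n a' b') = s.arr 7 (idx n a' b') ∧
      s'.arr 8 (idx n a' b') = s.arr 8 (idx n a' b')) : GoodCell n W s' a b := by
  obtain ⟨⟨h1, h2⟩, h3⟩ := h
  obtain ⟨e1, e2, e3⟩ := hs a b (by omega) (.inr ⟨rfl, rfl⟩)
  refine ⟨⟨fun han => ?_, fun han => ?_⟩, by rwa [e2]⟩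
  · simp only [e1, e2]; exact h1 han
  · simp only [e1, e2, e3]
    obtain ⟨i1, i2, i3, i4, i5, i6⟩ := h2 han
    simp only at i1 i2 i3 i4 i5 i6
    refine ⟨i1, i2, i3, ?_, ?_, fun q hq1 hq2 hq3 => ?_⟩
    · rw [(hs _ _ (by omega) (.inl (by omega))).1]; exact i4
    · rw [(hs _ _ (by omega) (.inl (by omega))).2.1]; exact i5
    · rw [(hs (a + q) (2 * q) (by omega) (.inl (by omega))).1,
        (hs (a + q) (2 * q) (by omega) (.inl (by omega))).2.1]
      exact i6 q hq1 hq2 hq3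

/-- A running lexicographic minimum over `q ≤ min b (n - a)`. The second half of `GoodCell` bounds
the bit counts by `n - a + b`, which keeps their additions below the modulus. -/
theorem dpCell_run {B n a b : ℕ} {s : State} (hB : n * (n + 1) + 4 * n + 10 < B)
    (hn : s.var 0 = n) (ha : s.var 3 = a) (hb : s.var 4 = b) (hb1 : 1 ≤ b) (hba : b ≤ a)
    (han : a ≤ n) (hW : s.wt 2 n = 0) (hpc : ∀ m ≤ n, s.arr 6 m = bitCount m)
    (hgood : ∀ a' b', a < a' → a' ≤ n → 1 ≤ b' → b' ≤ a' → GoodCell n (s.wt 2) s a' b') :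
    Run B dpCell s (300 * (n + 1)) fun s' => GoodCell n (s.wt 2) s' a b ∧
      ∀ x, x ≠ idx n a b →
        s'.wt 3 x = s.wt 3 x ∧ s'.arr 7 x = s.arr 7 x ∧ s'.arr 8 x = s.arr 8 x := by
  set W := s.wt 2 with hWdef
  set I := idx n a b with hIdef
  have hIle : I ≤ n * (n + 1) + b := idx_le b han
  have hale : a * (n + 1) ≤ n * (n + 1) := Nat.mul_le_mul_right _ han
  have hc1 : 1 % B = 1 := Nat.mod_eq_of_lt (by omega)
  have hc2 : 2 % B = 2 := Nat.mod_eq_of_lt (by omega)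
  have hn1 : (n + 1) % B = n + 1 := Nat.mod_eq_of_lt (by omega)
  refine Run.seq (T₁ := 60) (T₂ := n * (150 + 7) + 3)
    (P := fun s' => s'.var 8 = I ∧ s'.var 5 = 1 ∧ s'.var 7 = min b (n - a) + 1 ∧
      s'.wt 3 I = 0 ∧ s'.arr 7 I = bitCount b ∧ ∀ x, x ≠ I →
        s'.wt 3 x = s.wt 3 x ∧ s'.arr 7 x = s.arr 7 x)
    (Run.flat rfl (by decide) ?_) (fun s1 h1 f1 => ?_) (by omega)
  · have e1 : (a * (n + 1)) % B = a * (n + 1) := Nat.mod_eq_of_lt (by omega)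
    have e2 : (a * (n + 1) + b) % B = I := Nat.mod_eq_of_lt (by rw [idx] at hIdef; omega)
    have e3 : (b + 1) % B = b + 1 := Nat.mod_eq_of_lt (by omega)
    have e4 : (n - a + 1) % B = n - a + 1 := Nat.mod_eq_of_lt (by omega)
    simp only [dpCellInit, Prog.run, Expr.eval, WExpr.eval, Test.holds, setVar_var, setVar_arr,
      setVar_wt, setArr_var, setWt_arr, setWt_var, hn, ha, hb, hc1, hn1, e1, e2, if_true,
      OfNat.zero_ne_ofNat, Nat.reduceEqDiff, if_false, e3, e4]
    split_ifs with hlt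
    · simp only [setVar_var, setVar_arr, setVar_wt, setArr_arr, setArr_var, setArr_wt, setWt_arr,
        setWt_var, setWt_wt, Nat.reduceEqDiff, if_true, if_false, Function.update_self]
      refine ⟨trivial, trivial, by omega, hW, hpc b (by omega), fun x hx => ?_⟩
      simp [Function.update_of_ne hx]
    · simp only [setVar_var, setVar_arr, setVar_wt, setArr_arr, setArr_var, setArr_wt, setWt_arr,
        setWt_var, setWt_wt, Nat.reduceEqDiff, if_true, if_false, Function.update_self]
      refine ⟨trivial, trivial, by omega, hW, hpc b (by omega), fun x hx => ?_⟩
      simp [Function.update_of_ne hx]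
  obtain ⟨hI1, h51, h71, hF1, hP1, hx1⟩ := h1
  have hn1' : s1.var 0 = n := (f1.var 0 rfl).trans hn
  have ha1 : s1.var 3 = a := (f1.var 3 rfl).trans ha
  have hb1' : s1.var 4 = b := (f1.var 4 rfl).trans hb
  have hW1 : s1.wt 2 = W := f1.wt 2 rfl
  have hpc1 : s1.arr 6 = s.arr 6 := f1.arr 6 rfl
  have hQ1 : s1.arr 8 = s.arr 8 := f1.arr 8 rfl
  have hIne : ∀ q, 1 ≤ q → q ≤ b → a + q ≤ n → idx n (a + q) (2 * q) ≠ I := by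
    intro q hq hqb hqn h
    have := (idx_inj (by omega) (by omega) h).1
    omega
  set cF : ℕ → ℝ := fun q => W (a - q) + s.wt 3 (idx n (a + q) (2 * q)) with hcF
  set cP : ℕ → ℕ := fun q => bitCount (b - q) + s.arr 7 (idx n (a + q) (2 * q)) with hcP
  have hcPle : ∀ q, 1 ≤ q → q ≤ b → a + q ≤ n → cP q + a ≤ n + b := by
    intro q hq hqb hqn
    have h1 := (hgood (a + q) (2 * q) (by omega) hqn (by omega) (by omega)).2
    have h2 := bitCount_le (b - q)
    simp only [hcP]
    omega
  -- The cell starts with the values for `a = n`, where the loop is empty. Otherwise the candidate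
  -- `q = 1` is accepted unconditionally, since those initial values are not a candidate.
  refine Run.forTo (fun q s' =>
      (∀ x, x ≠ I → s'.wt 3 x = s.wt 3 x ∧ s'.arr 7 x = s.arr 7 x ∧ s'.arr 8 x = s.arr 8 x) ∧
      (q = 1 → s'.wt 3 I = 0 ∧ s'.arr 7 I = bitCount b) ∧
      (1 < q → 1 ≤ s'.arr 8 I ∧ s'.arr 8 I < q ∧ s'.wt 3 I = cF (s'.arr 8 I) ∧
        s'.arr 7 I = cP (s'.arr 8 I) ∧ ∀ q', 1 ≤ q' → q' < q →
          LexLE (s'.wt 3 I) (s'.arr 7 I) (cF q') (cP q')))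
    rfl rfl h51 h71 (by omega) (by omega) ?_ ?_ ?_
    (Nat.add_le_add_right (Nat.mul_le_mul_right _ (by omega)) _)
  · exact ⟨fun x hx => ⟨(hx1 x hx).1, (hx1 x hx).2, by rw [hQ1]⟩, fun _ => ⟨hF1, hP1⟩,
      fun h => absurd h (lt_irrefl _)⟩
  · intro q s2 hq1 hqN hq2 f2 ⟨hx2, hone, hbest⟩
    have hqb : q ≤ b := by omega
    have hqn : a + q ≤ n := by omega
    have hn2 : s2.var 0 = n := (f2.var 0 rfl).trans hn1'
    have ha2 : s2.var 3 = a := (f2.var 3 rfl).trans ha1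
    have hb2 : s2.var 4 = b := (f2.var 4 rfl).trans hb1'
    have hI2 : s2.var 8 = I := (f2.var 8 rfl).trans hI1
    have hW2 : s2.wt 2 = W := (f2.wt 2 rfl).trans hW1
    have hpc2 : s2.arr 6 = s.arr 6 := (f2.arr 6 rfl).trans hpc1
    have hJle := idx_le (2 * q) hqn
    have hmul : (a + q) * (n + 1) ≤ n * (n + 1) := Nat.mul_le_mul_right _ hqn
    have e1 : (a + q) % B = a + q := Nat.mod_eq_of_lt (by omega)
    have e2 : ((a + q) * (n + 1)) % B = (a + q) * (n + 1) := Nat.mod_eq_of_lt (by omega)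
    have e3 : (2 * q) % B = 2 * q := Nat.mod_eq_of_lt (by omega)
    have e4 : ((a + q) * (n + 1) + 2 * q) % B = idx n (a + q) (2 * q) :=
      Nat.mod_eq_of_lt (by omega)
    obtain ⟨j1, j2, _⟩ := hx2 _ (hIne q hq1 hqb hqn)
    have e5 : (s.arr 6 (b - q) + s.arr 7 (idx n (a + q) (2 * q))) % B = cP q := by
      have := hcPle q hq1 hqb hqn
      rw [hpc _ (by omega)]
      exact Nat.mod_eq_of_lt (by simp only [hcP] at this; omega)
    refine Run.flat rfl (by decide) ?_
    simp only [dpStep, Prog.run, Expr.eval, WExpr.eval, Test.holds, Test.holds_or, setVar_var,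
      setVar_arr, setVar_wt, setArr_var, setWt_var, hn2, ha2, hb2, hq2, hI2, hW2, hpc2, hc1, hc2,
      hn1, e1, e2, e3, e4, if_true, Nat.reduceEqDiff, if_false, j1, j2, e5]
    have hcFq : W (a - q) + s.wt 3 (idx n (a + q) (2 * q)) = cF q := rfl
    simp only [hcFq]
    split_ifs with hcond
    · simp only [setVar_arr, setVar_wt, setArr_arr, setArr_wt, setWt_arr, setWt_wt,
        Nat.reduceEqDiff, if_true, if_false, Function.update_self]
      refine ⟨fun x hx => ?_, fun h => by omega, fun _ => ⟨hq1, by omega, trivial, trivial,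
        fun q' hq' hqq' => ?_⟩⟩
      · simpa [Function.update_of_ne hx] using hx2 x hx
      · rcases Nat.lt_succ_iff_lt_or_eq.1 hqq' with hlt | rfl
        · obtain ⟨_, _, _, _, hb5⟩ := hbest (by omega)
          refine LexLE.trans ?_ (hb5 q' hq' hlt)
          rcases hcond with h | h | ⟨h, h'⟩
          · omega
          · exact .inl h
          · rcases (not_lt.1 h).lt_or_eq with h | h
            · exact .inl h
            · exact .inr ⟨h, h'.le⟩
        · exact LexLE.refl _ _
    · simp only [setVar_arr, setVar_wt]
      have hq1' : q ≠ 1 := fun h => hcond (.inl h)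
      obtain ⟨hb1, hb2, hb3, hb4, hb5⟩ := hbest (by omega)
      refine ⟨hx2, fun h => by omega, fun _ => ⟨hb1, by omega, hb3, hb4, fun q' hq' hqq' => ?_⟩⟩
      rcases Nat.lt_succ_iff_lt_or_eq.1 hqq' with hlt | rfl
      · exact hb5 q' hq' hlt
      · simp only [not_or, not_and] at hcond
        obtain ⟨_, hc1, hc2⟩ := hcond
        rcases (not_lt.1 hc1).lt_or_eq with h | h
        · exact .inl h
        · exact .inr ⟨h, not_lt.1 (hc2 (by rw [h]; exact lt_irrefl _))⟩
  · intro s2 _ f2 ⟨hx2, hone, hbest⟩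
    refine ⟨⟨⟨fun h => ?_, fun h => ?_⟩, ?_⟩, hx2⟩
    · subst h
      exact hone (by omega)
    · obtain ⟨hb1, hb2, hb3, hb4, hb5⟩ := hbest (by omega)
      have hq : ∀ q, 1 ≤ q → q ≤ b → a + q ≤ n →
          cF q = W (a - q) + s2.wt 3 (idx n (a + q) (2 * q)) ∧
          cP q = bitCount (b - q) + s2.arr 7 (idx n (a + q) (2 * q)) := by
        intro q h1 h2 h3
        obtain ⟨k1, k2, _⟩ := hx2 _ (hIne q h1 h2 h3)
        rw [k1, k2]
        exact ⟨rfl, rfl⟩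
      refine ⟨hb1, show s2.arr 8 I ≤ b by omega, show a + s2.arr 8 I ≤ n by omega, ?_, ?_,
        fun q h1 h2 h3 => ?_⟩
      · exact hb3.trans (hq _ hb1 (by omega) (by omega)).1
      · exact hb4.trans (hq _ hb1 (by omega) (by omega)).2
      · have := hb5 q h1 (by omega)
        rwa [(hq q h1 h2 h3).1, (hq q h1 h2 h3).2] at this
    · rcases han.lt_or_eq with h | h
      · obtain ⟨hb1, hb2, hb3, hb4, hb5⟩ := hbest (by omega)
        rw [hb4]
        exact hcPle _ hb1 (by omega) (by omega)
      · have h1 := (hone (by omega)).2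
        have h2 := bitCount_le b
        rw [h1]; omega

/-- Cells refer only to later rows, so rows are filled from `n` downwards. -/
theorem dpProg_run {B n : ℕ} {s : State} (hB : n * (n + 1) + 4 * n + 10 < B)
    (hn : s.var 0 = n) (hW : s.wt 2 n = 0) (hpc : ∀ m ≤ n, s.arr 6 m = bitCount m) :
    Run B dpProg s (400 * (n + 1) ^ 3) fun s' => ∀ a b, 1 ≤ b → b ≤ a → a ≤ n →
      Bellman n (s.wt 2) (fun a b => s'.wt 3 (idx n a b)) (fun a b => s'.arr 7 (idx n a b))
        (fun a b => s'.arr 8 (idx n a b)) a b := by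
  set W := s.wt 2 with hWdef
  have hc1 : 1 % B = 1 := Nat.mod_eq_of_lt (by omega)
  refine Run.seq (T₁ := 2) (T₂ := n * ((20 + (n * (300 * (n + 1) + 7) + 3)) + 7) + 3)
    (P := fun s' => s'.var 2 = 0)
    (Run.flat rfl (by decide) ?_) (fun s1 h1 f1 => ?_) (by ring_nf; nlinarith [sq_nonneg n])
  · simp [Prog.run, Expr.eval]
  refine Run.forTo (fun i s' => ∀ a b, n < a + i → a ≤ n → 1 ≤ b → b ≤ a → GoodCell n W s' a b)
    rfl rfl h1 ((f1.var 0 rfl).trans hn) (Nat.zero_le _) (by omega)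
    (fun a b h h' => by omega) ?_ (fun s' _ _ h a b h1 h2 h3 => (h a b (by omega) h3 h1 h2).1)
    le_rfl
  intro i s2 _ hin hi2 f2 hI
  have hn2 : s2.var 0 = n := ((f2.var 0 rfl).trans (f1.var 0 rfl)).trans hn
  have hW2 : s2.wt 2 = W := (f2.wt 2 rfl).trans (f1.wt 2 rfl)
  have hpc2 : s2.arr 6 = s.arr 6 := (f2.arr 6 rfl).trans (f1.arr 6 rfl)
  have e1 : (n - i + 1) % B = n - i + 1 := Nat.mod_eq_of_lt (by omega)
  refine Run.seq (T₁ := 20) (T₂ := n * (300 * (n + 1) + 7) + 3)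
    (P := fun s' => s'.var 3 = n - i ∧ s'.var 6 = n - i + 1 ∧ s'.var 4 = 1 ∧ s'.arr = s2.arr ∧
      s'.wt = s2.wt)
    (Run.flat rfl (by decide) ?_) (fun s3 ⟨h33, h36, h34, ha3, hw3⟩ f3 => ?_) le_rfl
  · simp [Prog.run, Expr.eval, hn2, hi2, e1, hc1]
  have hn3 : s3.var 0 = n := (f3.var 0 rfl).trans hn2
  have hgood3 : ∀ a b, n < a + i → a ≤ n → 1 ≤ b → b ≤ a → GoodCell n W s3 a b := by
    intro a b h1 h2 h3 h4
    exact (hI a b h1 h2 h3 h4).congr h4 h2 fun _ _ _ _ => by rw [ha3, hw3]; simp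
  refine Run.forTo (fun r s' => (∀ a b, n < a + i → a ≤ n → 1 ≤ b → b ≤ a → GoodCell n W s' a b) ∧
      ∀ b, 1 ≤ b → b < r → GoodCell n W s' (n - i) b) rfl rfl h34 h36 (by omega) (by omega)
    ⟨hgood3, fun b h1 h2 => by omega⟩ ?_ ?_
    (Nat.add_le_add_right (Nat.mul_le_mul_right _ (by omega)) _)
  · intro r s4 hr1 hr2 hr4 f4 ⟨hg4, hr⟩
    have hn4 : s4.var 0 = n := (f4.var 0 rfl).trans hn3
    have h43 : s4.var 3 = n - i := (f4.var 3 rfl).trans h33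
    have hW4 : s4.wt 2 = W := (f4.wt 2 rfl).trans ((congrFun hw3 2).trans hW2)
    have hpc4 : s4.arr 6 = s.arr 6 := (f4.arr 6 rfl).trans ((congrFun ha3 6).trans hpc2)
    refine (dpCell_run hB hn4 h43 hr4 hr1 (by omega) (by omega) (by rw [hW4, hW])
      (by rwa [hpc4]) (fun a' b' h1 h2 h3 h4 => by
        rw [hW4]; exact hg4 a' b' (by omega) h2 h3 h4)).mono le_rfl ?_
    rintro s5 ⟨hc5, hx5⟩ _
    rw [hW4] at hc5
    have hcongr : ∀ a b, 1 ≤ b → b ≤ a → a ≤ n → n - i ≤ a → (a = n - i → b ≠ r) →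
        GoodCell n W s4 a b → GoodCell n W s5 a b := by
      intro a b h1 h2 h3 h4 h5 h6
      refine h6.congr h2 h3 fun a' b' hb' h => hx5 _ fun he => ?_
      obtain ⟨rfl, rfl⟩ := idx_inj hb' (by omega) he
      rcases h with h | ⟨h, h'⟩
      · omega
      · exact h5 h.symm h'.symm
    refine ⟨fun a b h1 h2 h3 h4 => ?_, fun b h1 h2 => ?_⟩
    · exact hcongr a b h3 h4 h2 (by omega) (by omega) (hg4 a b h1 h2 h3 h4)
    · rcases Nat.lt_succ_iff_lt_or_eq.1 h2 with hlt | rfl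
      · exact hcongr _ b h1 (by omega) (by omega) le_rfl (fun _ => hlt.ne) (hr b h1 hlt)
      · exact hc5
  · intro s4 _ _ ⟨hg4, hr⟩ a b h1 h2 h3 h4
    by_cases h : n < a + i
    · exact hg4 a b h h2 h3 h4
    · obtain rfl : a = n - i := by omega
      exact hr b h3 (by omega)

end SkeletonCode

namespace SkeletonCode

/-! ### Reading off the optimal profile -/

/-- Follow the table `Q` for one level. -/
def levelStep : Prog :=
  .seq (.assign 4 (.get 8 (.add (.mul (.var 2) (.add (.var 0) (.const 1))) (.var 3))))
  (.seq (.store 9 (.var 11) (.sub (.var 3) (.var 4)))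
  (.seq (.store 10 (.var 11) (.sub (.var 2) (.var 3)))
  (.seq (.assign 11 (.add (.var 11) (.const 1)))
  (.seq (.assign 2 (.add (.var 2) (.var 4)))
    (.assign 3 (.mul (.const 2) (.var 4)))))))

/-- Read off the numbers of leaves on the levels (array `9`), the numbers of leaves above the levels
(array `10`) and the number of levels (variable `11`). -/
def levelProg : Prog :=
  .seq (.seq (.assign 2 (.const 1)) (.seq (.assign 3 (.const 1)) (.assign 11 (.const 0))))
  (.seq (.loop (.lt (.var 2) (.var 0)) levelStep)
    (.seq (.store 9 (.var 11) (.var 3))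
      (.seq (.store 10 (.var 11) (.sub (.var 2) (.var 3)))
        (.assign 11 (.add (.var 11) (.const 1))))))

/-- The profile `l` is stored in the memory. -/
def StoresProfile (s : State) (l : List ℕ) : Prop :=
  s.var 11 = l.length ∧ ∀ j < l.length, s.arr 9 j = l.getD j 0 ∧ s.arr 10 j = offset l j

theorem StoresProfile.snoc {s s' : State} {l : List ℕ} {k : ℕ} (h : StoresProfile s l)
    (h11 : s'.var 11 = l.length + 1) (h9 : s'.arr 9 = Function.update (s.arr 9) l.length k)
    (h10 : s'.arr 10 = Function.update (s.arr 10) l.length l.sum) :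
    StoresProfile s' (l ++ [k]) := by
  refine ⟨by simp [h11], fun j hj => ?_⟩
  rw [List.length_append, List.length_singleton] at hj
  rw [h9, h10, offset]
  rcases Nat.lt_succ_iff_lt_or_eq.1 hj with hlt | rfl
  · have := h.2 j hlt
    rw [offset] at this
    rw [Function.update_of_ne hlt.ne, Function.update_of_ne hlt.ne, this.1, this.2,
      List.take_append_of_le_length hlt.le, List.getD_append _ _ _ _ hlt]
    exact ⟨rfl, rfl⟩
  · simp

/-- The distance `m` from `a` to `n` drops by `Q a b ≥ 1` on every level. By `hsum` the number of
leaves above the current level is `a - b`, which is the offset that gets stored. -/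
theorem levelLoop_run {B n : ℕ} {Q : ℕ → ℕ → ℕ} (hB : n * (n + 1) + 4 * n + 10 < B)
    (hQ : ∀ a b, 1 ≤ b → b ≤ a → a < n → 1 ≤ Q a b ∧ Q a b ≤ b ∧ a + Q a b ≤ n) (m : ℕ)
    {a b : ℕ} {s : State} (l : List ℕ) (ham : a + m = n) (hb : 1 ≤ b) (hba : b ≤ a)
    (hn : s.var 0 = n) (h2 : s.var 2 = a) (h3 : s.var 3 = b)
    (h8 : ∀ a b, s.arr 8 (idx n a b) = Q a b) (hl : StoresProfile s l) (hlen : l.length < a)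
    (hsum : l.sum + b = a) :
    Run B (.loop (.lt (.var 2) (.var 0)) levelStep) s (m * 60 + 3) fun s' =>
      ∃ l' b', s'.var 2 = n ∧ s'.var 3 = b' ∧ StoresProfile s' (l ++ l') ∧
        (l ++ l').length < n ∧ (l ++ l').sum + b' = n ∧ Follows n Q a b (l' ++ [b']) := by
  induction m using Nat.strong_induction_on generalizing a b s l with
  | _ m ih =>
  rcases Nat.eq_zero_or_pos m with rfl | hm
  · obtain rfl : a = n := by omega
    refine Run.loop_done (by simp [Test.holds, Expr.eval, h2, hn])
      (by simp [Test.time, Expr.time]) ?_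
    exact ⟨[], b, h2, h3, by simpa using hl, by simpa using hlen, by simpa using hsum, .last b⟩
  · obtain ⟨q1, q2, q3⟩ := hQ a b hb hba (by omega)
    have hmul : a * (n + 1) ≤ n * (n + 1) := Nat.mul_le_mul_right _ (by omega)
    have hc1 : 1 % B = 1 := Nat.mod_eq_of_lt (by omega)
    have hc2 : 2 % B = 2 := Nat.mod_eq_of_lt (by omega)
    have e1 : (n + 1) % B = n + 1 := Nat.mod_eq_of_lt (by omega)
    have e2 : (a * (n + 1)) % B = a * (n + 1) := Nat.mod_eq_of_lt (by omega)
    have e3 : (a * (n + 1) + b) % B = idx n a b := Nat.mod_eq_of_lt (by omega)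
    have e4 : (l.length + 1) % B = l.length + 1 := Nat.mod_eq_of_lt (by omega)
    have e5 : (a + Q a b) % B = a + Q a b := Nat.mod_eq_of_lt (by omega)
    have e6 : (2 * Q a b) % B = 2 * Q a b := Nat.mod_eq_of_lt (by omega)
    have h11 := hl.1
    refine Run.loop_next (T₁ := 50) (T₂ := (m - Q a b) * 60 + 3)
      (P := fun s' => s'.var 2 = a + Q a b ∧ s'.var 3 = 2 * Q a b ∧
        StoresProfile s' (l ++ [b - Q a b]))
      (by simp [Test.holds, Expr.eval, h2, hn]; omega) (Run.flat rfl (by decide) ?_)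
      (fun s' ⟨i2, i3, il⟩ f => ?_) (by simp only [Test.time, Expr.time]; omega)
    · simp only [levelStep, Prog.run, Expr.eval, setVar_var, setArr_var, hn, h2, h3, hc1,
        hc2, e1, e2, e3, h8, Nat.reduceEqDiff, if_true, if_false, h11, e4, e5, e6]
      refine ⟨trivial, trivial, hl.snoc ?_ ?_ ?_⟩
      · simp
      · simp
      · have : a - b = l.sum := by omega
        simp [this]
    · refine (ih (m - Q a b) (by omega) (l ++ [b - Q a b]) (by omega) (by omega) (by omega)
        ((f.var 0 rfl).trans hn) i2 i3 (by rw [f.arr 8 rfl]; exact h8) il (by simp; omega)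
        (by simp; omega)).mono le_rfl ?_
      rintro s'' ⟨l', b', j1, j2, j3, j4, j5, j6⟩ _
      refine ⟨(b - Q a b) :: l', b', j1, j2, ?_, ?_, ?_, .step (by omega) j6⟩
      · simpa using j3
      · simpa using j4
      · simpa using j5

theorem levelProg_run {B n : ℕ} {s : State} {Q : ℕ → ℕ → ℕ} (hB : n * (n + 1) + 4 * n + 10 < B)
    (hn0 : 0 < n) (hn : s.var 0 = n)
    (hQ : ∀ a b, 1 ≤ b → b ≤ a → a < n → 1 ≤ Q a b ∧ Q a b ≤ b ∧ a + Q a b ≤ n)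
    (h8 : ∀ a b, s.arr 8 (idx n a b) = Q a b) :
    Run B levelProg s (100 * (n + 1)) fun s' => ∃ ks, Follows n Q 1 1 ks ∧ StoresProfile s' ks := by
  have hc1 : 1 % B = 1 := Nat.mod_eq_of_lt (by omega)
  refine Run.seq (T₁ := 10) (T₂ := (n - 1) * 60 + 33)
    (P := fun s' => s'.var 2 = 1 ∧ s'.var 3 = 1 ∧ s'.var 11 = 0)
    (Run.flat rfl (by decide) ?_) (fun s1 ⟨h12, h13, h11⟩ f1 => ?_) (by omega)
  · simp [Prog.run, Expr.eval, hc1]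
  refine Run.seq (T₂ := 30) (levelLoop_run hB hQ (n - 1) [] (by omega) le_rfl le_rfl
    ((f1.var 0 rfl).trans hn) h12 h13 (by rw [f1.arr 8 rfl]; exact h8) ⟨h11, by simp⟩ (by simp)
    (by simp)) (fun s2 ⟨l', b', j1, j2, j3, j4, j5, j6⟩ f2 => ?_) le_rfl
  rw [List.nil_append] at j3 j4 j5
  refine Run.flat rfl (by decide) ⟨_, j6, j3.snoc ?_ ?_ ?_⟩
  · simp [Prog.run, Expr.eval, j3.1, hc1, Nat.mod_eq_of_lt (show l'.length + 1 < B by omega)]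
  · simp [Prog.run, Expr.eval, j3.1, j2]
  · have : n - b' = l'.sum := by omega
    simp [Prog.run, Expr.eval, j3.1, j1, j2, this]

end SkeletonCode

namespace SkeletonCode

/-! ### Ordering the leaves -/

/-- Append the leaf in the variables `3` (depth) and `4` (number in the sorted order). -/
def emitStep : Prog :=
  .seq (.store 11 (.var 7) (.var 3)) (.seq (.store 12 (.var 7) (.get 5 (.var 4)))
    (.assign 7 (.add (.var 7) (.const 1))))

/-- Append the leaves of a perfect subtree. -/
def pieceProg : Prog :=
  .seq (.seq (.assign 4 (.add (.get 10 (.var 3)) (.mul (.div (.get 9 (.var 3))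
        (.mul (.const 2) (.var 5))) (.mul (.const 2) (.var 5)))))
      (.assign 6 (.add (.get 10 (.var 3)) (.mul (.div (.get 9 (.var 3)) (.var 5)) (.var 5)))))
    (.forTo 4 6 emitStep)

/-- Compute the list of the leaves: depths in the array `11` and symbols in the array `12`. -/
def orderProg : Prog :=
  .seq (.seq (.assign 2 (.const 0)) (.assign 7 (.const 0))) (.forTo 2 11
    (.seq (.seq (.assign 3 (.var 2)) (.assign 5 (.const 1))) (.forTo 3 11
      (.seq pieceProg
        (.branch (.lt (.var 0) (.var 5)) .nop (.assign 5 (.mul (.const 2) (.var 5))))))))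

/-- The list `l` of leaves is stored in the memory. -/
def StoresLeaves (s : State) (l : List (ℕ × ℕ)) : Prop :=
  l = (List.range (s.var 7)).map fun i => (s.arr 11 i, s.arr 12 i)

theorem StoresLeaves.length {s : State} {l : List (ℕ × ℕ)} (h : StoresLeaves s l) :
    s.var 7 = l.length := by rw [h]; simp

theorem StoresLeaves.congr {s s' : State} {l : List (ℕ × ℕ)} (h : StoresLeaves s l)
    (h7 : s'.var 7 = s.var 7) (h11 : s'.arr 11 = s.arr 11) (h12 : s'.arr 12 = s.arr 12) :
    StoresLeaves s' l := by
  rw [StoresLeaves, h7, h11, h12]; exact h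

theorem StoresLeaves.snoc {s s' : State} {l : List (ℕ × ℕ)} {y : ℕ × ℕ} (h : StoresLeaves s l)
    (h7 : s'.var 7 = s.var 7 + 1) (h11 : s'.arr 11 = Function.update (s.arr 11) (s.var 7) y.1)
    (h12 : s'.arr 12 = Function.update (s.arr 12) (s.var 7) y.2) :
    StoresLeaves s' (l ++ [y]) := by
  rw [StoresLeaves, h7, h11, h12, List.range_succ, List.map_append, h]
  congr 1
  · refine List.map_congr_left fun i hi => ?_
    have hne : i ≠ s.var 7 := (List.mem_range.1 hi).ne
    simp [Function.update_of_ne hne]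
  · simp

/-- Bounds the length of the partial list by that of the whole, so that the leaf counter cannot
overflow. -/
theorem flatMap_range_prefix {α : Type*} (f : ℕ → List α) {a N : ℕ} (h : a < N) :
    ((List.range a).flatMap f ++ f a) <+: (List.range N).flatMap f := by
  induction N with
  | zero => omega
  | succ N ih =>
    rw [List.range_succ, List.flatMap_append]
    simp only [List.flatMap_cons, List.flatMap_nil, List.append_nil]
    rcases Nat.lt_succ_iff_lt_or_eq.1 h with h | rfl
    · exact (ih h).trans (List.prefix_append _ _)
    · exact List.prefix_rfl

/-- `2 ^ b` may be too large for a word. Once it exceeds `n`, any `p > n` serves as well, because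
both quotients of `k ≤ n` are zero. -/
theorem pieceProg_run {B n o k j p b : ℕ} {σ : ℕ → ℕ} {s : State} {l : List (ℕ × ℕ)}
    (hB : n * (n + 1) + 4 * n + 10 < B) (h3 : s.var 3 = j) (h5 : s.var 5 = p)
    (hok : o + k ≤ n) (h9 : s.arr 9 j = k) (h10 : s.arr 10 j = o) (hσ : s.arr 5 = σ)
    (hp : p = 2 ^ b ∨ n < p ∧ n < 2 ^ b) (hpn : p ≤ 2 * n)
    (hl : StoresLeaves s l) (hlen : (l ++ piece σ o k j b).length ≤ n) :
    Run B pieceProg s (40 * (n + 1)) fun s' => StoresLeaves s' (l ++ piece σ o k j b) := by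
  have hk1 : k / p * p = k / 2 ^ b * 2 ^ b := by
    rcases hp with rfl | ⟨h1, h2⟩
    · rfl
    · rw [Nat.div_eq_of_lt (by omega), Nat.div_eq_of_lt (by omega)]; simp
  have hk2 : k / (2 * p) * (2 * p) = k / 2 ^ (b + 1) * 2 ^ (b + 1) := by
    rcases hp with rfl | ⟨h1, h2⟩
    · rw [pow_succ']
    · rw [Nat.div_eq_of_lt (by omega), Nat.div_eq_of_lt (by rw [pow_succ']; omega)]; simp
  set lo := k / 2 ^ (b + 1) * 2 ^ (b + 1) with hlo
  set hi := k / 2 ^ b * 2 ^ b with hhi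
  have hle : hi ≤ k := Nat.div_mul_le_self _ _
  have hlohi : lo ≤ hi := by have := div_two_pow_eq k b; omega
  have hc1 : 1 % B = 1 := Nat.mod_eq_of_lt (by omega)
  have hc2 : 2 % B = 2 := Nat.mod_eq_of_lt (by omega)
  have e1 : (2 * p) % B = 2 * p := Nat.mod_eq_of_lt (by omega)
  have e2 : lo % B = lo := Nat.mod_eq_of_lt (by omega)
  have e3 : hi % B = hi := Nat.mod_eq_of_lt (by omega)
  have e4 : (o + lo) % B = o + lo := Nat.mod_eq_of_lt (by omega)
  have e5 : (o + hi) % B = o + hi := Nat.mod_eq_of_lt (by omega)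
  refine Run.seq (T₁ := 30) (T₂ := n * (20 + 7) + 3)
    (P := fun s' => s'.var 4 = o + lo ∧ s'.var 6 = o + hi)
    (Run.flat rfl (by decide) ?_) (fun s1 ⟨h14, h16⟩ f1 => ?_) (by omega)
  · simp only [Prog.run, Expr.eval, setVar_var, setVar_arr, h3, h5, h9, h10, hc2, e1, hk1,
      hk2, e2, e3,
      e4, e5, if_true, Nat.reduceEqDiff, if_false]
    exact ⟨trivial, trivial⟩
  have h13 : s1.var 3 = j := (f1.var 3 rfl).trans h3
  have hσ1 : s1.arr 5 = σ := (f1.arr 5 rfl).trans hσ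
  have hl1 := hl.congr (f1.var 7 rfl) (f1.arr 11 rfl) (f1.arr 12 rfl)
  have hplen : (piece σ o k j b).length = hi - lo := by simp [piece, hlo, hhi]
  rw [List.length_append, hplen] at hlen
  refine Run.forTo (fun x s' => StoresLeaves s' (l ++ (List.range' (o + lo) (x - (o + lo))).map
      fun x => (j, σ x))) rfl rfl h14 h16 (by omega) (by omega) (by simpa using hl1) ?_ ?_
    (Nat.add_le_add_right (Nat.mul_le_mul_right _ (by omega)) _)
  · intro x s2 hx1 hx2 hx f2 hl2
    have h23 : s2.var 3 = j := (f2.var 3 rfl).trans h13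
    have hσ2 : s2.arr 5 = σ := (f2.arr 5 rfl).trans hσ1
    have h27 := hl2.length
    simp only [List.length_append, List.length_map, List.length_range'] at h27
    have e6 : (s2.var 7 + 1) % B = s2.var 7 + 1 := Nat.mod_eq_of_lt (by omega)
    refine Run.flat rfl (by decide) ?_
    have hx3 : x + 1 - (o + lo) = x - (o + lo) + 1 := by omega
    have hx4 : o + lo + (x - (o + lo)) = x := by omega
    rw [hx3, List.range'_concat, List.map_append, ← List.append_assoc, one_mul, hx4]
    refine hl2.snoc ?_ ?_ ?_
    · simp [emitStep, Prog.run, Expr.eval, hc1, e6]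
    · simp [emitStep, Prog.run, Expr.eval, h23]
    · simp [emitStep, Prog.run, Expr.eval, hσ2, hx]
  · intro s2 _ _ hl2
    have : o + hi - (o + lo) = hi - lo := by omega
    rwa [this] at hl2

/-- A crude linear bound for each of the quadratically many blocks already gives cubic time. -/
theorem orderProg_run {B n : ℕ} {σ : ℕ → ℕ} {s : State} {ks : List ℕ}
    (hB : n * (n + 1) + 4 * n + 10 < B) (hn0 : 0 < n) (hn : s.var 0 = n) (hσ : s.arr 5 = σ)
    (hks : StoresProfile s ks) (hN : ks.length ≤ n) (hsum : ks.sum = n)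
    (hlen : (leafSeq σ ks).length = n) :
    Run B orderProg s (200 * (n + 1) ^ 3) fun s' => StoresLeaves s' (leafSeq σ ks) := by
  set N := ks.length with hNdef
  have hc1 : 1 % B = 1 := Nat.mod_eq_of_lt (by omega)
  have hc2 : 2 % B = 2 := Nat.mod_eq_of_lt (by omega)
  have hok : ∀ j < N, offset ks j + ks.getD j 0 ≤ n := by
    intro j hj
    have h1 := List.sum_take_succ ks j hj
    have h2 := List.sum_take_add_sum_drop ks (j + 1)
    rw [offset, List.getD_eq_getElem _ _ hj]
    omega
  set g : ℕ → ℕ → List (ℕ × ℕ) := fun d b =>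
    piece σ (offset ks (d + b)) (ks.getD (d + b) 0) (d + b) b with hg
  set f : ℕ → List (ℕ × ℕ) := fun d => (List.range (N - d)).flatMap (g d) with hf
  have hseq : leafSeq σ ks = (List.range N).flatMap f := rfl
  refine Run.seq (T₁ := 4) (T₂ := n * ((6 + (n * ((40 * (n + 1) + 10) + 7) + 3)) + 7) + 3)
    (P := fun s' => s'.var 2 = 0 ∧ s'.var 7 = 0)
    (Run.flat rfl (by decide) ?_) (fun s1 ⟨h12, h17⟩ f1 => ?_) (by ring_nf; nlinarith [sq_nonneg n])
  · simp [Prog.run, Expr.eval]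
  refine Run.forTo (fun d s' => StoresLeaves s' ((List.range d).flatMap f)) rfl rfl h12
    ((f1.var 11 rfl).trans hks.1) (Nat.zero_le _) (by omega) (by simp [StoresLeaves, h17]) ?_
    (fun s' _ _ h => h) (Nat.add_le_add_right (Nat.mul_le_mul_right _ (by omega)) _)
  intro d s2 _ hdN h22 f2 hl2
  have hpre1 := (flatMap_range_prefix f hdN).length_le
  rw [← hseq, hlen, List.length_append] at hpre1
  refine Run.seq (T₁ := 6) (T₂ := n * ((40 * (n + 1) + 10) + 7) + 3)
    (P := fun s' => s'.var 3 = d ∧ s'.var 5 = 1 ∧ s'.arr = s2.arr)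
    (Run.flat rfl (by decide) ?_) (fun s3 ⟨h33, h35, ha3⟩ f3 => ?_) le_rfl
  · simp [Prog.run, Expr.eval, h22, hc1]
  have hl3 := hl2.congr (f3.var 7 rfl) (congrFun ha3 11) (congrFun ha3 12)
  refine Run.forTo (fun j s' => StoresLeaves s' ((List.range d).flatMap f ++
      (List.range (j - d)).flatMap (g d)) ∧ (s'.var 5 = 2 ^ (j - d) ∨
        n < s'.var 5 ∧ n < 2 ^ (j - d)) ∧ s'.var 5 ≤ 2 * n) rfl rfl h33
    (((f3.var 11 rfl).trans (f2.var 11 rfl)).trans ((f1.var 11 rfl).trans hks.1)) hdN.le (by omega)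
    ⟨by simpa using hl3, by simp [h35], by omega⟩ ?_ ?_
    (Nat.add_le_add_right (Nat.mul_le_mul_right _ (by omega)) _)
  · intro j s4 hdj hjN h43 f4 ⟨hl4, hp4, hp4'⟩
    have hj : d + (j - d) = j := by omega
    have hpre2 := (flatMap_range_prefix (g d) (show j - d < N - d by omega)).length_le
    have hgd : g d (j - d) = piece σ (offset ks j) (ks.getD j 0) j (j - d) := by
      rw [hg]; simp only [hj]
    rw [List.length_append] at hpre2
    have hpre3 : (f d).length = ((List.range (N - d)).flatMap (g d)).length := rfl
    have h9 : s4.arr 9 = s.arr 9 :=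
      (f4.arr 9 rfl).trans ((f3.arr 9 rfl).trans ((f2.arr 9 rfl).trans (f1.arr 9 rfl)))
    have h10 : s4.arr 10 = s.arr 10 :=
      (f4.arr 10 rfl).trans ((f3.arr 10 rfl).trans ((f2.arr 10 rfl).trans (f1.arr 10 rfl)))
    have h5 : s4.arr 5 = σ :=
      (f4.arr 5 rfl).trans ((f3.arr 5 rfl).trans ((f2.arr 5 rfl).trans ((f1.arr 5 rfl).trans hσ)))
    have hn4 : s4.var 0 = n :=
      (f4.var 0 rfl).trans ((f3.var 0 rfl).trans ((f2.var 0 rfl).trans ((f1.var 0 rfl).trans hn)))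
    refine Run.seq (T₂ := 10) (pieceProg_run hB h43 rfl (hok j hjN) (by rw [h9, (hks.2 j hjN).1])
      (by rw [h10, (hks.2 j hjN).2]) h5 hp4 hp4' hl4 (by
        rw [← hgd, List.length_append, List.length_append]; omega)) (fun s5 hl5 f5 => ?_) le_rfl
    have hn5 : s5.var 0 = n := (f5.var 0 rfl).trans hn4
    have h55 : s5.var 5 = s4.var 5 := f5.var 5 rfl
    refine Run.flat rfl (by decide) ?_
    have hj2 : j + 1 - d = j - d + 1 := by omega
    rw [hj2, List.range_succ, List.flatMap_append, ← List.append_assoc]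
    simp only [List.flatMap_cons, List.flatMap_nil, List.append_nil, hgd]
    simp only [Prog.run, Test.holds, Expr.eval, hn5, h55, hc2]
    split_ifs with hlt
    · refine ⟨hl5.congr rfl rfl rfl, ?_, ?_⟩
      · right
        simp only [setVar_var, Nat.reduceEqDiff, if_false, h55]
        have : 2 ^ (j - d + 1) = 2 * 2 ^ (j - d) := pow_succ' _ _
        rcases hp4 with h | ⟨_, h⟩ <;> omega
      · simpa [h55] using hp4'
    · have hp : s4.var 5 = 2 ^ (j - d) := hp4.resolve_right fun h => hlt h.1
      have e : (2 * s4.var 5) % B = 2 * s4.var 5 := Nat.mod_eq_of_lt (by omega)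
      refine ⟨hl5.congr rfl rfl rfl, .inl ?_, ?_⟩
      · rw [pow_succ', ← hp]; simp [e]
      · simp [e]; omega
  · intro s4 _ _ ⟨hl4, _⟩
    change StoresLeaves (s4.setVar 2 (d + 1)) _
    rw [List.range_succ, List.flatMap_append]
    simp only [List.flatMap_cons, List.flatMap_nil, List.append_nil]
    exact hl4.congr rfl rfl rfl

end SkeletonCode

namespace SkeletonCode

/-! ### Building the trees -/

/-- Merge the tree in the variable `3` with the top of the stack. -/
def mergeStep : Prog :=
  .seq (.assign 7 (.get 13 (.sub (.var 6) (.const 1))))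
  (.seq (.store 2 (.var 4) (.var 7))
  (.seq (.store 3 (.var 4) (.var 3))
  (.seq (.branch (.both (.eq (.get 15 (.var 7)) (.get 15 (.var 3)))
      (.neg (.eq (.get 15 (.var 7)) (.const 0))))
    (.seq (.store 15 (.var 4) (.add (.get 15 (.var 7)) (.const 1)))
      (.seq (.store 0 (.var 4) (.const 0)) (.store 1 (.var 4) (.const 0))))
    (.seq (.store 15 (.var 4) (.const 0))
      (.seq (.store 0 (.var 4) (.var 7)) (.store 1 (.var 4) (.var 3)))))
  (.seq (.assign 3 (.var 4))
  (.seq (.assign 4 (.add (.var 4) (.const 1)))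
  (.seq (.assign 6 (.sub (.var 6) (.const 1)))
    (.assign 5 (.sub (.var 5) (.const 1)))))))))

/-- Merge as long as the top of the stack has the same depth. -/
def mergeLoop : Prog :=
  .loop (.both (.lt (.const 0) (.var 6)) (.eq (.get 14 (.sub (.var 6) (.const 1))) (.var 5)))
    mergeStep

/-- Create the leaf number `2` of the list of leaves. -/
def leafStep : Prog :=
  .seq (.store 2 (.var 4) (.const 0))
  (.seq (.store 3 (.var 4) (.const 0))
  (.seq (.store 0 (.var 4) (.const 0))
  (.seq (.store 1 (.var 4) (.const 0))
  (.seq (.store 4 (.var 4) (.get 12 (.var 2)))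
  (.seq (.store 15 (.var 4) (.const 1))
  (.seq (.assign 3 (.var 4))
  (.seq (.assign 5 (.get 11 (.var 2)))
    (.assign 4 (.add (.var 4) (.const 1))))))))))

/-- Put the current tree on the stack. -/
def stackStep : Prog :=
  .seq (.store 13 (.var 6) (.var 3)) (.seq (.store 14 (.var 6) (.var 5))
    (.assign 6 (.add (.var 6) (.const 1))))

/-- Build the tree from the list of leaves. -/
def buildProg : Prog :=
  .seq (.seq (.assign 2 (.const 0)) (.seq (.assign 4 (.const 1)) (.assign 6 (.const 0))))
  (.seq (.forTo 2 0 (.seq leafStep (.seq mergeLoop stackStep)))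
    (.seq (.assign 1 (.get 13 (.const 0))) (.assign 0 (.get 13 (.const 0)))))

theorem LTree.Linked.congr {L R L' R' : ℕ → ℕ} {t : LTree} (h : t.Linked L R)
    (hL : ∀ v ∈ t.ids, L' v = L v) (hR : ∀ v ∈ t.ids, R' v = R v) : t.Linked L' R' := by
  induction t with
  | leaf v i =>
    simp only [LTree.ids, List.mem_singleton, forall_eq] at hL hR
    exact ⟨h.1, hL.trans h.2.1, hR.trans h.2.2⟩
  | node v l r ihl ihr =>
    obtain ⟨h1, h2, h3, h4, h5⟩ := h
    simp only [LTree.ids, List.mem_cons, List.mem_append] at hL hR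
    exact ⟨h1, (hL v (.inl rfl)).trans h2, (hR v (.inl rfl)).trans h3,
      ihl h4 (fun x hx => hL x (.inr (.inl hx))) (fun x hx => hR x (.inr (.inl hx))),
      ihr h5 (fun x hx => hL x (.inr (.inr hx))) (fun x hx => hR x (.inr (.inr hx)))⟩

theorem LTree.Labelled.congr {A A' : ℕ → ℕ} {t : LTree} (h : t.Labelled A)
    (hA : ∀ v ∈ t.ids, A' v = A v) : t.Labelled A' := by
  induction t with
  | leaf v i => exact (hA v (by simp [LTree.ids])).trans h
  | node v l r ihl ihr =>
    simp only [LTree.ids, List.mem_cons, List.mem_append] at hA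
    exact ⟨ihl h.1 fun x hx => hA x (.inr (.inl hx)), ihr h.2 fun x hx => hA x (.inr (.inr hx))⟩

/-- The tree `t` and its skeleton are stored at addresses below `nx`. -/
structure StoresLTree (s : State) (nx : ℕ) (t : LTree) : Prop where
  linked : t.Linked (s.arr 2) (s.arr 3)
  skel : t.skel.Linked (s.arr 0) (s.arr 1)
  labelled : t.Labelled (s.arr 4)
  ph : s.arr 15 t.root = t.ph
  ph_lt : t.ph < nx
  ids_lt : ∀ v ∈ t.ids, v < nx

/-- The arrays of trees in the states `s` and `s'` agree below `nx`. -/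
def AgreeBelow (nx : ℕ) (s s' : State) : Prop :=
  ∀ v < nx, s'.arr 0 v = s.arr 0 v ∧ s'.arr 1 v = s.arr 1 v ∧ s'.arr 2 v = s.arr 2 v ∧
    s'.arr 3 v = s.arr 3 v ∧ s'.arr 4 v = s.arr 4 v ∧ s'.arr 15 v = s.arr 15 v

theorem StoresLTree.congr {s s' : State} {nx nx' : ℕ} {t : LTree} (h : StoresLTree s nx t)
    (hs : AgreeBelow nx s s') (hnx : nx ≤ nx') : StoresLTree s' nx' t where
  linked := h.linked.congr (fun v hv => (hs v (h.ids_lt v hv)).2.2.1)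
    (fun v hv => (hs v (h.ids_lt v hv)).2.2.2.1)
  skel := h.skel.congr
    (fun v hv => (hs v (h.ids_lt v (t.skel_ids_sublist.subset hv))).1)
    (fun v hv => (hs v (h.ids_lt v (t.skel_ids_sublist.subset hv))).2.1)
  labelled := h.labelled.congr fun v hv => (hs v (h.ids_lt v hv)).2.2.2.2.1
  ph := ((hs _ (h.ids_lt _ t.root_mem_ids)).2.2.2.2.2).trans h.ph
  ph_lt := h.ph_lt.trans_le hnx
  ids_lt := fun v hv => (h.ids_lt v hv).trans_le hnx

/-- The stack `st` is stored in the memory. -/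
def StoresStack (s : State) (nx : ℕ) : List (ℕ × LTree) → Prop
  | [] => True
  | (d, t) :: st => s.arr 13 st.length = t.root ∧ s.arr 14 st.length = d ∧ StoresLTree s nx t ∧
      StoresStack s nx st

theorem StoresStack.congr {s s' : State} {nx nx' : ℕ} {st : List (ℕ × LTree)}
    (h : StoresStack s nx st) (hs : AgreeBelow nx s s') (hnx : nx ≤ nx')
    (h13 : ∀ i < st.length, s'.arr 13 i = s.arr 13 i)
    (h14 : ∀ i < st.length, s'.arr 14 i = s.arr 14 i) : StoresStack s' nx' st := by
  induction st with
  | nil => trivial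
  | cons x st ih =>
    obtain ⟨h1, h2, h3, h4⟩ := h
    simp only [List.length_cons] at h13 h14
    exact ⟨(h13 _ (by omega)).trans h1, (h14 _ (by omega)).trans h2, h3.congr hs hnx,
      ih h4 (fun i hi => h13 i (by omega)) (fun i hi => h14 i (by omega))⟩

/-- The skeleton is built along with the tree at the same addresses. If the new node is perfect, its
skeleton pointers are null and the skeletons of its children become unreachable; nothing below `nx`
is altered. -/
theorem mergeStep_run {B nx d : ℕ} {s : State} {u t : LTree} {k : ℕ} (hB : nx + 1 < B)
    (hnx : nx ≠ 0) (h3 : s.var 3 = t.root) (h4 : s.var 4 = nx) (h5 : s.var 5 = d)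
    (h6 : s.var 6 = k + 1) (h13 : s.arr 13 k = u.root) (hu : StoresLTree s nx u)
    (ht : StoresLTree s nx t) : Run B mergeStep s 80 fun s' => s'.var 3 = nx ∧ s'.var 4 = nx + 1 ∧
      s'.var 5 = d - 1 ∧ s'.var 6 = k ∧ StoresLTree s' (nx + 1) (.node nx u t) ∧
      AgreeBelow nx s s' := by
  have hc1 : 1 % B = 1 := Nat.mod_eq_of_lt (by omega)
  have e1 : (nx + 1) % B = nx + 1 := Nat.mod_eq_of_lt (by omega)
  have e2 : (u.ph + 1) % B = u.ph + 1 := Nat.mod_eq_of_lt (by have := hu.ph_lt; omega)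
  refine Run.flat rfl (by decide) ?_
  set s' := mergeStep.run B s with hs'
  have key : s'.var 3 = nx ∧ s'.var 4 = nx + 1 ∧ s'.var 5 = d - 1 ∧ s'.var 6 = k ∧
      s'.arr 2 = Function.update (s.arr 2) nx u.root ∧
      s'.arr 3 = Function.update (s.arr 3) nx t.root ∧
      s'.arr 0 = Function.update (s.arr 0) nx (if u.ph = t.ph ∧ u.ph ≠ 0 then 0 else u.root) ∧
      s'.arr 1 = Function.update (s.arr 1) nx (if u.ph = t.ph ∧ u.ph ≠ 0 then 0 else t.root) ∧
      s'.arr 15 = Function.update (s.arr 15) nx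
        (if u.ph = t.ph ∧ u.ph ≠ 0 then u.ph + 1 else 0) ∧ s'.arr 4 = s.arr 4 := by
    rw [hs']
    by_cases hc : u.ph = t.ph ∧ u.ph ≠ 0
    · have h0 : t.ph ≠ 0 := hc.1 ▸ hc.2
      rw [hc.1] at e2
      simp [mergeStep, Prog.run, Expr.eval, Test.holds, h3, h4, h5, h6, h13, hc1, e1, e2,
        hu.ph, ht.ph,
        hc.1, h0]
    · simp [mergeStep, Prog.run, Expr.eval, Test.holds, h3, h4, h5, h6, h13, hc1, e1, hu.ph, ht.ph,
        hc]
  obtain ⟨k3, k4, k5, k6, a2, a3, a0, a1, a15, a4⟩ := key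
  have hagree : AgreeBelow nx s s' := fun v hv => by
    rw [a0, a1, a2, a3, a4, a15]
    simp [Function.update_of_ne hv.ne]
  have hu' := hu.congr hagree (Nat.le_succ nx)
  have ht' := ht.congr hagree (Nat.le_succ nx)
  refine ⟨k3, k4, k5, k6, ⟨⟨hnx, by simp [a2], by simp [a3], hu'.linked, ht'.linked⟩, ?_,
    ⟨hu'.labelled, ht'.labelled⟩, by simp [a15, LTree.ph], ?_, ?_⟩, hagree⟩
  · by_cases hc : u.ph = t.ph ∧ u.ph ≠ 0
    · have : (LTree.node nx u t).ph ≠ 0 := by simp only [LTree.ph, if_pos hc]; omega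
      rw [LTree.skel, if_neg this]
      exact ⟨hnx, by rw [a0, if_pos hc, Function.update_self],
        by rw [a1, if_pos hc, Function.update_self]⟩
    · have : (LTree.node nx u t).ph = 0 := by simp only [LTree.ph, if_neg hc]
      rw [LTree.skel, if_pos this]
      exact ⟨hnx, by simp [a0, hc, LTree.skel_root], by simp [a1, hc, LTree.skel_root],
        hu'.skel, ht'.skel⟩
  · have := hu.ph_lt
    simp only [LTree.ph]; split_ifs <;> omega
  · intro v hv
    simp only [LTree.ids, List.mem_cons, List.mem_append] at hv
    rcases hv with rfl | hv | hv
    · omega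
    · exact hu'.ids_lt v hv
    · exact ht'.ids_lt v hv

/-- Each merge uses one new address and pops one entry, so `nx` plus the height of the stack is
constant. -/
theorem mergeLoop_run {B : ℕ} (st : List (ℕ × LTree)) {nx d : ℕ} {s : State} {t : LTree}
    (hB : nx + st.length + 1 < B) (hnx : nx ≠ 0) (h3 : s.var 3 = t.root) (h4 : s.var 4 = nx)
    (h5 : s.var 5 = d) (h6 : s.var 6 = st.length) (ht : StoresLTree s nx t)
    (hst : StoresStack s nx st) : Run B mergeLoop s (st.length * 100 + 20) fun s' =>
      ∃ nx' d' t' st', merge st nx d t = (nx', (d', t') :: st') ∧ s'.var 3 = t'.root ∧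
        s'.var 4 = nx' ∧ s'.var 5 = d' ∧ s'.var 6 = st'.length ∧ StoresLTree s' nx' t' ∧
        StoresStack s' nx' st' ∧ nx' + st'.length = nx + st.length ∧ nx' ≠ 0 := by
  have hc1 : 1 % B = 1 := Nat.mod_eq_of_lt (by omega)
  induction st generalizing nx d s t with
  | nil =>
    refine Run.loop_done
      (by simpa [Test.holds, Expr.eval] using fun h => absurd h6 (by simp; omega))
      (by decide) ⟨nx, d, t, [], rfl, h3, h4, h5, h6, ht, hst, rfl, hnx⟩
  | cons x st ih =>
    obtain ⟨e, u⟩ := x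
    obtain ⟨i1, i2, i3, i4⟩ := hst
    rw [List.length_cons] at h6
    have htest : (Test.both (.lt (.const 0) (.var 6))
        (.eq (.get 14 (.sub (.var 6) (.const 1))) (.var 5))).holds B s ↔ e = d := by
      simp [Test.holds, Expr.eval, h6, hc1, i2, h5]
    by_cases hed : e = d
    · simp only [merge, if_pos hed]
      refine Run.loop_next (T₂ := st.length * 100 + 20) (htest.2 hed)
        (mergeStep_run (by omega) hnx h3 h4 h5 h6 i1 i3 ht)
        (fun s' ⟨j3, j4, j5, j6, j7, j8⟩ f => ?_) ?_
      · refine (ih (nx := nx + 1) (d := d - 1) (t := .node nx u t) ?_ (by omega) j3 j4 j5 j6 j7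
          (i4.congr j8 (by omega) (fun i _ => by rw [f.arr 13 rfl])
            (fun i _ => by rw [f.arr 14 rfl]))).mono le_rfl ?_
        · rw [List.length_cons] at hB; omega
        · rintro s'' ⟨nx', d', t', st', k1, k2, k3, k4, k5, k6, k7, k8, k9⟩ _
          exact ⟨nx', d', t', st', k1, k2, k3, k4, k5, k6, k7, by rw [List.length_cons]; omega, k9⟩
      · simp only [Test.time, Expr.time, List.length_cons]; omega
    · refine Run.loop_done (fun h => hed (htest.1 h)) ?_ ⟨nx, d, t, (e, u) :: st, ?_,
        h3, h4, h5, ?_,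
        ht, ⟨i1, i2, i3, i4⟩, rfl, hnx⟩
      · simp only [Test.time, Expr.time]; omega
      · rw [merge, if_neg hed]
      · rw [h6, List.length_cons]

theorem leafStep_run {B nx i : ℕ} {s : State} (hB : nx + 1 < B) (hnx : nx ≠ 0)
    (h2 : s.var 2 = i) (h4 : s.var 4 = nx) : Run B leafStep s 40 fun s' => s'.var 3 = nx ∧
      s'.var 4 = nx + 1 ∧ s'.var 5 = s.arr 11 i ∧
      StoresLTree s' (nx + 1) (.leaf nx (s.arr 12 i)) ∧ AgreeBelow nx s s' := by
  have hc1 : 1 % B = 1 := Nat.mod_eq_of_lt (by omega)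
  have e1 : (nx + 1) % B = nx + 1 := Nat.mod_eq_of_lt (by omega)
  refine Run.flat rfl (by decide) ?_
  refine ⟨by simp [leafStep, Prog.run, Expr.eval, h4],
    by simp [leafStep, Prog.run, Expr.eval, h4, hc1, e1],
    by simp [leafStep, Prog.run, Expr.eval, h2], ⟨⟨hnx, ?_, ?_⟩, ⟨hnx, ?_, ?_⟩, ?_, ?_, ?_, ?_⟩,
    fun v hv => ?_⟩
  · simp [leafStep, Prog.run, Expr.eval, h4]
  · simp [leafStep, Prog.run, Expr.eval, h4]
  · simp [leafStep, Prog.run, Expr.eval, h4]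
  · simp [leafStep, Prog.run, Expr.eval, h4]
  · simp [leafStep, Prog.run, Expr.eval, h4, h2, LTree.Labelled]
  · simp [leafStep, Prog.run, Expr.eval, h4, LTree.ph, hc1]
  · simp [LTree.ph]; omega
  · simp [LTree.ids]
  · simp [leafStep, Prog.run, Expr.eval, h4, Function.update_of_ne hv.ne]

/-- The next free address plus the stack height is `2 * p + 1` after `p` leaves: a leaf adds one to
each, and merging preserves the sum. This bounds all addresses and the work of every merge loop. -/
theorem buildProg_run {B n nx : ℕ} {s : State} {l : List (ℕ × ℕ)} {t : LTree}
    (hB : 2 * n + 3 < B) (hn : s.var 0 = n) (hlen : l.length = n)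
    (hl : l = (List.range n).map fun i => (s.arr 11 i, s.arr 12 i))
    (ht : l.foldl push (1, []) = (nx, [(0, t)])) :
    Run B buildProg s (300 * (n + 1) ^ 2) fun s' => s'.var 0 = t.root ∧ s'.var 1 = t.root ∧
      t.Linked (s'.arr 2) (s'.arr 3) ∧ t.skel.Linked (s'.arr 0) (s'.arr 1) ∧
      t.Labelled (s'.arr 4) := by
  have hc1 : 1 % B = 1 := Nat.mod_eq_of_lt (by omega)
  refine Run.seq (T₁ := 6) (T₂ := (n * ((n * 200 + 80) + 7) + 3) + 10)
    (P := fun s' => s'.var 2 = 0 ∧ s'.var 4 = 1 ∧ s'.var 6 = 0)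
    (Run.flat rfl (by decide) ?_) (fun s1 ⟨h12, h14, h16⟩ f1 => ?_) (by nlinarith)
  · simp [Prog.run, Expr.eval, hc1]
  refine Run.seq (T₁ := n * ((n * 200 + 80) + 7) + 3) (T₂ := 10)
    (P := fun s' => StoresStack s' nx [(0, t)])
    (Run.forTo (fun p s' => s'.var 4 = ((l.take p).foldl push (1, [])).1 ∧
      s'.var 6 = ((l.take p).foldl push (1, [])).2.length ∧
      StoresStack s' ((l.take p).foldl push (1, [])).1 ((l.take p).foldl push (1, [])).2 ∧
      s'.var 4 + s'.var 6 = 2 * p + 1 ∧ s'.var 4 ≠ 0) rfl rfl h12 ((f1.var 0 rfl).trans hn)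
      (Nat.zero_le _) (by omega) (by simp [h14, h16, StoresStack]) ?_ ?_ le_rfl)
    (fun s2 h2 f2 => ?_) le_rfl
  · intro p s2 _ hpn h22 f2 ⟨j4, j6, jst, jsum, jnx⟩
    have hp : p < l.length := by omega
    have hget : l[p] = (s2.arr 11 p, s2.arr 12 p) := by
      have e11 : s2.arr 11 = s.arr 11 := (f2.arr 11 rfl).trans (f1.arr 11 rfl)
      have e12 : s2.arr 12 = s.arr 12 := (f2.arr 12 rfl).trans (f1.arr 12 rfl)
      rw [e11, e12]
      simp only [hl, List.getElem_map, List.getElem_range]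
    rw [List.take_add_one, List.getElem?_eq_getElem hp, hget, Option.toList_some, List.foldl_append]
    generalize (l.take p).foldl push (1, []) = z at j4 j6 jst
    obtain ⟨nz, st⟩ := z
    simp only at j4 j6 jst
    rw [j4] at jnx jsum
    rw [j6] at jsum
    simp only [List.foldl_cons, List.foldl_nil, push]
    refine Run.seq (T₁ := 40) (T₂ := (n * 200 + 40)) (leafStep_run (by omega) jnx h22 j4)
      (fun s3 ⟨k3, k4, k5, k6, k7⟩ f3 => ?_) (by omega)
    have hst3 : StoresStack s3 (nz + 1) st := jst.congr k7 (by omega)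
      (fun i _ => by rw [f3.arr 13 rfl]) (fun i _ => by rw [f3.arr 14 rfl])
    refine Run.seq (T₂ := 20) (mergeLoop_run st (nx := nz + 1) (t := .leaf nz (s2.arr 12 p))
      (by omega)
      (by omega) k3 k4 k5 ((f3.var 6 rfl).trans j6) k6 hst3)
      (fun s4 ⟨nx', d', t', st', m1, m2, m3, m4, m5, m6, m7, m8, m9⟩ f4 => ?_) (by omega)
    rw [m1]
    have e1 : (st'.length + 1) % B = st'.length + 1 := Nat.mod_eq_of_lt (by omega)
    refine Run.flat rfl (by decide) ⟨?_, ?_, ⟨?_, ?_, ?_, ?_⟩, ?_, ?_⟩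
    · simp [stackStep, Prog.run, Expr.eval, m3]
    · simp [stackStep, Prog.run, Expr.eval, m5, hc1, e1]
    · simp [stackStep, Prog.run, Expr.eval, m5, m2]
    · simp [stackStep, Prog.run, Expr.eval, m5, m4]
    · refine m6.congr (fun v _ => ?_) le_rfl
      simp [stackStep, Prog.run]
    · refine m7.congr (fun v _ => ?_) le_rfl (fun i hi => ?_) (fun i hi => ?_)
      · simp [stackStep, Prog.run]
      · simp [stackStep, Prog.run, Expr.eval, m5, Function.update_of_ne hi.ne]
      · simp [stackStep, Prog.run, Expr.eval, m5, Function.update_of_ne hi.ne]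
    · simp [stackStep, Prog.run, Expr.eval, m3, m5, hc1, e1]; omega
    · simpa [stackStep, Prog.run, Expr.eval, m3] using m9
  · intro s2 _ _ ⟨j4, j6, jst, _⟩
    rw [List.take_of_length_le hlen.le, ht] at jst
    exact jst
  · obtain ⟨i1, _, i3, _⟩ := h2
    simp only [List.length_nil] at i1
    refine Run.flat rfl (by decide) ⟨?_, ?_, i3.linked, i3.skel, i3.labelled⟩
    · simp [Prog.run, Expr.eval, i1]
    · simp [Prog.run, Expr.eval, i1]

end SkeletonCode

/-! ### Assembly of the algorithm -/

namespace SkeletonCode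

/-- The program that constructs an optimal skeleton tree. -/
def skeletonProg : Prog :=
  .seq sortProg (.seq suffixProg (.seq bitCountProg (.seq dpProg
    (.seq levelProg (.seq orderProg buildProg)))))

theorem length_leafSeq (σ : ℕ → ℕ) {ks : List ℕ} (hks : ∀ j, ks.getD j 0 < 2 ^ (j + 1)) :
    (leafSeq σ ks).length = ks.sum := by
  have h := sum_leafSeq σ (fun _ => 1) hks
  have h2 : ∑ j ∈ Finset.range ks.length, ks.getD j 0 = ks.sum := by
    rw [Finset.sum_range, ← List.sum_ofFn]
    congr 1
    exact List.ext_getElem (by simp) fun j hj hj' => by simp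
  rw [← h2]; simpa using h

theorem skeletonProg_run {n : ℕ} (hn : 0 < n) (w : Fin n → ℝ) (hw : ∀ i, 0 < w i) {B : ℕ}
    (hB : n * (n + 1) + 4 * n + 10 < B) :
    Run B skeletonProg (initState w) (1300 * (n + 1) ^ 3) fun s => ∃ c : Fin n → List Bool,
      HasOptimalSkeleton w c ∧ Outputs s c := by
  set s0 := initState w with hs0
  have h0 : s0.var 0 = n := rfl
  set u := s0.wt 0 with hu
  have huw : ∀ i : Fin n, u i = w i := fun i => by simp [hu, hs0, initState]
  have hpow : (n + 1) ^ 2 ≤ (n + 1) ^ 3 := Nat.pow_le_pow_right (by omega) (by omega)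
  have hpow1 : n + 1 ≤ (n + 1) ^ 3 := Nat.le_self_pow (by omega) _
  refine Run.seq (T₂ := 100 * (n + 1) ^ 2 + (100 * (n + 1) ^ 2 + (400 * (n + 1) ^ 3 +
    (100 * (n + 1) + (200 * (n + 1) ^ 3 + 300 * (n + 1) ^ 2))))) (sortProg_run h0 (by omega))
    (fun s1 hsort f1 => ?_) (by omega)
  have h1 : s1.var 0 = n := (f1.var 0 rfl).trans h0
  refine Run.seq (suffixProg_run h1 (by omega) (by
    rw [f1.wt 2 rfl]; simp [hs0, initState])) (fun s2 hsuf f2 => ?_) le_rfl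
  have h2 : s2.var 0 = n := (f2.var 0 rfl).trans h1
  refine Run.seq (bitCountProg_run h2 (by omega) (by
    rw [f2.arr 6 rfl, f1.arr 6 rfl]; rfl)) (fun s3 hbit f3 => ?_) le_rfl
  have h3 : s3.var 0 = n := (f3.var 0 rfl).trans h2
  have hW : ∀ m ≤ n, s3.wt 2 m = ∑ x ∈ Finset.Ico m n, s1.wt 1 x := by rw [f3.wt 2 rfl]; exact hsuf
  refine Run.seq (dpProg_run hB h3 (by simpa using hW n le_rfl) hbit) (fun s4 hdp f4 => ?_) le_rfl
  have h4 : s4.var 0 = n := (f4.var 0 rfl).trans h3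
  refine Run.seq (levelProg_run hB hn h4 (Q := fun a b => s4.arr 8 (idx n a b))
    (fun a b hb hba ha => by
      obtain ⟨q1, q2, q3, _⟩ := (hdp a b hb hba ha.le).2 ha
      exact ⟨q1, q2, q3⟩) (fun _ _ => rfl)) (fun s5 ⟨ks, hfol, hks⟩ f5 => ?_) le_rfl
  have h5 : s5.var 0 = n := (f5.var 0 rfl).trans h4
  obtain ⟨hprof, _, _⟩ := hfol.spec (by simpa using hW n le_rfl) hdp le_rfl le_rfl hn
  have hsum : ks.sum = n := by simpa using hprof.sum_eq le_rfl
  have hlen := length_leafSeq (s1.arr 5) hprof.getD_lt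
  have hσ5 : s5.arr 5 = s1.arr 5 :=
    (f5.arr 5 rfl).trans ((f4.arr 5 rfl).trans ((f3.arr 5 rfl).trans (f2.arr 5 rfl)))
  refine Run.seq (orderProg_run hB hn h5 hσ5 hks (by have := hprof.length_add_le; omega) hsum
    (hlen.trans hsum)) (fun s6 hord f6 => ?_) le_rfl
  have h6 : s6.var 0 = n := (f6.var 0 rfl).trans h5
  obtain ⟨nx, t, ht, a1, a2, a3, a4, a5⟩ := exists_tree_of_leafSeq hprof
    (sorted_image fun i hi => (hsort i hi).1)
    (fun x hx => (sorted_weight (fun i hi => (hsort i hi).1) (fun i hi => (hsort i hi).2) hx).2) hW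
  have hl := hord
  rw [StoresLeaves, hord.length, hlen, hsum] at hl
  refine (buildProg_run (by omega) h6 (hlen.trans hsum) hl ht).mono le_rfl ?_
  rintro s7 ⟨b0, b1, b2, b3, b4⟩ _
  exact ⟨_, hasOptimalSkeleton hn hw huw (fun i hi => (hsort i hi).2) hW hdp hfol a1 a2 a4 a5,
    outputs_path a1 a2 a3 b0 b1 b3 b2 b4⟩

end SkeletonCode

/-- There is one program, with constants `k` and `C`, that for all `n ≥ 1` and all positive weights
`w`, with words of at least `k * log (n + 2)` bits, constructs an optimal skeleton tree (and the
optimal code that it comes from) in at most `C * n ^ 3` steps. -/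
theorem theorem1 :
    ∃ (p : SkeletonCode.Prog) (k C : ℕ),
      ∀ (n : ℕ), 0 < n → ∀ (w : Fin n → ℝ), (∀ i, 0 < w i) →
        ∀ (B : ℕ), (n + 2) ^ k ≤ B →
          ∃ (t : ℕ) (s : SkeletonCode.State) (c : Fin n → List Bool),
            SkeletonCode.Exec B p (SkeletonCode.initState w) t s ∧
            t ≤ C * n ^ 3 ∧
            SkeletonCode.HasOptimalSkeleton w c ∧
            SkeletonCode.Outputs s c := by
  -- The exponent `4` makes the modulus exceed the quadratic bound on the integers even for `n = 1`.
  -- The constant is `1300 * 8`, from `n + 1 ≤ 2 * n`.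
  refine ⟨SkeletonCode.skeletonProg, 4, 10400, fun n hn w hw B hB => ?_⟩
  have hB' : n * (n + 1) + 4 * n + 10 < B := by
    refine lt_of_lt_of_le ?_ hB
    have h : (n + 2) ^ 4 = ((n + 2) ^ 2) * ((n + 2) ^ 2) := by ring
    have h9 : 9 ≤ (n + 2) ^ 2 := by nlinarith
    rw [h]
    nlinarith
  obtain ⟨t, s, he, ht, c, hc, ho⟩ := SkeletonCode.skeletonProg_run hn w hw hB'
  refine ⟨t, s, c, he, ht.trans ?_, hc, ho⟩
  calc 1300 * (n + 1) ^ 3 ≤ 1300 * (2 * n) ^ 3 := by gcongr; omega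
    _ = 10400 * n ^ 3 := by ring
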